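/- Let $\alpha_0,\alpha_1,\alpha_2,\alpha_\infty,\nu\in\mathbb C$ and $\eta\in\mathbb C^{\times}$ satisfy $\alpha_0+\alpha_1+\alpha_2+\alpha_\infty=1-2\nu$, and assume that they are generic in the sense that none of the numbers $$\alpha_1,\quad \alpha_\infty,\quad \alpha_1\pm\alpha_\infty,\quad \alpha_0\pm\alpha_2,\quad \alpha_0\pm\alpha_2\pm\alpha_\infty$$ is an integer. Define the Hamiltonians $H_1,H_2$ by $$\begin{aligned} s_1^2H_1={}&q_1^2(q_1-s_1)p_1^2+2q_1^2q_2p_1p_2+q_1q_2(q_2-s_2)p_2^2\\ &-\bigl[(\alpha_0+\alpha_2-1)q_1^2+\alpha_1q_1(q_1-s_1)+\eta(q_1-s_1)+\eta s_1q_2\bigr]p_1\\ &-\bigl[(\alpha_0+\alpha_1-1)q_1q_2+\alpha_2q_1(q_2-s_2)-\eta(s_2-1)q_2\bigr]p_2+\nu(\nu+\alpha_\infty)q_1,\\ s_2(s_2-1)H_2={}&q_1^2q_2p_1^2+2q_1q_2(q_2-s_2)p_1p_2+\Bigl[q_2(q_2-1)(q_2-s_2)+\tfrac{s_2(s_2-1)}{s_1}q_1q_2\Bigr]p_2^2\\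 &-\bigl[(\alpha_0+\alpha_1-1)q_1q_2+\alpha_2q_1(q_2-s_2)-\eta(s_2-1)q_2\bigr]p_1\\ &-\Bigl[(\alpha_0-1)q_2(q_2-1)+\alpha_1q_2(q_2-s_2)+\alpha_2(q_2-1)(q_2-s_2)+\tfrac{s_2(s_2-1)}{s_1}(\alpha_2q_1+\eta q_2)\Bigr]p_2+\nu(\nu+\alpha_\infty)q_2 . \end{aligned}$$ With $t_1=1/s_1$, consider the Hamiltonian system $\mathcal H_2(1112)$: for $i=1,2$, $$-t_1\frac{\partial q_i}{\partial t_1}=s_1\frac{\partial H_1}{\partial p_i},\qquad t_1\frac{\partial p_i}{\partial t_1}=s_1\frac{\partial H_1}{\partial q_i},\qquad \frac{\partial q_i}{\partial s_2}=\frac{\partial H_2}{\partial p_i},\qquad -\frac{\partial p_i}{\partial s_2}=\frac{\partial H_2}{\partial q_i}.$$ Let $R=\mathbb C\{\{t_1,s_2\}\}$ be the ring of convergent power series in $t_1,s_2$ at the origin, and let $\langle u_1,\dots,u_n\rangle$ denote an unspecified element of the ideal of $R$ generated by $u_1,\dots,u_n$. Then the system has eight (pairwise distinct) meromorphic solutions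 around $(t_1,s_2)=(0,0)$, with the following leading terms. $$\begin{aligned} (1)\ & q_1=\tfrac{\eta}{\alpha_\infty}+\langle t_1,s_2\rangle,\quad q_2=\tfrac{\alpha_\infty+\alpha_1}{\alpha_\infty}+\langle t_1,s_2\rangle,\\ & p_1=\tfrac{-\nu(\nu+\alpha_2)\alpha_\infty}{(\alpha_\infty+\alpha_1)(1-\alpha_\infty-\alpha_1)}t_1s_2+\langle t_1^3,t_1^2s_2,s_2^2\rangle,\quad p_2=\tfrac{-\nu\alpha_\infty}{\alpha_\infty+\alpha_1}+\langle t_1,s_2\rangle;\\ (2)\ & q_1=\tfrac{-\eta}{\alpha_\infty}+\langle t_1,s_2\rangle,\quad q_2=\tfrac{\alpha_\infty-\alpha_1}{\alpha_\infty}+\langle t_1,s_2\rangle,\\ & p_1=\tfrac{-(\nu+\alpha_\infty)(\nu+\alpha_2+\alpha_\infty)\alpha_\infty}{(\alpha_\infty-\alpha_1)(1+\alpha_\infty-\alpha_1)}t_1s_2+\langle t_1^3,t_1^2s_2,s_2^2\rangle,\quad p_2=\tfrac{-(\nu+\alpha_\infty)\alpha_\infty}{\alpha_\infty-\alpha_1}+\langle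 t_1,s_2\rangle;\\ (3)\ & q_1=\tfrac{-\eta}{\alpha_1}+\langle t_1,s_2\rangle,\quad q_2=s_2\bigl(\tfrac{\alpha_2}{\alpha_0+\alpha_2}+\langle t_1,s_2\rangle\bigr),\\ & p_1=\tfrac{\nu(\nu+\alpha_\infty)}{1-\alpha_1}t_1+\langle s_2,t_1^2\rangle,\quad p_2=\tfrac1{s_2}\bigl(\tfrac{\nu(\nu+\alpha_\infty)}{1-\alpha_0-\alpha_2}s_2+\langle t_1^2,t_1s_2,s_2^2\rangle\bigr);\\ (4)\ & q_1=\tfrac{-\eta}{\alpha_1}+\langle t_1,s_2\rangle,\quad q_2=s_2\bigl(\tfrac{\alpha_2}{\alpha_2-\alpha_0}+\langle t_1,s_2\rangle\bigr),\\ & p_1=\tfrac{(\nu+\alpha_2)(\nu+\alpha_2+\alpha_\infty)}{1-\alpha_1}t_1+\langle s_2,t_1^2\rangle,\quad p_2=\tfrac1{s_2}\bigl(\alpha_2-\alpha_0+\langle t_1,s_2\rangle\bigr);\\ (5)\ & q_1=\tfrac1{t_1}\bigl(\tfrac{\alpha_\infty+\alpha_0+\alpha_2}{\alpha_\infty}+\langle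 t_1,s_2\rangle\bigr),\quad q_2=\tfrac{-\alpha_2}{\alpha_\infty}s_2+\langle t_1^2,t_1s_2,s_2^2\rangle,\\ & p_1=t_1\bigl(\tfrac{-\nu\alpha_\infty}{\alpha_\infty+\alpha_0+\alpha_2}+\langle t_1,s_2\rangle\bigr),\quad p_2=\tfrac{\eta\nu\alpha_\infty}{(\alpha_1+2\nu)(\alpha_\infty+\alpha_0+\alpha_2)}t_1+\langle s_2,t_1^2\rangle;\\ (6)\ & q_1=\tfrac1{t_1}\bigl(\tfrac{\alpha_\infty-\alpha_0-\alpha_2}{\alpha_\infty}+\langle t_1,s_2\rangle\bigr),\quad q_2=\tfrac{\alpha_2}{\alpha_\infty}s_2+\langle t_1^2,t_1s_2,s_2^2\rangle,\\ & p_1=t_1\bigl(\tfrac{-(\nu+\alpha_\infty)\alpha_\infty}{\alpha_\infty-\alpha_0-\alpha_2}+\langle t_1,s_2\rangle\bigr),\quad p_2=\tfrac{\eta\alpha_\infty(\nu+\alpha_\infty)}{(\alpha_\infty-\alpha_0-\alpha_2)(1+\alpha_\infty-\alpha_0-\alpha_2)}t_1+\langle s_2,t_1^2\rangle;\\ (7)\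 & q_1=\tfrac1{t_1}\bigl(\tfrac{\alpha_\infty+\alpha_0-\alpha_2}{\alpha_\infty}+\langle t_1,s_2\rangle\bigr),\quad q_2=s_2\bigl(\tfrac{\alpha_2}{\alpha_\infty}+\langle t_1,s_2\rangle\bigr),\\ & p_1=t_1\bigl(\tfrac{-(\nu+\alpha_2)\alpha_\infty}{\alpha_\infty+\alpha_0-\alpha_2}+\langle t_1,s_2\rangle\bigr),\quad p_2=\tfrac1{s_2}\bigl(\alpha_\infty+\langle t_1,s_2\rangle\bigr);\\ (8)\ & q_1=\tfrac1{t_1}\bigl(\tfrac{\alpha_\infty-\alpha_0+\alpha_2}{\alpha_\infty}+\langle t_1,s_2\rangle\bigr),\quad q_2=s_2\bigl(\tfrac{-\alpha_2}{\alpha_\infty}+\langle t_1,s_2\rangle\bigr),\\ & p_1=t_1\bigl(\tfrac{-(\nu+\alpha_2+\alpha_\infty)\alpha_\infty}{\alpha_\infty-\alpha_0+\alpha_2}+\langle t_1,s_2\rangle\bigr),\quad p_2=\tfrac1{s_2}\bigl(-\alpha_\infty+\langle t_1,s_2\rangle\bigr). \end{aligned}$$ Moreover, for each $k=1,\dots,8$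 the higher-order terms are uniquely determined by the system: any solution $(q_1,q_2,p_1,p_2)$ of the system in formal Laurent series $\mathbb C[[t_1,s_2]][t_1^{-1},s_2^{-1}]$ with the leading terms $(k)$ (the ideals now being taken in $\mathbb C[[t_1,s_2]]$) coincides with solution $(k)$; and the series converge: on some polydisc $|t_1|<r$, $|s_2|<r$ with $t_1s_2\neq0$ they sum to a solution that is meromorphic on the polydisc with poles at most along $t_1s_2=0$. -/

import Mathlib

namespace Garnier

/-! ## Parameters -/

/-- The complex parameters `α₀, α₁, α₂, α_∞, ν, η`; `a8` stands for `α_∞`. -/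
structure Params where
  a0 : ℂ
  a1 : ℂ
  a2 : ℂ
  a8 : ℂ
  nu : ℂ
  eta : ℂ

/-- The (Fuchs) relation satisfied by the parameters of the system. -/
def Params.Relation (P : Params) : Prop :=
  P.a0 + P.a1 + P.a2 + P.a8 = 1 - 2 * P.nu

/-- Genericity: `η ≠ 0`, and none of
`α₁, α_∞, α₁ ± α_∞, α₀ ± α₂, α₀ ± α₂ ± α_∞` is an integer. -/
structure Params.Generic (P : Params) : Prop where
  eta_ne : P.eta ≠ 0
  a1_ne : ∀ n : ℤ, P.a1 ≠ n
  a8_ne : ∀ n : ℤ, P.a8 ≠ n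
  a1_add_a8_ne : ∀ n : ℤ, P.a1 + P.a8 ≠ n
  a1_sub_a8_ne : ∀ n : ℤ, P.a1 - P.a8 ≠ n
  a0_add_a2_ne : ∀ n : ℤ, P.a0 + P.a2 ≠ n
  a0_sub_a2_ne : ∀ n : ℤ, P.a0 - P.a2 ≠ n
  a0_add_a2_add_a8_ne : ∀ n : ℤ, P.a0 + P.a2 + P.a8 ≠ n
  a0_add_a2_sub_a8_ne : ∀ n : ℤ, P.a0 + P.a2 - P.a8 ≠ n
  a0_sub_a2_add_a8_ne : ∀ n : ℤ, P.a0 - P.a2 + P.a8 ≠ n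
  a0_sub_a2_sub_a8_ne : ∀ n : ℤ, P.a0 - P.a2 - P.a8 ≠ n

/-! ## The Hamiltonian system

Everything is written over a commutative `ℂ`-algebra `K` in which `t₁`, `s₂` and `s₂ - 1` are
invertible. It is used for `K = ℂ` (the system at a point) and for a ring of formal Laurent series
(the system for formal expansions). `Ring.inverse` is the inverse of an invertible element.
The variables `X 0, X 1, X 2, X 3` are `q₁, q₂, p₁, p₂`. -/

section System

open MvPolynomial

variable {K : Type*} [CommRing K] [Algebra ℂ K]

/-- A complex number as a constant polynomial. -/
noncomputable def cst (K : Type*) [CommRing K] [Algebra ℂ K] (c : ℂ) : MvPolynomial (Fin 4) K :=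
  C (algebraMap ℂ K c)

/-- `s₁² H₁` as a polynomial in `q₁, q₂, p₁, p₂`, where `s1 = s₁`, `s2 = s₂`. -/
noncomputable def scaledH1 (P : Params) (s1 s2 : K) : MvPolynomial (Fin 4) K :=
  let q1 : MvPolynomial (Fin 4) K := X 0
  let q2 : MvPolynomial (Fin 4) K := X 1
  let p1 : MvPolynomial (Fin 4) K := X 2
  let p2 : MvPolynomial (Fin 4) K := X 3
  q1 ^ 2 * (q1 - C s1) * p1 ^ 2 + 2 * q1 ^ 2 * q2 * p1 * p2 + q1 * q2 * (q2 - C s2) * p2 ^ 2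
    - (cst K (P.a0 + P.a2 - 1) * q1 ^ 2 + cst K P.a1 * q1 * (q1 - C s1)
        + cst K P.eta * (q1 - C s1) + cst K P.eta * C s1 * q2) * p1
    - (cst K (P.a0 + P.a1 - 1) * q1 * q2 + cst K P.a2 * q1 * (q2 - C s2)
        - cst K P.eta * (C s2 - 1) * q2) * p2
    + cst K (P.nu * (P.nu + P.a8)) * q1

/-- `s₂ (s₂ - 1) H₂` as a polynomial in `q₁, q₂, p₁, p₂`. -/
noncomputable def scaledH2 (P : Params) (s1 s2 : K) : MvPolynomial (Fin 4) K :=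
  let q1 : MvPolynomial (Fin 4) K := X 0
  let q2 : MvPolynomial (Fin 4) K := X 1
  let p1 : MvPolynomial (Fin 4) K := X 2
  let p2 : MvPolynomial (Fin 4) K := X 3
  let u : MvPolynomial (Fin 4) K := C (s2 * (s2 - 1) * Ring.inverse s1)
  q1 ^ 2 * q2 * p1 ^ 2 + 2 * q1 * q2 * (q2 - C s2) * p1 * p2
    + (q2 * (q2 - 1) * (q2 - C s2) + u * q1 * q2) * p2 ^ 2
    - (cst K (P.a0 + P.a1 - 1) * q1 * q2 + cst K P.a2 * q1 * (q2 - C s2)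
        - cst K P.eta * (C s2 - 1) * q2) * p1
    - (cst K (P.a0 - 1) * q2 * (q2 - 1) + cst K P.a1 * q2 * (q2 - C s2)
        + cst K P.a2 * (q2 - 1) * (q2 - C s2)
        + u * (cst K P.a2 * q1 + cst K P.eta * q2)) * p2
    + cst K (P.nu * (P.nu + P.a8)) * q2

/-- The Hamiltonian `H₁`. -/
noncomputable def H1 (P : Params) (s1 s2 : K) : MvPolynomial (Fin 4) K :=
  C (Ring.inverse (s1 ^ 2)) * scaledH1 P s1 s2

/-- The Hamiltonian `H₂`. -/
noncomputable def H2 (P : Params) (s1 s2 : K) : MvPolynomial (Fin 4) K :=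
  C (Ring.inverse (s2 * (s2 - 1))) * scaledH2 P s1 s2

/-- The eight equations of the Hamiltonian system in the variables `t = t₁ = 1 / s₁` and `s = s₂`,
for the values `z = (q₁, q₂, p₁, p₂)`, with `dt` and `ds` the partial derivatives of `z` with
respect to `t₁` and `s₂`. -/
structure HamiltonEqs (P : Params) (t s : K) (z dt ds : Fin 4 → K) : Prop where
  q1_t : -t * dt 0 = Ring.inverse t * eval z (pderiv 2 (H1 P (Ring.inverse t) s))
  q2_t : -t * dt 1 = Ring.inverse t * eval z (pderiv 3 (H1 P (Ring.inverse t) s))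
  p1_t : t * dt 2 = Ring.inverse t * eval z (pderiv 0 (H1 P (Ring.inverse t) s))
  p2_t : t * dt 3 = Ring.inverse t * eval z (pderiv 1 (H1 P (Ring.inverse t) s))
  q1_s : ds 0 = eval z (pderiv 2 (H2 P (Ring.inverse t) s))
  q2_s : ds 1 = eval z (pderiv 3 (H2 P (Ring.inverse t) s))
  p1_s : -ds 2 = eval z (pderiv 0 (H2 P (Ring.inverse t) s))
  p2_s : -ds 3 = eval z (pderiv 1 (H2 P (Ring.inverse t) s))

end System

/-! ## Power series and Laurent series in two variables -/

/-- Formal power series in `t₁` (variable `0`) and `s₂` (variable `1`). -/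
abbrev Pow : Type := MvPowerSeries (Fin 2) ℂ

/-- The power series `t₁`. -/
noncomputable def tP : Pow := MvPowerSeries.X 0

/-- The power series `s₂`. -/
noncomputable def sP : Pow := MvPowerSeries.X 1

/-- Convergence (in some polydisc around the origin) of a formal power series. -/
def IsConvergent (F : Pow) : Prop :=
  ∃ r : ℝ, 0 < r ∧ Summable fun n : Fin 2 →₀ ℕ => ‖MvPowerSeries.coeff n F‖ * r ^ (n 0 + n 1)

theorem IsConvergent.of_finite {F : Pow}
    (h : {n | MvPowerSeries.coeff n F ≠ 0}.Finite) : IsConvergent F := by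
  refine ⟨1, one_pos, summable_of_hasFiniteSupport (h.subset ?_)⟩
  intro n hn h0
  exact hn (by simp [h0])

theorem IsConvergent.shrink {F : Pow} {r r' : ℝ} (h0 : 0 ≤ r') (hr : r' ≤ r)
    (h : Summable fun n : Fin 2 →₀ ℕ => ‖MvPowerSeries.coeff n F‖ * r ^ (n 0 + n 1)) :
    Summable fun n : Fin 2 →₀ ℕ => ‖MvPowerSeries.coeff n F‖ * r' ^ (n 0 + n 1) :=
  h.of_nonneg_of_le (fun _ => by positivity) (fun _ => by gcongr)

theorem IsConvergent.add {F G : Pow} (hF : IsConvergent F) (hG : IsConvergent G) :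
    IsConvergent (F + G) := by
  obtain ⟨r, hr, hF⟩ := hF
  obtain ⟨r', hr', hG⟩ := hG
  have hm : 0 < min r r' := lt_min hr hr'
  refine ⟨min r r', hm, ?_⟩
  refine ((IsConvergent.shrink hm.le (min_le_left _ _) hF).add
    (IsConvergent.shrink hm.le (min_le_right _ _) hG)).of_nonneg_of_le
    (fun _ => by positivity) (fun n => ?_)
  rw [map_add, ← add_mul]
  gcongr
  exact norm_add_le _ _

theorem IsConvergent.mul_aux {F G : Pow} {r : ℝ} (hr : 0 ≤ r)
    (hF : Summable fun n : Fin 2 →₀ ℕ => ‖MvPowerSeries.coeff n F‖ * r ^ (n 0 + n 1))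
    (hG : Summable fun n : Fin 2 →₀ ℕ => ‖MvPowerSeries.coeff n G‖ * r ^ (n 0 + n 1)) :
    Summable fun n : Fin 2 →₀ ℕ => ‖MvPowerSeries.coeff n (F * G)‖ * r ^ (n 0 + n 1) := by
  have hp : Summable fun x : (Fin 2 →₀ ℕ) × (Fin 2 →₀ ℕ) =>
      (‖MvPowerSeries.coeff x.1 F‖ * r ^ (x.1 0 + x.1 1)) *
        (‖MvPowerSeries.coeff x.2 G‖ * r ^ (x.2 0 + x.2 1)) :=
    hF.mul_of_nonneg hG (fun _ => by positivity) (fun _ => by positivity)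
  have h := summable_sum_mul_antidiagonal_of_summable_mul
    (f := fun n : Fin 2 →₀ ℕ => ‖MvPowerSeries.coeff n F‖ * r ^ (n 0 + n 1))
    (g := fun n : Fin 2 →₀ ℕ => ‖MvPowerSeries.coeff n G‖ * r ^ (n 0 + n 1)) hp
  refine h.of_nonneg_of_le (fun _ => by positivity) (fun n => ?_)
  rw [MvPowerSeries.coeff_mul]
  refine (mul_le_mul_of_nonneg_right (norm_sum_le _ _) (by positivity)).trans (le_of_eq ?_)
  rw [Finset.sum_mul]
  refine Finset.sum_congr rfl (fun p hp => ?_)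
  rw [Finset.HasAntidiagonal.mem_antidiagonal] at hp
  rw [← hp, norm_mul, Finsupp.add_apply, Finsupp.add_apply]
  ring

theorem IsConvergent.mul {F G : Pow} (hF : IsConvergent F) (hG : IsConvergent G) :
    IsConvergent (F * G) := by
  obtain ⟨r, hr, hF⟩ := hF
  obtain ⟨r', hr', hG⟩ := hG
  have hm : 0 < min r r' := lt_min hr hr'
  exact ⟨min r r', hm, IsConvergent.mul_aux hm.le
    (IsConvergent.shrink hm.le (min_le_left r r') hF)
    (IsConvergent.shrink hm.le (min_le_right r r') hG)⟩

/-- The ring `R = ℂ{t₁, s₂}` of convergent power series. -/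
noncomputable def R : Subring Pow where
  carrier := {F | IsConvergent F}
  mul_mem' := IsConvergent.mul
  add_mem' := IsConvergent.add
  one_mem' := IsConvergent.of_finite ((Set.finite_singleton 0).subset fun n hn => by
    classical
    by_contra h
    exact hn (by rw [MvPowerSeries.coeff_one]; exact if_neg h))
  zero_mem' := IsConvergent.of_finite (by simp)
  neg_mem' := by
    rintro F ⟨r, hr, h⟩
    exact ⟨r, hr, by simpa using h⟩

/-- Formal Laurent series in `t₁, s₂` with poles of finite order along `t₁ s₂ = 0`, that is
`ℂ[[t₁, s₂]][t₁⁻¹, s₂⁻¹]`: families of coefficients indexed by `ℤ × ℤ` whose support is partially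
well ordered for the product order (equivalently, bounded below in both exponents). -/
abbrev Laurent : Type := HahnSeries (ℤ × ℤ) ℂ

/-- The monomial `c t₁ⁱ s₂ʲ`. -/
noncomputable def mono (i j : ℤ) (c : ℂ) : Laurent := HahnSeries.single (i, j) c

/-- The exponent embedding `ℕ² → ℤ²`. -/
def expo : (Fin 2 →₀ ℕ) →+ ℤ × ℤ where
  toFun n := (n 0, n 1)
  map_zero' := by simp
  map_add' m n := by simp

theorem expo_le (m n : Fin 2 →₀ ℕ) : expo m ≤ expo n ↔ m ≤ n := by
  simp [expo, Finsupp.le_def, Fin.forall_fin_two]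

/-- The inclusion of power series into Laurent series. -/
noncomputable def toL : Pow →+* Laurent :=
  (HahnSeries.embDomainRingHom expo
    (fun m n h => le_antisymm ((expo_le m n).1 h.le) ((expo_le n m).1 h.ge)) expo_le).comp
    (HahnSeries.toMvPowerSeries (R := ℂ) (σ := Fin 2)).symm.toRingHom

theorem toL_coeff (F : Pow) (n : Fin 2 →₀ ℕ) :
    (toL F).coeff (n 0, n 1) = MvPowerSeries.coeff n F :=
  HahnSeries.embDomain_coeff (f := ⟨⟨expo, _⟩, fun {a b} => expo_le a b⟩) (a := n)

/-- The operator `t₁ ∂/∂t₁` on Laurent series. -/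
noncomputable def eulerT (x : Laurent) : Laurent where
  coeff n := n.1 * x.coeff n
  isPWO_support' := x.isPWO_support.mono fun n hn => by
    intro h; exact hn (by simp [h])

/-- The operator `s₂ ∂/∂s₂` on Laurent series. -/
noncomputable def eulerS (x : Laurent) : Laurent where
  coeff n := n.2 * x.coeff n
  isPWO_support' := x.isPWO_support.mono fun n hn => by
    intro h; exact hn (by simp [h])

/-- `∂/∂t₁` on Laurent series. -/
noncomputable def dT (x : Laurent) : Laurent := mono (-1) 0 1 * eulerT x

/-- `∂/∂s₂` on Laurent series. -/
noncomputable def dS (x : Laurent) : Laurent := mono 0 (-1) 1 * eulerS x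

theorem dT_coeff (x : Laurent) (i j : ℤ) :
    (dT x).coeff (i, j) = (i + 1) * x.coeff (i + 1, j) := by
  have h : ((i, j) : ℤ × ℤ) = (i + 1, j) + (-1, 0) := by simp
  rw [dT, mono, h, HahnSeries.coeff_single_mul_add]
  simp [eulerT]

theorem dS_coeff (x : Laurent) (i j : ℤ) :
    (dS x).coeff (i, j) = (j + 1) * x.coeff (i, j + 1) := by
  have h : ((i, j) : ℤ × ℤ) = (i, j + 1) + (0, -1) := by simp
  rw [dS, mono, h, HahnSeries.coeff_single_mul_add]
  simp [eulerS]

/-- `z = (q₁, q₂, p₁, p₂)` is a formal Laurent series solution of the Hamiltonian system. -/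
def IsFormalSolution (P : Params) (z : Fin 4 → Laurent) : Prop :=
  HamiltonEqs P (mono 1 0 1) (mono 0 1 1) z (fun i => dT (z i)) (fun i => dS (z i))

/-- Together with `isUnit_s_mul`: the denominators occurring in the formal system are invertible,
so that `Ring.inverse` is the true inverse there. -/
theorem isUnit_mono (i j : ℤ) : IsUnit (mono i j 1) :=
  IsUnit.of_mul_eq_one (mono (-i) (-j) 1) (by
    simp only [mono, HahnSeries.single_mul_single, Prod.mk_add_mk, add_neg_cancel, mul_one]
    rfl)

theorem toL_sP : toL sP = mono 0 1 1 := by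
  classical
  ext ⟨i, j⟩
  by_cases h : ∃ n : Fin 2 →₀ ℕ, expo n = (i, j)
  · obtain ⟨n, hn⟩ := h
    have h2 : ((i, j) : ℤ × ℤ) = ((n 0 : ℤ), (n 1 : ℤ)) := hn.symm
    rw [h2, toL_coeff, sP, MvPowerSeries.coeff_X, mono, HahnSeries.coeff_single]
    congr 1
    simp [Finsupp.ext_iff, Fin.forall_fin_two]
  · have h1 : (toL sP).coeff (i, j) = 0 :=
      HahnSeries.embDomain_of_notMem_range (fun ⟨n, hn⟩ => h ⟨n, hn⟩)
    rw [h1, mono, HahnSeries.coeff_single, if_neg]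
    intro h3
    exact h ⟨Finsupp.single 1 1, by rw [h3]; simp [expo]⟩

theorem isUnit_s_mul : IsUnit (mono 0 1 1 * (mono 0 1 1 - 1)) := by
  refine (isUnit_mono 0 1).mul ?_
  rw [← toL_sP, ← map_one toL, ← map_sub]
  refine IsUnit.map toL ?_
  rw [MvPowerSeries.isUnit_iff_constantCoeff]
  simp [sP]

/-! ## Leading terms -/

/-- `x = m (l + ⟨S⟩)`: the Laurent series `x` is `m` times the sum of `l` and an element of the
ideal generated by `S` in the ring `A` of power series (`A = R`, or `A = ⊤` for all formal power
series). -/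
def HasForm (A : Subring Pow) (m l : Laurent) (S : Set Pow) (x : Laurent) : Prop :=
  ∃ f : A, f ∈ Ideal.span ((fun a : A => (a : Pow)) ⁻¹' S) ∧ x = m * (l + toL f)

/-- The leading terms of the eight solutions; the index `k` stands for solution `k + 1`. The error
terms are taken in ideals of the ring `A` of power series. -/
def Leading (A : Subring Pow) (P : Params) (k : Fin 8) (z : Fin 4 → Laurent) : Prop :=
  let t : Pow := tP
  let s : Pow := sP
  let a0 := P.a0
  let a1 := P.a1
  let a2 := P.a2
  let a8 := P.a8
  let nu := P.nu
  let eta := P.eta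
  match k with
  | 0 =>
    HasForm A 1 (mono 0 0 (eta / a8)) {t, s} (z 0) ∧
    HasForm A 1 (mono 0 0 ((a8 + a1) / a8)) {t, s} (z 1) ∧
    HasForm A 1 (mono 1 1 (-nu * (nu + a2) * a8 / ((a8 + a1) * (1 - a8 - a1))))
      {t ^ 3, t ^ 2 * s, s ^ 2} (z 2) ∧
    HasForm A 1 (mono 0 0 (-nu * a8 / (a8 + a1))) {t, s} (z 3)
  | 1 =>
    HasForm A 1 (mono 0 0 (-eta / a8)) {t, s} (z 0) ∧
    HasForm A 1 (mono 0 0 ((a8 - a1) / a8)) {t, s} (z 1) ∧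
    HasForm A 1 (mono 1 1 (-(nu + a8) * (nu + a2 + a8) * a8 / ((a8 - a1) * (1 + a8 - a1))))
      {t ^ 3, t ^ 2 * s, s ^ 2} (z 2) ∧
    HasForm A 1 (mono 0 0 (-(a8 + nu) / (a8 - a1) * a8)) {t, s} (z 3)
  | 2 =>
    HasForm A 1 (mono 0 0 (-eta / a1)) {t, s} (z 0) ∧
    HasForm A (mono 0 1 1) (mono 0 0 (a2 / (a0 + a2))) {t, s} (z 1) ∧
    HasForm A 1 (mono 1 0 (nu * (nu + a8) / (1 - a1))) {s, t ^ 2} (z 2) ∧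
    HasForm A (mono 0 (-1) 1) (mono 0 1 (nu * (nu + a8) / (1 - a0 - a2)))
      {t ^ 2, t * s, s ^ 2} (z 3)
  | 3 =>
    HasForm A 1 (mono 0 0 (-eta / a1)) {t, s} (z 0) ∧
    HasForm A (mono 0 1 1) (mono 0 0 (a2 / (a2 - a0))) {t, s} (z 1) ∧
    HasForm A 1 (mono 1 0 ((nu + a2) * (nu + a2 + a8) / (1 - a1))) {s, t ^ 2} (z 2) ∧
    HasForm A (mono 0 (-1) 1) (mono 0 0 (a2 - a0)) {t, s} (z 3)
  | 4 =>
    HasForm A (mono (-1) 0 1) (mono 0 0 ((a8 + a0 + a2) / a8)) {t, s} (z 0) ∧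
    HasForm A 1 (mono 0 1 (-a2 / a8)) {t ^ 2, t * s, s ^ 2} (z 1) ∧
    HasForm A (mono 1 0 1) (mono 0 0 (-nu * a8 / (a8 + a0 + a2))) {t, s} (z 2) ∧
    HasForm A 1 (mono 1 0 (eta * nu * a8 / ((a1 + 2 * nu) * (a8 + a0 + a2)))) {s, t ^ 2} (z 3)
  | 5 =>
    HasForm A (mono (-1) 0 1) (mono 0 0 ((a8 - a0 - a2) / a8)) {t, s} (z 0) ∧
    HasForm A 1 (mono 0 1 (a2 / a8)) {t ^ 2, t * s, s ^ 2} (z 1) ∧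
    HasForm A (mono 1 0 1) (mono 0 0 (-(nu + a8) * a8 / (a8 - a0 - a2))) {t, s} (z 2) ∧
    HasForm A 1 (mono 1 0 (eta * a8 * (nu + a8) / ((a8 - a0 - a2) * (1 + a8 - a0 - a2))))
      {s, t ^ 2} (z 3)
  | 6 =>
    HasForm A (mono (-1) 0 1) (mono 0 0 ((a8 + a0 - a2) / a8)) {t, s} (z 0) ∧
    HasForm A (mono 0 1 1) (mono 0 0 (a2 / a8)) {t, s} (z 1) ∧
    HasForm A (mono 1 0 1) (mono 0 0 (-(nu + a2) * a8 / (a8 + a0 - a2))) {t, s} (z 2) ∧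
    HasForm A (mono 0 (-1) 1) (mono 0 0 a8) {t, s} (z 3)
  | 7 =>
    HasForm A (mono (-1) 0 1) (mono 0 0 ((a8 - a0 + a2) / a8)) {t, s} (z 0) ∧
    HasForm A (mono 0 1 1) (mono 0 0 (-a2 / a8)) {t, s} (z 1) ∧
    HasForm A (mono 1 0 1) (mono 0 0 (-(nu + a2 + a8) * a8 / (a8 - a0 + a2))) {t, s} (z 2) ∧
    HasForm A (mono 0 (-1) 1) (mono 0 0 (-a8)) {t, s} (z 3)

/-! ## Meromorphic solutions -/

/-- The polydisc of radius `r` around the origin. -/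
def polydisc (r : ℝ) : Set (ℂ × ℂ) := {x | ‖x.1‖ < r ∧ ‖x.2‖ < r}

/-- The polydisc without the two lines `t₁ = 0` and `s₂ = 0`. -/
def puncturedPolydisc (r : ℝ) : Set (ℂ × ℂ) := {x ∈ polydisc r | x.1 ≠ 0 ∧ x.2 ≠ 0}

/-- The function `f` is meromorphic on the polydisc, with poles at most along `t₁ s₂ = 0`. -/
def IsMeromorphic (r : ℝ) (f : ℂ × ℂ → ℂ) : Prop :=
  ∃ m n : ℕ, ∃ g : ℂ × ℂ → ℂ, DifferentiableOn ℂ g (polydisc r) ∧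
    ∀ x ∈ puncturedPolydisc r, f x = g x / (x.1 ^ m * x.2 ^ n)

/-- The Laurent series `x` converges to `f` on the punctured polydisc. -/
def ConvergesTo (r : ℝ) (x : Laurent) (f : ℂ × ℂ → ℂ) : Prop :=
  ∀ y ∈ puncturedPolydisc r, HasSum (fun n : ℤ × ℤ => x.coeff n * y.1 ^ n.1 * y.2 ^ n.2) (f y)

/-- `f = (q₁, q₂, p₁, p₂)` is a meromorphic solution of the Hamiltonian system on the polydisc of
radius `r`. The system itself is required where its coefficients are defined. -/
def IsMeromorphicSolution (P : Params) (r : ℝ) (f : Fin 4 → ℂ × ℂ → ℂ) : Prop :=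
  (∀ i, IsMeromorphic r (f i)) ∧
  ∀ x ∈ puncturedPolydisc r, x.2 ≠ 1 →
    HamiltonEqs P x.1 x.2 (fun i => f i x)
      (fun i => deriv (fun t => f i (t, x.2)) x.1) (fun i => deriv (fun s => f i (x.1, s)) x.2)

end Garnier

namespace Garnier

open MvPolynomial

/-! ## Logarithmic derivations and polynomial vector fields on power series -/

/-! After multiplication of the unknowns by monomials in `t₁`, `s₂`, each prescribed solution
becomes a vector `Z` of ordinary power series with known constant term `z0`. Four canonical monomial
substitutions (the charts) are enough. In a chart the system reads `t₁ ∂Z/∂t₁ = A(Z, t₁, s₂)`, `s₂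
(s₂ - 1) ∂Z/∂s₂ = B(Z, t₁, s₂)` with polynomial `A`, `B` vanishing at `(z0, 0, 0)`: an integrable
pair with logarithmic singularities along `t₁ s₂ = 0`, of Briot–Bouquet type. The core is
`exists_pairSol`: a nonresonant pair of this kind has exactly one formal solution with constant term
`z0`, and it converges.

Its proof replaces the pair by one equation. Integrability (`curvature_chart`,
`compat_of_curvature`) makes the Jacobians `J_A`, `J_B` at `z0` commute. Nonresonance says that they
have no common eigenvector with eigenvalues `(n₀, -n₁)`, `n ≠ 0`. Then for all real `b > 0` outside
a countable set, `n₀ + b n₁ - (J_A - b J_B)` is invertible for every `n ≠ 0`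
(`exists_pos_nonresonant`). For such `b` the equation `θ Z = A - b B`, with `θ = t₁ ∂/∂t₁ + b (1 -
s₂) s₂ ∂/∂s₂`, can be solved degree by degree, uniquely. Positivity of `b` excludes small divisors:
the inverses are `O(1 / deg n)`, which beats the derivative left on the right hand side, and a
majorant estimate gives convergence (`Sys.convergent`). The defect `W = t₁ ∂Z/∂t₁ - A(Z)` solves a
homogeneous linear equation with the same linear part, hence vanishes (`Sys.linear_unique`). The
second equation of the pair follows because `b ≠ 0`.

Nonresonance at the eight equilibria is linear algebra: after elimination of decoupled directions,
the relevant block of a Jacobian squares to `k²` with `k` one of the combinations assumed not to be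
an integer, so it has no eigenvalue `±n`. The symmetry `α_∞ ↦ -α_∞`, `ν ↦ ν + α_∞` exchanges
solutions 1, 5, 7 with 2, 6, 8. The prescribed terms beyond `z0` are read off by comparing low order
coefficients. Conversely, leading terms (even with formal errors) force a Laurent solution to come
from power series in the chart with constant term `z0`, so uniqueness transfers. The coefficients of
`q₁` at `t₁⁻¹` and `1` and of `p₂` at `s₂⁻¹` separate the eight solutions. -/

/-- Polynomials in the four unknowns (`Sum.inl`) and the two variables `t₁, s₂` (`Sum.inr`). -/
abbrev Poly : Type := MvPolynomial (Fin 4 ⊕ Fin 2) ℂ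

/-- The point `(Z, t, s)`. -/
def pt {K : Type*} (Z : Fin 4 → K) (t s : K) : Fin 4 ⊕ Fin 2 → K := Sum.elim Z ![t, s]

@[simp] theorem pt_inl {K : Type*} (Z : Fin 4 → K) (t s : K) (i : Fin 4) :
    pt Z t s (Sum.inl i) = Z i := rfl

@[simp] theorem pt_inr_zero {K : Type*} (Z : Fin 4 → K) (t s : K) :
    pt Z t s (Sum.inr 0) = t := rfl

@[simp] theorem pt_inr_one {K : Type*} (Z : Fin 4 → K) (t s : K) :
    pt Z t s (Sum.inr 1) = s := rfl

/-- The total degree of an exponent. -/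
def deg (n : Fin 2 →₀ ℕ) : ℕ := n 0 + n 1

@[simp] theorem deg_zero : deg 0 = 0 := rfl

theorem deg_add (m n : Fin 2 →₀ ℕ) : deg (m + n) = deg m + deg n := by
  simp only [deg, Finsupp.add_apply]; ring

theorem deg_eq_zero {n : Fin 2 →₀ ℕ} : deg n = 0 ↔ n = 0 := by
  simp [deg, Finsupp.ext_iff, Fin.forall_fin_two]

/-- The derivation `x ∂/∂x` for the variable `x` with index `k`. -/
noncomputable def euler (k : Fin 2) : Derivation ℂ Pow Pow :=
  (MvPowerSeries.X k : Pow) • MvPowerSeries.pderiv ℂ k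

theorem coeff_euler (k : Fin 2) (n : Fin 2 →₀ ℕ) (F : Pow) :
    MvPowerSeries.coeff n (euler k F) = n k * MvPowerSeries.coeff n F := by
  classical
  rw [euler, Derivation.smul_apply, smul_eq_mul, mul_comm, MvPowerSeries.X,
    MvPowerSeries.coeff_mul_monomial]
  split_ifs with h
  · rw [MvPowerSeries.coeff_pderiv, tsub_add_cancel_of_le h]
    have h1 : 1 ≤ n k := by simpa using h k
    rw [Finsupp.tsub_apply, Finsupp.single_eq_same, Nat.cast_sub h1]
    push_cast; ring
  · have : n k = 0 := by
      by_contra h0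
      exact h (by simpa using Nat.one_le_iff_ne_zero.2 h0)
    simp [this]

theorem coeff_sP_mul (n : Fin 2 →₀ ℕ) (F : Pow) : MvPowerSeries.coeff n (sP * F) =
    if 1 ≤ n 1 then MvPowerSeries.coeff (n - Finsupp.single 1 1) F else 0 := by
  classical
  rw [sP, mul_comm, MvPowerSeries.X, MvPowerSeries.coeff_mul_monomial]
  simp

theorem euler_tP_zero : euler 0 tP = tP := by
  simp [euler, tP]

theorem euler_one_tP : euler 1 tP = 0 := by
  simp [euler, tP]

theorem euler_one_sP : euler 1 sP = sP := by
  simp [euler, sP]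

theorem euler_zero_sP : euler 0 sP = 0 := by
  simp [euler, sP]

theorem derivation_aeval {σ : Type*} [Fintype σ] (D : Derivation ℂ Pow Pow) (Y : σ → Pow)
    (F : MvPolynomial σ ℂ) :
    D (aeval Y F) = ∑ j, aeval Y (pderiv j F) * D (Y j) := by
  classical
  induction F using MvPolynomial.induction_on with
  | C c => simp
  | add p q hp hq => simp [hp, hq, add_mul, Finset.sum_add_distrib]
  | mul_X p k hp =>
    simp only [map_mul, aeval_X, Derivation.leibniz, hp, smul_eq_mul, pderiv_X, map_add, add_mul,
      Finset.sum_add_distrib, Finset.mul_sum]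
    congr 1
    · rw [Finset.sum_eq_single k]
      · simp
      · intro j _ hj; simp [hj.symm]
      · simp
    · exact Finset.sum_congr rfl fun j _ => by ring

/-- Evaluation of a polynomial at `(Z, t₁, s₂)`. -/
noncomputable def ev (Z : Fin 4 → Pow) : Poly →ₐ[ℂ] Pow := aeval (pt Z tP sP)

/-- Evaluation of a polynomial at `(z, 0, 0)`. -/
noncomputable def ev0 (z : Fin 4 → ℂ) : Poly →ₐ[ℂ] ℂ := aeval (pt z 0 0)

theorem constantCoeff_aeval {σ : Type*} (Y : σ → Pow) (F : MvPolynomial σ ℂ) :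
    MvPowerSeries.constantCoeff (aeval Y F)
      = aeval (fun j => MvPowerSeries.constantCoeff (Y j)) F := by
  have h := MvPolynomial.comp_aeval_apply (R := ℂ) (f := Y)
    (AlgHom.mk (MvPowerSeries.constantCoeff (σ := Fin 2) (R := ℂ)) (fun r => by
      rw [MvPowerSeries.algebraMap_apply]; simp)) F
  exact h

theorem constantCoeff_pt (Z : Fin 4 → Pow) :
    (fun j => MvPowerSeries.constantCoeff (pt Z tP sP j))
      = pt (fun i => MvPowerSeries.constantCoeff (Z i)) 0 0 := by
  funext j
  rcases j with i | j
  · rfl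
  · fin_cases j
    · simp [tP]
    · simp [sP]

theorem constantCoeff_ev (Z : Fin 4 → Pow) (F : Poly) :
    MvPowerSeries.constantCoeff (ev Z F)
      = ev0 (fun i => MvPowerSeries.constantCoeff (Z i)) F := by
  rw [ev, constantCoeff_aeval, constantCoeff_pt, ev0]

theorem derivation_ev (D : Derivation ℂ Pow Pow) (Z : Fin 4 → Pow) (F : Poly) :
    D (ev Z F) = (∑ j, ev Z (pderiv (Sum.inl j) F) * D (Z j))
      + (ev Z (pderiv (Sum.inr 0) F) * D tP + ev Z (pderiv (Sum.inr 1) F) * D sP) := by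
  rw [ev, derivation_aeval, Fintype.sum_sum_type, Fin.sum_univ_two]
  rfl

/-! ## Agreement up to a given degree -/

/-- In a splitting of `n` with nonzero second part, the first part has degree below `N`; only the
splitting `(n, 0)` contributes. -/
theorem coeff_mul_of_vanish {N : ℕ} {F G : Pow}
    (hF : ∀ m, deg m < N → MvPowerSeries.coeff m F = 0) {n : Fin 2 →₀ ℕ} (hn : deg n ≤ N) :
    MvPowerSeries.coeff n (F * G)
      = MvPowerSeries.coeff n F * MvPowerSeries.constantCoeff G := by
  classical
  rw [MvPowerSeries.coeff_mul, Finset.sum_eq_single (n, 0)]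
  · rfl
  · rintro ⟨p, q⟩ h1 h2
    rw [Finset.HasAntidiagonal.mem_antidiagonal] at h1
    have hq : q ≠ 0 := by
      rintro rfl
      exact h2 (by rw [← h1]; simp)
    have : deg p < N := by
      have := deg_add p q
      have h3 : deg q ≠ 0 := fun h => hq (deg_eq_zero.1 h)
      simp only at h1
      rw [h1] at this
      omega
    simp only
    rw [hF p this, zero_mul]
  · intro h
    exact absurd (Finset.HasAntidiagonal.mem_antidiagonal.2 (by simp)) h

/-- First order Taylor expansion. The increments start in degree `N > 0`, so quadratic terms start
in degree `2N > N`, and up to degree `N` only the derivative at the constant terms is seen. -/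
theorem coeff_aeval_sub {σ : Type*} [Fintype σ] {N : ℕ} (hN : 0 < N) {Y Y' : σ → Pow}
    (h : ∀ j m, deg m < N → MvPowerSeries.coeff m (Y' j - Y j) = 0) (F : MvPolynomial σ ℂ)
    {n : Fin 2 →₀ ℕ} (hn : deg n ≤ N) :
    MvPowerSeries.coeff n (aeval Y' F - aeval Y F)
      = ∑ j, aeval (fun j => MvPowerSeries.constantCoeff (Y j)) (pderiv j F)
          * MvPowerSeries.coeff n (Y' j - Y j) := by
  classical
  induction F using MvPolynomial.induction_on generalizing n with
  | C c => simp
  | add p q hp hq =>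
    have : aeval Y' (p + q) - aeval Y (p + q)
        = (aeval Y' p - aeval Y p) + (aeval Y' q - aeval Y q) := by
      simp only [map_add]; ring
    rw [this, map_add, hp hn, hq hn, ← Finset.sum_add_distrib]
    exact Finset.sum_congr rfl fun j _ => by rw [map_add, map_add]; ring
  | mul_X p k hp =>
    have : aeval Y' (p * X k) - aeval Y (p * X k)
        = (aeval Y' p - aeval Y p) * Y' k + (Y' k - Y k) * aeval Y p := by
      simp only [map_mul, aeval_X]; ring
    have hv : ∀ m, deg m < N → MvPowerSeries.coeff m (aeval Y' p - aeval Y p) = 0 := by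
      intro m hm
      rw [hp hm.le]
      exact Finset.sum_eq_zero fun j _ => by rw [h j m hm, mul_zero]
    have hc : MvPowerSeries.constantCoeff (Y' k) = MvPowerSeries.constantCoeff (Y k) := by
      have := h k 0 (by simpa using hN)
      rw [map_sub, sub_eq_zero] at this
      exact this
    rw [this, map_add, coeff_mul_of_vanish hv hn, coeff_mul_of_vanish (h k) hn, hp hn, hc,
      constantCoeff_aeval]
    simp only [pderiv_mul, map_add, map_mul, add_mul, Finset.sum_add_distrib, aeval_X]
    congr 1
    · rw [Finset.sum_mul]
      exact Finset.sum_congr rfl fun j _ => by ring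
    · rw [Finset.sum_eq_single k]
      · simp [mul_comm]
      · intro j _ hj; simp [pderiv_X, hj.symm]
      · simp

theorem coeff_ev_sub {N : ℕ} (hN : 0 < N) {Z Z' : Fin 4 → Pow}
    (h : ∀ j m, deg m < N → MvPowerSeries.coeff m (Z' j - Z j) = 0) (F : Poly)
    {n : Fin 2 →₀ ℕ} (hn : deg n ≤ N) :
    MvPowerSeries.coeff n (ev Z' F - ev Z F)
      = ∑ j, ev0 (fun i => MvPowerSeries.constantCoeff (Z i)) (pderiv (Sum.inl j) F)
          * MvPowerSeries.coeff n (Z' j - Z j) := by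
  rw [ev, ev, coeff_aeval_sub hN (Y := pt Z tP sP) (Y' := pt Z' tP sP) _ F hn,
    Fintype.sum_sum_type, constantCoeff_pt, Fin.sum_univ_two]
  · simp [ev0]
  · rintro (j | j) m hm
    · exact h j m hm
    · fin_cases j <;> simp

/-! ## Formal solution of a nonresonant logarithmic system

`θ Z = F(Z, t₁, s₂)` where `θ = t₁ ∂/∂t₁ + b (1 - s₂) s₂ ∂/∂s₂`. -/

/-- The vector field `t₁ ∂/∂t₁ + b (1 - s₂) s₂ ∂/∂s₂`. -/
noncomputable def theta (b : ℂ) : Derivation ℂ Pow Pow :=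
  euler 0 + (MvPowerSeries.C b * (1 - sP) : Pow) • euler 1

/-- The eigenvalue of the degree preserving part of `theta b` on a monomial. -/
def wt (b : ℂ) (n : Fin 2 →₀ ℕ) : ℂ := n 0 + b * n 1

theorem coeff_theta (b : ℂ) (n : Fin 2 →₀ ℕ) (F : Pow) :
    MvPowerSeries.coeff n (theta b F) = wt b n * MvPowerSeries.coeff n F
      - b * MvPowerSeries.coeff n (sP * euler 1 F) := by
  have : theta b F = euler 0 F + MvPowerSeries.C b * (euler 1 F - sP * euler 1 F) := by
    simp only [theta, Derivation.add_apply, Derivation.smul_apply, smul_eq_mul]; ring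
  rw [this, map_add, MvPowerSeries.coeff_C_mul, map_sub, coeff_euler, coeff_euler, wt]
  ring

/-- Multiplication by `s₂` raises the degree. This makes `theta b` triangular for the degree, with
diagonal `wt b`. -/
theorem coeff_sP_euler_of_vanish {N : ℕ} {F : Pow}
    (hF : ∀ m, deg m < N → MvPowerSeries.coeff m F = 0) {n : Fin 2 →₀ ℕ} (hn : deg n ≤ N) :
    MvPowerSeries.coeff n (sP * euler 1 F) = 0 := by
  rw [coeff_sP_mul]
  split_ifs with h
  · rw [coeff_euler, hF, mul_zero]
    simp only [deg, Finsupp.tsub_apply] at hn ⊢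
    simp only [Finsupp.single_eq_same]
    rw [Finsupp.single_eq_of_ne (by decide)]
    omega
  · rfl

/-- The data of a nonresonant system. -/
structure Sys where
  F : Fin 4 → Poly
  z0 : Fin 4 → ℂ
  b : ℂ
  M : (Fin 2 →₀ ℕ) → Matrix (Fin 4) (Fin 4) ℂ
  equil : ∀ i, ev0 z0 (F i) = 0

/-- The linear part of the system. -/
noncomputable def Sys.L (S : Sys) : Matrix (Fin 4) (Fin 4) ℂ :=
  Matrix.of fun i j => ev0 S.z0 (pderiv (Sum.inl j) (S.F i))

/-- `M n` inverts `wt n - L` for nonzero `n`. -/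
def Sys.Inv (S : Sys) : Prop :=
  ∀ n ≠ 0, (wt S.b n • 1 - S.L) * S.M n = 1

/-- Solutions with the given constant term. -/
def Sys.Sol (S : Sys) (Z : Fin 4 → Pow) : Prop :=
  (∀ i, MvPowerSeries.constantCoeff (Z i) = S.z0 i) ∧ ∀ i, theta S.b (Z i) = ev Z (S.F i)

/-- The nonlinear part of the system. -/
noncomputable def Sys.rest (S : Sys) (Z : Fin 4 → Pow) (i : Fin 4) : Pow :=
  ev Z (S.F i) - ∑ j, MvPowerSeries.C (S.L i j) * (Z j - MvPowerSeries.C (S.z0 j))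
    + MvPowerSeries.C S.b * (sP * euler 1 (Z i))

/-- The fixed point operator. -/
noncomputable def Sys.T (S : Sys) (Z : Fin 4 → Pow) (i : Fin 4) : Pow := fun n =>
  if n = 0 then S.z0 i else ∑ k, S.M n i k * MvPowerSeries.coeff n (S.rest Z k)

theorem Sys.coeff_T_zero (S : Sys) (Z : Fin 4 → Pow) (i : Fin 4) :
    MvPowerSeries.constantCoeff (S.T Z i) = S.z0 i := by
  change S.T Z i 0 = S.z0 i
  simp [Sys.T]

theorem Sys.coeff_T (S : Sys) (Z : Fin 4 → Pow) (i : Fin 4) {n : Fin 2 →₀ ℕ} (hn : n ≠ 0) :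
    MvPowerSeries.coeff n (S.T Z i)
      = ∑ k, S.M n i k * MvPowerSeries.coeff n (S.rest Z k) := if_neg hn

/-- The linear terms have been removed and the derivative term carries a factor `s₂`, so the
coefficients up to degree `N` depend only on those of `Z` below degree `N`. -/
theorem Sys.rest_congr (S : Sys) {N : ℕ} (hN : 0 < N) {Z Z' : Fin 4 → Pow}
    (hZ : ∀ i, MvPowerSeries.constantCoeff (Z i) = S.z0 i)
    (h : ∀ j m, deg m < N → MvPowerSeries.coeff m (Z' j - Z j) = 0) (i : Fin 4)
    {n : Fin 2 →₀ ℕ} (hn : deg n ≤ N) :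
    MvPowerSeries.coeff n (S.rest Z' i) = MvPowerSeries.coeff n (S.rest Z i) := by
  have h1 : S.rest Z' i - S.rest Z i = (ev Z' (S.F i) - ev Z (S.F i))
      - ∑ j, MvPowerSeries.C (S.L i j) * (Z' j - Z j)
      + MvPowerSeries.C S.b * (sP * euler 1 (Z' i - Z i)) := by
    have : ∑ j, MvPowerSeries.C (S.L i j) * (Z' j - Z j)
        = ∑ j, MvPowerSeries.C (S.L i j) * (Z' j - MvPowerSeries.C (S.z0 j))
          - ∑ j, MvPowerSeries.C (S.L i j) * (Z j - MvPowerSeries.C (S.z0 j)) := by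
      rw [← Finset.sum_sub_distrib]
      exact Finset.sum_congr rfl fun j _ => by ring
    rw [this, Sys.rest, Sys.rest, map_sub]
    ring
  rw [← sub_eq_zero, ← map_sub, h1, map_add, map_sub, coeff_ev_sub hN h _ hn,
    MvPowerSeries.coeff_C_mul, coeff_sP_euler_of_vanish (h i) hn, map_sum]
  simp_rw [MvPowerSeries.coeff_C_mul, hZ]
  simp [Sys.L]

/-- `S.T` is a contraction for the degree filtration: each application gains one degree of
agreement. -/
theorem Sys.T_congr (S : Sys) {N : ℕ} (hN : 0 < N) {Z Z' : Fin 4 → Pow}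
    (hZ : ∀ i, MvPowerSeries.constantCoeff (Z i) = S.z0 i)
    (h : ∀ j m, deg m < N → MvPowerSeries.coeff m (Z' j - Z j) = 0) (i : Fin 4)
    {n : Fin 2 →₀ ℕ} (hn : deg n ≤ N) :
    MvPowerSeries.coeff n (S.T Z' i - S.T Z i) = 0 := by
  rw [map_sub, sub_eq_zero]
  by_cases h0 : n = 0
  · subst h0
    exact (S.coeff_T_zero Z' i).trans (S.coeff_T_zero Z i).symm
  · rw [S.coeff_T _ _ h0, S.coeff_T _ _ h0]
    exact Finset.sum_congr rfl fun k _ => by rw [S.rest_congr hN hZ h k hn]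

/-- In degree `n` the differential equation says `(wt n - L) Zₙ = restₙ`, and `M n` is the inverse
of the matrix on the left. In degree `0` it is the equilibrium condition. -/
theorem Sys.sol_iff (S : Sys) (hI : S.Inv) (Z : Fin 4 → Pow) : S.Sol Z ↔ S.T Z = Z := by
  have key : ∀ i n, MvPowerSeries.coeff n (ev Z (S.F i)) - MvPowerSeries.coeff n (theta S.b (Z i))
      = MvPowerSeries.coeff n (S.rest Z i) - (wt S.b n * MvPowerSeries.coeff n (Z i)
        - ∑ j, S.L i j * MvPowerSeries.coeff n (Z j - MvPowerSeries.C (S.z0 j))) := by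
    intro i n
    rw [coeff_theta, Sys.rest, map_add, map_sub, map_sum, MvPowerSeries.coeff_C_mul]
    simp_rw [MvPowerSeries.coeff_C_mul]
    ring
  have hC : ∀ (n : Fin 2 →₀ ℕ) (c : ℂ), n ≠ 0 →
      MvPowerSeries.coeff n (MvPowerSeries.C c : Pow) = 0 := by
    classical
    intro n c hn
    rw [MvPowerSeries.coeff_C, if_neg hn]
  constructor
  · rintro ⟨h0, h1⟩
    funext i
    ext n
    by_cases hn : n = 0
    · subst hn
      exact (S.coeff_T_zero Z i).trans (h0 i).symm
    rw [S.coeff_T _ _ hn]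
    have hr : (fun k => MvPowerSeries.coeff n (S.rest Z k))
        = (wt S.b n • (1 : Matrix (Fin 4) (Fin 4) ℂ) - S.L).mulVec
            (fun j => MvPowerSeries.coeff n (Z j)) := by
      funext k
      have := key k n
      rw [h1, sub_self, eq_comm, sub_eq_zero] at this
      rw [this, Matrix.sub_mulVec, Matrix.smul_mulVec, Matrix.one_mulVec]
      simp [Matrix.mulVec, dotProduct, hC n _ hn]
    have h2 : (S.M n).mulVec (fun k => MvPowerSeries.coeff n (S.rest Z k)) i
        = MvPowerSeries.coeff n (Z i) := by
      rw [hr, Matrix.mulVec_mulVec, mul_eq_one_comm.1 (hI n hn), Matrix.one_mulVec]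
    exact h2
  · intro h
    have h0 : ∀ i, MvPowerSeries.constantCoeff (Z i) = S.z0 i := fun i => by
      rw [← h]; exact S.coeff_T_zero Z i
    refine ⟨h0, fun i => ?_⟩
    ext n
    by_cases hn : n = 0
    · subst hn
      have h1 := constantCoeff_ev Z (S.F i)
      have h2 : (fun i => MvPowerSeries.constantCoeff (Z i)) = S.z0 := funext h0
      rw [h2, S.equil] at h1
      rw [coeff_theta, coeff_sP_mul]
      simpa [wt] using h1.symm
    · rw [eq_comm, ← sub_eq_zero, key, sub_eq_zero]
      have hv : (fun k => MvPowerSeries.coeff n (Z k))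
          = (S.M n).mulVec (fun k => MvPowerSeries.coeff n (S.rest Z k)) := by
        funext k
        conv_lhs => rw [← h]
        exact S.coeff_T _ _ hn
      have h3 : (fun k => MvPowerSeries.coeff n (S.rest Z k))
          = (wt S.b n • (1 : Matrix (Fin 4) (Fin 4) ℂ) - S.L).mulVec
            (fun j => MvPowerSeries.coeff n (Z j)) := by
        rw [hv, Matrix.mulVec_mulVec, hI n hn, Matrix.one_mulVec]
      have h4 := congrFun h3 i
      rw [Matrix.sub_mulVec, Matrix.smul_mulVec, Matrix.one_mulVec] at h4
      rw [h4]
      simp [Matrix.mulVec, dotProduct, hC n _ hn]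

/-- The iterates of the fixed point operator. -/
noncomputable def Sys.iter (S : Sys) (N : ℕ) : Fin 4 → Pow :=
  S.T^[N] fun i => MvPowerSeries.C (S.z0 i)

theorem Sys.iter_zero_coeff (S : Sys) (N : ℕ) (i : Fin 4) :
    MvPowerSeries.constantCoeff (S.iter N i) = S.z0 i := by
  cases N with
  | zero => simp [Sys.iter]
  | succ N => rw [Sys.iter, Function.iterate_succ_apply']; exact S.coeff_T_zero _ i

theorem Sys.iter_succ_agree (S : Sys) (N : ℕ) (i : Fin 4) (n : Fin 2 →₀ ℕ) (hn : deg n < N + 1) :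
    MvPowerSeries.coeff n (S.iter (N + 1) i - S.iter N i) = 0 := by
  induction N generalizing i n with
  | zero =>
    have : n = 0 := deg_eq_zero.1 (by omega)
    subst this
    rw [map_sub, sub_eq_zero]
    exact (S.iter_zero_coeff 1 i).trans (S.iter_zero_coeff 0 i).symm
  | succ N ih =>
    have h1 : S.iter (N + 1 + 1) = S.T (S.iter (N + 1)) := Function.iterate_succ_apply' _ _ _
    have h2 : S.iter (N + 1) = S.T (S.iter N) := Function.iterate_succ_apply' _ _ _
    rw [h1]
    nth_rewrite 2 [h2]
    exact S.T_congr (Nat.succ_pos N) (S.iter_zero_coeff N) ih i (by omega)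

theorem Sys.iter_agree (S : Sys) {N N' : ℕ} (h : N ≤ N') (i : Fin 4) (n : Fin 2 →₀ ℕ)
    (hn : deg n < N + 1) :
    MvPowerSeries.coeff n (S.iter N' i) = MvPowerSeries.coeff n (S.iter N i) := by
  induction N', h using Nat.le_induction with
  | base => rfl
  | succ N' h ih =>
    have := S.iter_succ_agree N' i n (by omega)
    rw [map_sub, sub_eq_zero] at this
    rw [this, ih]

/-- The formal solution. -/
noncomputable def Sys.sol (S : Sys) (i : Fin 4) : Pow := fun n =>
  MvPowerSeries.coeff n (S.iter (deg n) i)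

theorem Sys.coeff_sol (S : Sys) (i : Fin 4) {n : Fin 2 →₀ ℕ} {N : ℕ} (hn : deg n ≤ N) :
    MvPowerSeries.coeff n (S.sol i) = MvPowerSeries.coeff n (S.iter N i) :=
  (S.iter_agree hn i n (by omega)).symm

/-- In each degree `S.sol` agrees with every sufficiently late iterate, and `S.T` sends an iterate
to the next one; `S.T_congr` carries the agreement through `S.T`. -/
theorem Sys.T_sol (S : Sys) : S.T S.sol = S.sol := by
  funext i
  ext n
  have h := S.T_congr (N := deg n + 1) (Nat.succ_pos _) (Z := S.iter (deg n + 1)) (Z' := S.sol)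
    (S.iter_zero_coeff _)
    (fun j m hm => by rw [map_sub, sub_eq_zero]; exact S.coeff_sol j (by omega)) i
    (n := n) (by omega)
  rw [map_sub, sub_eq_zero] at h
  rw [h, S.coeff_sol i (N := deg n + 1 + 1) (by omega)]
  exact (congrArg _ (congrFun (Function.iterate_succ_apply' S.T _ _) i)).symm

theorem Sys.fixed_unique (S : Sys) {Z Z' : Fin 4 → Pow} (h : S.T Z = Z) (h' : S.T Z' = Z') :
    Z' = Z := by
  have h0 : ∀ i, MvPowerSeries.constantCoeff (Z i) = S.z0 i := fun i => by
    rw [← h]; exact S.coeff_T_zero Z i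
  have h0' : ∀ i, MvPowerSeries.constantCoeff (Z' i) = S.z0 i := fun i => by
    rw [← h']; exact S.coeff_T_zero Z' i
  have key : ∀ N : ℕ, ∀ i n, deg n < N + 1 → MvPowerSeries.coeff n (Z' i - Z i) = 0 := by
    intro N
    induction N with
    | zero =>
      intro i n hn
      have : n = 0 := deg_eq_zero.1 (by omega)
      subst this
      rw [map_sub, sub_eq_zero]
      exact (h0' i).trans (h0 i).symm
    | succ N ih =>
      intro i n hn
      have := S.T_congr (Nat.succ_pos N) h0 ih i (n := n) (by omega)
      rwa [h, h'] at this
  funext i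
  ext n
  have := key (deg n) i n (by omega)
  rwa [map_sub, sub_eq_zero] at this

theorem Sys.sol_unique (S : Sys) (hI : S.Inv) {Z : Fin 4 → Pow} (h : S.Sol Z) : Z = S.sol :=
  S.fixed_unique S.T_sol ((S.sol_iff hI Z).1 h)

theorem Sys.sol_spec (S : Sys) (hI : S.Inv) : S.Sol S.sol := (S.sol_iff hI _).2 S.T_sol

/-- A linear homogeneous system with nonresonant linear part has only the trivial solution. -/
theorem Sys.linear_unique (S : Sys) (hI : S.Inv) {Z W : Fin 4 → Pow}
    (hZ : ∀ i, MvPowerSeries.constantCoeff (Z i) = S.z0 i)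
    (hW : ∀ i, MvPowerSeries.constantCoeff (W i) = 0)
    (h : ∀ i, theta S.b (W i) = ∑ j, ev Z (pderiv (Sum.inl j) (S.F i)) * W j) : W = 0 := by
  have key : ∀ N : ℕ, ∀ i n, deg n < N + 1 → MvPowerSeries.coeff n (W i) = 0 := by
    intro N
    induction N with
    | zero =>
      intro i n hn
      have : n = 0 := deg_eq_zero.1 (by omega)
      subst this
      exact hW i
    | succ N ih =>
      intro i n hn
      by_cases hd : deg n < N + 1
      · exact ih i n hd
      have hn0 : n ≠ 0 := by rintro rfl; simp at hd
      -- `W` vanishes below degree `deg n`, so in this degree the variable coefficients act only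
      -- through their constant terms, which form `S.L`.
      have h1 : ∀ i, wt S.b n * MvPowerSeries.coeff n (W i)
          = ∑ j, S.L i j * MvPowerSeries.coeff n (W j) := by
        intro i
        have := congrArg (MvPowerSeries.coeff n) (h i)
        rw [coeff_theta, coeff_sP_euler_of_vanish (ih i) (by omega), mul_zero, sub_zero,
          map_sum] at this
        rw [this]
        refine Finset.sum_congr rfl fun j _ => ?_
        rw [mul_comm, coeff_mul_of_vanish (ih j) (by omega), constantCoeff_ev, mul_comm]
        simp only [hZ]
        rfl
      have h2 : (wt S.b n • (1 : Matrix (Fin 4) (Fin 4) ℂ) - S.L).mulVec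
          (fun j => MvPowerSeries.coeff n (W j)) = 0 := by
        funext k
        rw [Matrix.sub_mulVec, Matrix.smul_mulVec, Matrix.one_mulVec]
        simp [Matrix.mulVec, dotProduct, h1 k]
      have h3 := congrArg (S.M n).mulVec h2
      rw [Matrix.mulVec_mulVec, mul_eq_one_comm.1 (hI n hn0), Matrix.one_mulVec,
        Matrix.mulVec_zero] at h3
      exact congrFun h3 i
  funext i
  ext n
  exact key (deg n) i n (by omega)

end Garnier

namespace Garnier

open MvPolynomial

/-! ## Truncated majorant norms -/

/-- The exponents of degree at most `N`. -/
noncomputable def tri (N : ℕ) : Finset (Fin 2 →₀ ℕ) :=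
  (Finset.Iic (Finsupp.equivFunOnFinite.symm fun _ => N)).filter fun n => deg n ≤ N

theorem mem_tri {N : ℕ} {n : Fin 2 →₀ ℕ} : n ∈ tri N ↔ deg n ≤ N := by
  rw [tri, Finset.mem_filter, and_iff_right_iff_imp, Finset.mem_Iic]
  intro h i
  simp only [deg] at h
  fin_cases i <;> simp <;> omega

/-- The norm of the truncation in degrees at most `N`. -/
noncomputable def nrm (r : ℝ) (N : ℕ) (F : Pow) : ℝ :=
  ∑ n ∈ tri N, ‖MvPowerSeries.coeff n F‖ * r ^ deg n

variable {r : ℝ}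

theorem nrm_nonneg (hr : 0 ≤ r) (N : ℕ) (F : Pow) : 0 ≤ nrm r N F :=
  Finset.sum_nonneg fun _ _ => by positivity

theorem nrm_add (hr : 0 ≤ r) (N : ℕ) (F G : Pow) : nrm r N (F + G) ≤ nrm r N F + nrm r N G := by
  rw [nrm, nrm, nrm, ← Finset.sum_add_distrib]
  refine Finset.sum_le_sum fun n _ => ?_
  rw [map_add, ← add_mul]
  gcongr
  exact norm_add_le _ _

theorem nrm_C_mul (N : ℕ) (c : ℂ) (F : Pow) :
    nrm r N (MvPowerSeries.C c * F) = ‖c‖ * nrm r N F := by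
  rw [nrm, nrm, Finset.mul_sum]
  refine Finset.sum_congr rfl fun n _ => ?_
  rw [MvPowerSeries.coeff_C_mul, norm_mul, mul_assoc]

@[simp] theorem nrm_zero (N : ℕ) : nrm r N 0 = 0 := by simp [nrm]

/-- Common source of the product estimates for `nrm`; the hypothesis lists which pairs of exponents
can contribute. -/
theorem sum_mul_le (hr : 0 ≤ r) (T A B : Finset (Fin 2 →₀ ℕ)) (F G : Pow)
    (h : ∀ p q, p + q ∈ T → MvPowerSeries.coeff p F ≠ 0 → MvPowerSeries.coeff q G ≠ 0 →
      p ∈ A ∧ q ∈ B) :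
    ∑ n ∈ T, ‖MvPowerSeries.coeff n (F * G)‖ * r ^ deg n
      ≤ (∑ n ∈ A, ‖MvPowerSeries.coeff n F‖ * r ^ deg n)
        * ∑ n ∈ B, ‖MvPowerSeries.coeff n G‖ * r ^ deg n := by
  classical
  set f : (Fin 2 →₀ ℕ) × (Fin 2 →₀ ℕ) → ℝ := fun x =>
    (‖MvPowerSeries.coeff x.1 F‖ * r ^ deg x.1) * (‖MvPowerSeries.coeff x.2 G‖ * r ^ deg x.2)
    with hf
  have h0 : ∀ x, 0 ≤ f x := fun x => by positivity
  calc ∑ n ∈ T, ‖MvPowerSeries.coeff n (F * G)‖ * r ^ deg n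
      ≤ ∑ n ∈ T, ∑ x ∈ Finset.HasAntidiagonal.antidiagonal n, f x := by
        refine Finset.sum_le_sum fun n _ => ?_
        rw [MvPowerSeries.coeff_mul]
        refine (mul_le_mul_of_nonneg_right (norm_sum_le _ _) (by positivity)).trans (le_of_eq ?_)
        rw [Finset.sum_mul]
        refine Finset.sum_congr rfl (fun p hp => ?_)
        rw [Finset.HasAntidiagonal.mem_antidiagonal] at hp
        rw [← hp, norm_mul, deg_add, hf]
        ring
    _ = ∑ y ∈ T.sigma fun n => Finset.HasAntidiagonal.antidiagonal n, f y.2 := Finset.sum_sigma' _ _ _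
    _ = ∑ x ∈ (T.sigma fun n => Finset.HasAntidiagonal.antidiagonal n).image fun y => y.2, f x := by
        rw [Finset.sum_image]
        rintro ⟨n, x⟩ hx ⟨m, y⟩ hy hxy
        simp only [Finset.mem_coe, Finset.mem_sigma,
          Finset.HasAntidiagonal.mem_antidiagonal] at hx hy hxy
        subst hxy
        obtain rfl : n = m := hx.2.symm.trans hy.2
        rfl
    _ ≤ ∑ x ∈ A ×ˢ B, f x := by
        -- Vanishing products are discarded first, since `h` only locates pairs with both
        -- coefficients nonzero.
        rw [← Finset.sum_filter_ne_zero]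
        refine Finset.sum_le_sum_of_subset_of_nonneg (fun x hx => ?_) (fun x _ _ => h0 x)
        obtain ⟨hx, hfx⟩ := Finset.mem_filter.1 hx
        obtain ⟨⟨n, y⟩, hy, rfl⟩ := Finset.mem_image.1 hx
        simp only [Finset.mem_sigma, Finset.HasAntidiagonal.mem_antidiagonal] at hy
        rw [Finset.mem_product]
        refine h _ _ (hy.2 ▸ hy.1) ?_ ?_
        · intro h1; exact hfx (by simp [hf, h1])
        · intro h1; exact hfx (by simp [hf, h1])
    _ = _ := by rw [Finset.sum_product, Finset.sum_mul_sum]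

theorem nrm_mul (hr : 0 ≤ r) (N : ℕ) (F G : Pow) :
    nrm r N (F * G) ≤ nrm r N F * nrm r N G := by
  refine sum_mul_le hr _ _ _ F G fun p q h _ _ => ?_
  rw [mem_tri, deg_add] at h
  rw [mem_tri, mem_tri]
  omega

/-- Without constant terms, both exponents have degree at least one; a sum of degree at most `N + 1`
therefore keeps each of them within degree `N`. This gain of one degree closes the induction in
`Sys.convergent`. -/
theorem nrm_succ_mul (hr : 0 ≤ r) (N : ℕ) {F G : Pow}
    (hF : MvPowerSeries.constantCoeff F = 0) (hG : MvPowerSeries.constantCoeff G = 0) :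
    nrm r (N + 1) (F * G) ≤ nrm r N F * nrm r N G := by
  refine sum_mul_le hr _ _ _ F G fun p q h hp hq => ?_
  rw [mem_tri, deg_add] at h
  rw [mem_tri, mem_tri]
  have h1 : deg p ≠ 0 := fun h0 => hp (by rw [deg_eq_zero.1 h0]; exact hF)
  have h2 : deg q ≠ 0 := fun h0 => hq (by rw [deg_eq_zero.1 h0]; exact hG)
  omega

theorem nrm_X_le (hr : 0 ≤ r) (N : ℕ) (k : Fin 2) :
    nrm r N (MvPowerSeries.X k : Pow) ≤ r := by
  classical
  rw [nrm]
  have h : ∀ n ∈ tri N, n ≠ Finsupp.single k 1 →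
      ‖MvPowerSeries.coeff n (MvPowerSeries.X k : Pow)‖ * r ^ deg n = 0 := by
    intro n _ hn
    rw [MvPowerSeries.coeff_X, if_neg hn]; simp
  by_cases hm : Finsupp.single k 1 ∈ tri N
  · rw [Finset.sum_eq_single_of_mem _ hm h, MvPowerSeries.coeff_X, if_pos rfl]
    have : deg (Finsupp.single k 1) = 1 := by fin_cases k <;> simp [deg]
    simp [this]
  · rw [Finset.sum_eq_zero fun n hn => h n hn fun h0 => hm (h0 ▸ hn)]
    exact hr

/-- The remainder of order two is built from products of two factors without constant term, so its
truncation at `N + 1` is controlled by truncations at `N`. The constant depends only on `P` and `y`;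
the first estimate is what the induction on `P` needs. -/
theorem exists_nrm_taylor {σ : Type*} [Fintype σ] (P : MvPolynomial σ ℂ) (y : σ → ℂ) :
    ∃ c : ℝ, 0 ≤ c ∧ ∀ (r ρ : ℝ) (N : ℕ) (Y : σ → Pow), 0 ≤ r → 0 ≤ ρ → ρ ≤ 1 →
      (∀ j, MvPowerSeries.constantCoeff (Y j) = y j) →
      (∀ j, nrm r N (Y j - MvPowerSeries.C (y j)) ≤ ρ) →
      nrm r N (aeval Y P - MvPowerSeries.C (aeval y P)) ≤ c * ρ ∧
      nrm r (N + 1) (aeval Y P - MvPowerSeries.C (aeval y P)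
        - ∑ j, MvPowerSeries.C (aeval y (pderiv j P)) * (Y j - MvPowerSeries.C (y j)))
          ≤ c * ρ ^ 2 := by
  classical
  induction P using MvPolynomial.induction_on with
  | C a =>
    refine ⟨0, le_rfl, fun r ρ N Y hr hρ hρ1 hY h => ?_⟩
    have : (algebraMap ℂ Pow a) = MvPowerSeries.C a := rfl
    simp [this]
  | add p q hp hq =>
    obtain ⟨c, hc, hp⟩ := hp
    obtain ⟨d, hd, hq⟩ := hq
    refine ⟨c + d, add_nonneg hc hd, fun r ρ N Y hr hρ hρ1 hY h => ?_⟩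
    obtain ⟨p1, p2⟩ := hp r ρ N Y hr hρ hρ1 hY h
    obtain ⟨q1, q2⟩ := hq r ρ N Y hr hρ hρ1 hY h
    constructor
    · have : aeval Y (p + q) - MvPowerSeries.C (aeval y (p + q))
          = (aeval Y p - MvPowerSeries.C (aeval y p))
            + (aeval Y q - MvPowerSeries.C (aeval y q)) := by
        simp only [map_add]; ring
      rw [this, add_mul]
      exact (nrm_add hr _ _ _).trans (add_le_add p1 q1)
    · have : aeval Y (p + q) - MvPowerSeries.C (aeval y (p + q))
          - ∑ j, MvPowerSeries.C (aeval y (pderiv j (p + q))) * (Y j - MvPowerSeries.C (y j))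
          = (aeval Y p - MvPowerSeries.C (aeval y p)
          - ∑ j, MvPowerSeries.C (aeval y (pderiv j p)) * (Y j - MvPowerSeries.C (y j)))
            + (aeval Y q - MvPowerSeries.C (aeval y q)
          - ∑ j, MvPowerSeries.C (aeval y (pderiv j q)) * (Y j - MvPowerSeries.C (y j))) := by
        simp only [map_add, add_mul, Finset.sum_add_distrib]; ring
      rw [this, add_mul]
      exact (nrm_add hr _ _ _).trans (add_le_add p2 q2)
  | mul_X p k hp =>
    obtain ⟨c, hc, hp⟩ := hp
    -- The increment of `p * X k` is `U δ + y k U + p(y) δ`; the three summands bound these terms,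
    -- `ρ ≤ 1` being used for `U δ`.
    refine ⟨c + ‖y k‖ * c + ‖aeval y p‖, by positivity, fun r ρ N Y hr hρ hρ1 hY h => ?_⟩
    obtain ⟨p1, p2⟩ := hp r ρ N Y hr hρ hρ1 hY h
    set U : Pow := aeval Y p - MvPowerSeries.C (aeval y p) with hU
    set δ : Pow := Y k - MvPowerSeries.C (y k) with hδ
    have hδ0 : MvPowerSeries.constantCoeff δ = 0 := by simp [hδ, hY]
    have hU0 : MvPowerSeries.constantCoeff U = 0 := by
      rw [hU, map_sub, constantCoeff_aeval]
      simp [hY]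
    have e1 : aeval Y (p * X k) - MvPowerSeries.C (aeval y (p * X k))
        = U * δ + MvPowerSeries.C (y k) * U + MvPowerSeries.C (aeval y p) * δ := by
      rw [hU, hδ]; simp only [map_mul, aeval_X]; ring
    constructor
    · rw [e1]
      refine (nrm_add hr _ _ _).trans ?_
      refine (add_le_add_left (nrm_add hr _ _ _) _).trans ?_
      rw [nrm_C_mul, nrm_C_mul]
      have h1 : nrm r N (U * δ) ≤ c * ρ := (nrm_mul hr _ _ _).trans
        ((mul_le_mul p1 ((h k).trans hρ1) (nrm_nonneg hr _ _) (by positivity)).trans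
          (by rw [mul_one]))
      have h2 : ‖y k‖ * nrm r N U ≤ ‖y k‖ * (c * ρ) := by gcongr
      have h3 : ‖aeval y p‖ * nrm r N δ ≤ ‖aeval y p‖ * ρ := by gcongr; exact h k
      linarith
    · have e2 : ∑ j, MvPowerSeries.C (aeval y (pderiv j (p * X k)))
            * (Y j - MvPowerSeries.C (y j))
          = MvPowerSeries.C (y k) * (∑ j, MvPowerSeries.C (aeval y (pderiv j p))
            * (Y j - MvPowerSeries.C (y j))) + MvPowerSeries.C (aeval y p) * δ := by
        simp only [pderiv_mul, map_add, map_mul, add_mul, Finset.sum_add_distrib, aeval_X]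
        congr 1
        · rw [Finset.mul_sum]
          exact Finset.sum_congr rfl fun j _ => by ring
        · rw [Finset.sum_eq_single k]
          · simp [hδ]
          · intro j _ hj; simp [pderiv_X, hj.symm]
          · simp
      rw [e1, e2]
      have e3 : U * δ + MvPowerSeries.C (y k) * U + MvPowerSeries.C (aeval y p) * δ
          - (MvPowerSeries.C (y k) * (∑ j, MvPowerSeries.C (aeval y (pderiv j p))
            * (Y j - MvPowerSeries.C (y j))) + MvPowerSeries.C (aeval y p) * δ)
          = U * δ + MvPowerSeries.C (y k) * (U - ∑ j, MvPowerSeries.C (aeval y (pderiv j p))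
            * (Y j - MvPowerSeries.C (y j))) := by ring
      rw [e3]
      refine (nrm_add hr _ _ _).trans ?_
      rw [nrm_C_mul]
      have h1 : nrm r (N + 1) (U * δ) ≤ (c * ρ) * ρ := (nrm_succ_mul hr N hU0 hδ0).trans
        (mul_le_mul p1 (h k) (nrm_nonneg hr _ _) (by positivity))
      have h2 := mul_le_mul_of_nonneg_left p2 (norm_nonneg (y k))
      have h3 : 0 ≤ ‖aeval y p‖ * ρ ^ 2 := by positivity
      linarith

theorem exists_nrm_taylor_uniform {σ ι : Type*} [Fintype σ] [Fintype ι] (P : ι → MvPolynomial σ ℂ)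
    (y : σ → ℂ) :
    ∃ c : ℝ, 0 ≤ c ∧ ∀ (i : ι) (r ρ : ℝ) (N : ℕ) (Y : σ → Pow), 0 ≤ r → 0 ≤ ρ → ρ ≤ 1 →
      (∀ j, MvPowerSeries.constantCoeff (Y j) = y j) →
      (∀ j, nrm r N (Y j - MvPowerSeries.C (y j)) ≤ ρ) →
      nrm r (N + 1) (aeval Y (P i) - MvPowerSeries.C (aeval y (P i))
        - ∑ j, MvPowerSeries.C (aeval y (pderiv j (P i))) * (Y j - MvPowerSeries.C (y j)))
          ≤ c * ρ ^ 2 := by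
  choose c hc h using fun i => exists_nrm_taylor (P i) y
  refine ⟨∑ i, c i, Finset.sum_nonneg fun i _ => hc i, fun i r ρ N Y hr hρ hρ1 hY hh => ?_⟩
  refine (h i r ρ N Y hr hρ hρ1 hY hh).2.trans ?_
  gcongr
  exact Finset.single_le_sum (fun i _ => hc i) (Finset.mem_univ i)

/-! ## Convergence of the formal solution -/

/-- The factor `1 / deg n` in the size of `S.M n` absorbs the factor at most `deg n` produced by the
derivative, so no loss of radius occurs. The series `ζ` is meant to be `Z` without its constant
term, which has the same derivative. -/
theorem Sys.nrm_T_le (S : Sys) {K : ℝ}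
    (hK : ∀ n ≠ 0, ∀ i k, ‖S.M n i k‖ * deg n ≤ K) (hr : 0 ≤ r) (N : ℕ) (i : Fin 4)
    (Z G ζ : Fin 4 → Pow)
    (h : ∀ k, S.rest Z k = G k + MvPowerSeries.C S.b * (sP * euler 1 (ζ k))) :
    nrm r N (S.T Z i - MvPowerSeries.C (S.z0 i))
      ≤ ∑ k, K * (nrm r N (G k) + ‖S.b‖ * nrm r N (sP * ζ k)) := by
  classical
  rw [nrm]
  have hterm : ∀ n ∈ tri N,
      ‖MvPowerSeries.coeff n (S.T Z i - MvPowerSeries.C (S.z0 i))‖ * r ^ deg n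
      ≤ ∑ k, K * ((‖MvPowerSeries.coeff n (G k)‖ * r ^ deg n)
          + ‖S.b‖ * (‖MvPowerSeries.coeff n (sP * ζ k)‖ * r ^ deg n)) := by
    intro n _
    have hK0 : 0 ≤ K := by
      have := hK (Finsupp.single 0 1) (by simp) 0 0
      exact le_trans (by positivity) this
    by_cases hn : n = 0
    · subst hn
      have : MvPowerSeries.coeff 0 (S.T Z i - MvPowerSeries.C (S.z0 i)) = 0 := by
        have := S.coeff_T_zero Z i
        rw [MvPowerSeries.coeff_zero_eq_constantCoeff_apply, map_sub, this]
        simp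
      rw [this, norm_zero, zero_mul]
      exact Finset.sum_nonneg fun k _ => by positivity
    have hd : 1 ≤ deg n := Nat.one_le_iff_ne_zero.2 fun h => hn (deg_eq_zero.1 h)
    rw [map_sub, MvPowerSeries.coeff_C, if_neg hn, sub_zero, S.coeff_T _ _ hn]
    refine (mul_le_mul_of_nonneg_right (norm_sum_le _ _) (by positivity)).trans ?_
    rw [Finset.sum_mul]
    refine Finset.sum_le_sum fun k _ => ?_
    have hM := hK n hn i k
    have hM1 : ‖S.M n i k‖ ≤ K := by
      refine le_trans ?_ hM
      have : (1 : ℝ) ≤ deg n := by exact_mod_cast hd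
      nlinarith [norm_nonneg (S.M n i k)]
    have he : ‖MvPowerSeries.coeff n (sP * euler 1 (ζ k))‖
        ≤ deg n * ‖MvPowerSeries.coeff n (sP * ζ k)‖ := by
      rw [coeff_sP_mul, coeff_sP_mul]
      split_ifs with h1
      · rw [coeff_euler, norm_mul]
        gcongr
        rw [Complex.norm_natCast]
        have : (n - Finsupp.single 1 1 : Fin 2 →₀ ℕ) 1 ≤ deg n := by
          simp only [Finsupp.tsub_apply, deg]; omega
        exact_mod_cast this
      · simp
    rw [h k, map_add, norm_mul, MvPowerSeries.coeff_C_mul]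
    have h2 : ‖MvPowerSeries.coeff n (G k)
          + S.b * MvPowerSeries.coeff n (sP * euler 1 (ζ k))‖
        ≤ ‖MvPowerSeries.coeff n (G k)‖
          + ‖S.b‖ * (deg n * ‖MvPowerSeries.coeff n (sP * ζ k)‖) := by
      refine (norm_add_le _ _).trans ?_
      rw [norm_mul]
      gcongr
    calc ‖S.M n i k‖ * ‖MvPowerSeries.coeff n (G k)
          + S.b * MvPowerSeries.coeff n (sP * euler 1 (ζ k))‖ * r ^ deg n
        ≤ ‖S.M n i k‖ * (‖MvPowerSeries.coeff n (G k)‖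
          + ‖S.b‖ * (deg n * ‖MvPowerSeries.coeff n (sP * ζ k)‖)) * r ^ deg n := by gcongr
      _ = (‖S.M n i k‖ * ‖MvPowerSeries.coeff n (G k)‖ + (‖S.M n i k‖ * deg n)
          * (‖S.b‖ * ‖MvPowerSeries.coeff n (sP * ζ k)‖)) * r ^ deg n := by ring
      _ ≤ (K * ‖MvPowerSeries.coeff n (G k)‖ + K
          * (‖S.b‖ * ‖MvPowerSeries.coeff n (sP * ζ k)‖)) * r ^ deg n := by gcongr
      _ = _ := by ring
  refine (Finset.sum_le_sum hterm).trans (le_of_eq ?_)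
  rw [Finset.sum_comm]
  refine Finset.sum_congr rfl fun k _ => ?_
  rw [← Finset.mul_sum, Finset.sum_add_distrib, ← Finset.mul_sum]
  rfl

/-- The bound `nrm r N (Z - z0) ≤ B r` is propagated from `N` to `N + 1` through the fixed point
equation. It does not depend on `N`, hence bounds the full sum. -/
theorem Sys.convergent (S : Sys) {K : ℝ} (hK : ∀ n ≠ 0, ∀ i k, ‖S.M n i k‖ * deg n ≤ K) :
    ∃ r : ℝ, 0 < r ∧ ∀ i, Summable fun n : Fin 2 →₀ ℕ =>
      ‖MvPowerSeries.coeff n (S.sol i)‖ * r ^ (n 0 + n 1) := by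
  have hK0 : 0 ≤ K := by
    have := hK (Finsupp.single 0 1) (by simp) 0 0
    exact le_trans (by positivity) this
  obtain ⟨c, hc, hT⟩ := exists_nrm_taylor_uniform S.F (pt S.z0 0 0)
  set l : ℝ := ∑ k, (‖ev0 S.z0 (pderiv (Sum.inr 0) (S.F k))‖
    + ‖ev0 S.z0 (pderiv (Sum.inr 1) (S.F k))‖) with hl
  have hl0 : 0 ≤ l := Finset.sum_nonneg fun _ _ => by positivity
  -- `4 K l` covers the terms linear in `t₁`, `s₂`; the `1` is reserved for the quadratic remainder
  -- and the derivative term. `D` is then chosen so that `r = 1 / D` makes that reserve sufficient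
  -- and keeps `B r ≤ 1`, as the Taylor estimate requires.
  set B : ℝ := 4 * K * l + 1 with hB
  have hB1 : 1 ≤ B := by rw [hB]; have : 0 ≤ 4 * K * l := by positivity
                         linarith
  set D : ℝ := 4 * K * (c * B ^ 2 + ‖S.b‖ * B) + B with hD
  have hD1 : 1 ≤ D := by
    have : 0 ≤ 4 * K * (c * B ^ 2 + ‖S.b‖ * B) := by positivity
    rw [hD]; linarith
  set r : ℝ := D⁻¹ with hr
  have hD0 : 0 < D := by linarith
  have hr0 : 0 < r := inv_pos.2 hD0
  have hrD : D * r = 1 := mul_inv_cancel₀ hD0.ne'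
  have hBr : B * r ≤ 1 := by
    rw [← hrD]
    gcongr
    have : 0 ≤ 4 * K * (c * B ^ 2 + ‖S.b‖ * B) := by positivity
    rw [hD]; linarith
  have hsmall : 4 * K * (c * B ^ 2 + ‖S.b‖ * B) * r ≤ 1 := by
    rw [← hrD]
    gcongr
    rw [hD]; linarith
  have h0 : ∀ i, MvPowerSeries.constantCoeff (S.sol i) = S.z0 i := fun i => by
    rw [← S.T_sol]; exact S.coeff_T_zero _ i
  have key : ∀ N : ℕ, ∀ i, nrm r N (S.sol i - MvPowerSeries.C (S.z0 i)) ≤ B * r := by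
    intro N
    induction N with
    | zero =>
      intro i
      have : nrm r 0 (S.sol i - MvPowerSeries.C (S.z0 i)) = 0 := by
        refine Finset.sum_eq_zero fun n hn => ?_
        rw [mem_tri, Nat.le_zero, deg_eq_zero] at hn
        subst hn
        simp [h0]
      rw [this]; positivity
    | succ N ih =>
      intro i
      have hpt : ∀ j, MvPowerSeries.constantCoeff (pt S.sol tP sP j) = pt S.z0 0 0 j := by
        intro j
        have := congrFun (constantCoeff_pt S.sol) j
        simp only [h0] at this
        exact this
      have hd : ∀ j, nrm r N (pt S.sol tP sP j - MvPowerSeries.C (pt S.z0 0 0 j)) ≤ B * r := by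
        rintro (j | j)
        · exact ih j
        · have : r ≤ B * r := le_mul_of_one_le_left hr0.le hB1
          fin_cases j
          · simpa [tP] using (nrm_X_le hr0.le N 0).trans this
          · simpa [sP] using (nrm_X_le hr0.le N 1).trans this
      set R : Fin 4 → Pow := fun k => aeval (pt S.sol tP sP) (S.F k)
        - MvPowerSeries.C (aeval (pt S.z0 0 0) (S.F k))
        - ∑ j, MvPowerSeries.C (aeval (pt S.z0 0 0) (pderiv j (S.F k)))
            * (pt S.sol tP sP j - MvPowerSeries.C (pt S.z0 0 0 j)) with hR
      have hRk : ∀ k, nrm r (N + 1) (R k) ≤ c * (B * r) ^ 2 := fun k =>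
        hT k r (B * r) N _ hr0.le (by positivity) hBr hpt hd
      set G : Fin 4 → Pow := fun k => R k
        + (MvPowerSeries.C (ev0 S.z0 (pderiv (Sum.inr 0) (S.F k))) * tP
          + MvPowerSeries.C (ev0 S.z0 (pderiv (Sum.inr 1) (S.F k))) * sP) with hG
      have hrest : ∀ k, S.rest S.sol k = G k + MvPowerSeries.C S.b
          * (sP * euler 1 (S.sol k - MvPowerSeries.C (S.z0 k))) := by
        intro k
        have he : euler 1 (S.sol k - MvPowerSeries.C (S.z0 k)) = euler 1 (S.sol k) := by
          rw [map_sub, sub_eq_self]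
          exact (euler 1).map_algebraMap (S.z0 k)
        have hk : aeval (pt S.z0 0 0) (S.F k) = 0 := S.equil k
        rw [he, Sys.rest, hG, hR]
        simp only [hk, Fintype.sum_sum_type, Fin.sum_univ_two, pt_inl, pt_inr_zero, pt_inr_one,
          map_zero, sub_zero]
        simp only [Sys.L, ev, ev0, Matrix.of_apply]
        ring
      have hGk : ∑ k, nrm r (N + 1) (G k) ≤ 4 * (c * (B * r) ^ 2) + l * r := by
        have : ∀ k, nrm r (N + 1) (G k) ≤ c * (B * r) ^ 2
            + (‖ev0 S.z0 (pderiv (Sum.inr 0) (S.F k))‖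
              + ‖ev0 S.z0 (pderiv (Sum.inr 1) (S.F k))‖) * r := by
          intro k
          refine (nrm_add hr0.le _ _ _).trans (add_le_add (hRk k) ?_)
          refine (nrm_add hr0.le _ _ _).trans ?_
          rw [nrm_C_mul, nrm_C_mul, add_mul]
          gcongr
          · exact nrm_X_le hr0.le _ 0
          · exact nrm_X_le hr0.le _ 1
        refine (Finset.sum_le_sum fun k _ => this k).trans (le_of_eq ?_)
        rw [Finset.sum_add_distrib, hl, Finset.sum_mul]
        simp
      have hs : ∀ k, nrm r (N + 1) (sP * (S.sol k - MvPowerSeries.C (S.z0 k))) ≤ r * (B * r) := by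
        intro k
        refine (nrm_succ_mul hr0.le N (by simp [sP]) (by simp [h0])).trans ?_
        exact mul_le_mul (nrm_X_le hr0.le _ 1) (ih k) (nrm_nonneg hr0.le _ _) hr0.le
      have hfin := S.nrm_T_le hK hr0.le (N + 1) i S.sol G _ hrest
      rw [S.T_sol] at hfin
      refine hfin.trans ?_
      rw [← Finset.mul_sum, Finset.sum_add_distrib, ← Finset.mul_sum]
      have hs' : ∑ k, nrm r (N + 1) (sP * (S.sol k - MvPowerSeries.C (S.z0 k)))
          ≤ 4 * (r * (B * r)) := by
        refine (Finset.sum_le_sum fun k _ => hs k).trans (le_of_eq ?_)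
        simp
      calc K * (∑ k, nrm r (N + 1) (G k) + ‖S.b‖
            * ∑ k, nrm r (N + 1) (sP * (S.sol k - MvPowerSeries.C (S.z0 k))))
          ≤ K * ((4 * (c * (B * r) ^ 2) + l * r) + ‖S.b‖ * (4 * (r * (B * r)))) := by gcongr
        _ = (4 * K * (c * B ^ 2 + ‖S.b‖ * B) * r + K * l) * r := by ring
        _ ≤ (1 + 4 * K * l) * r := by
            have : 0 ≤ K * l := by positivity
            gcongr
            linarith
        _ = B * r := by rw [hB]; ring
  refine ⟨r, hr0, fun i => ?_⟩
  have hsum : Summable fun n : Fin 2 →₀ ℕ =>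
      ‖MvPowerSeries.coeff n (S.sol i - MvPowerSeries.C (S.z0 i))‖ * r ^ deg n := by
    refine summable_of_sum_le (c := B * r) (fun n => by positivity) fun u => ?_
    refine le_trans ?_ (key (u.sup deg) i)
    refine Finset.sum_le_sum_of_subset_of_nonneg (fun n hn => mem_tri.2 (Finset.le_sup hn))
      fun _ _ _ => by positivity
  -- Restoring the constant term changes only one summand.
  refine (summable_congr_cofinite ?_).1 hsum
  refine (Set.finite_singleton (0 : Fin 2 →₀ ℕ)).subset fun n hn => ?_
  by_contra h
  classical
  refine hn ?_
  rw [Set.mem_ofPred_eq]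
  simp only [deg]
  exact (by rw [map_sub, MvPowerSeries.coeff_C, if_neg fun h0 => h (Set.mem_singleton_iff.2 h0), sub_zero])

end Garnier

namespace Garnier

open MvPolynomial

/-! ## Inverting `wt b n - L` -/

/-- From `z N = 1 + L N` the sum `m` of the norms of the entries satisfies `‖z‖ m ≤ 4 + l m`, where
`4` comes from the identity matrix; with `l ≤ ‖z‖ / 2` this gives `‖z‖ m ≤ 8`. -/
theorem norm_entry_mul_le {L N : Matrix (Fin 4) (Fin 4) ℂ} {z : ℂ}
    (h : (z • 1 - L) * N = 1) (hz : 2 * (∑ i, ∑ j, ‖L i j‖) ≤ ‖z‖) (i k : Fin 4) :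
    ‖N i k‖ * ‖z‖ ≤ 8 := by
  set l : ℝ := ∑ i, ∑ j, ‖L i j‖ with hl
  set m : ℝ := ∑ i, ∑ k, ‖N i k‖ with hm
  have hN : ∀ i k, z * N i k = (1 : Matrix (Fin 4) (Fin 4) ℂ) i k + ∑ j, L i j * N j k := by
    intro i k
    have := congrFun (congrFun h i) k
    rw [sub_mul, smul_mul_assoc, one_mul] at this
    simp only [Matrix.sub_apply, Matrix.smul_apply, smul_eq_mul, Matrix.mul_apply] at this
    rw [← this]; ring
  have hb : ‖z‖ * m ≤ 4 + l * m := by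
    calc ‖z‖ * m = ∑ i, ∑ k, ‖z * N i k‖ := by
          simp only [hm, Finset.mul_sum, norm_mul]
      _ ≤ ∑ i, ∑ k, (‖(1 : Matrix (Fin 4) (Fin 4) ℂ) i k‖ + ∑ j, ‖L i j‖ * ‖N j k‖) := by
          refine Finset.sum_le_sum fun i _ => Finset.sum_le_sum fun k _ => ?_
          rw [hN]
          refine (norm_add_le _ _).trans (add_le_add le_rfl ((norm_sum_le _ _).trans ?_))
          simp only [norm_mul]; exact le_rfl
      _ = 4 + ∑ i, ∑ k, ∑ j, ‖L i j‖ * ‖N j k‖ := by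
          simp only [Finset.sum_add_distrib]
          congr 1
          simp [Matrix.one_apply, Fin.sum_univ_four]; norm_num
      _ ≤ 4 + l * m := by
          gcongr
          rw [hl, Finset.sum_mul]
          refine Finset.sum_le_sum fun i _ => ?_
          rw [Finset.sum_comm, Finset.sum_mul]
          refine Finset.sum_le_sum fun j _ => ?_
          rw [← Finset.mul_sum]
          gcongr
          exact Finset.single_le_sum (f := fun j => ∑ k, ‖N j k‖)
            (fun _ _ => Finset.sum_nonneg fun _ _ => norm_nonneg _) (Finset.mem_univ j)
  have hNm : ‖N i k‖ ≤ m := by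
    refine (Finset.single_le_sum (f := fun k => ‖N i k‖)
      (fun _ _ => norm_nonneg _) (Finset.mem_univ k)).trans ?_
    exact Finset.single_le_sum (f := fun i => ∑ k, ‖N i k‖)
      (fun _ _ => Finset.sum_nonneg fun _ _ => norm_nonneg _) (Finset.mem_univ i)
  have h0 : 0 ≤ m := (norm_nonneg _).trans hNm
  have h1 : ‖N i k‖ * ‖z‖ ≤ m * ‖z‖ := by gcongr
  nlinarith

/-- If the combined matrix is singular, its kernel is stable under the commuting matrix `Lt`, so it
contains an eigenvector of `Lt`, which is then also one of `Ls`. The eigenvalues `c`, `d` satisfy `c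
- n₀ + b (d - n₁) = 0`, an equation that determines `b` unless `c = n₀` and `d = n₁`. Countably many
`b` are thus excluded, and for the others only the forbidden joint eigenvector remains. -/
theorem exists_pos_nonresonant {Lt Ls : Matrix (Fin 4) (Fin 4) ℂ} (hc : Lt * Ls = Ls * Lt)
    (hnr : ∀ n : Fin 2 →₀ ℕ, n ≠ 0 → ∀ v : Fin 4 → ℂ, Lt.mulVec v = (n 0 : ℂ) • v →
      Ls.mulVec v = (n 1 : ℂ) • v → v = 0) :
    ∃ b : ℝ, 0 < b ∧ ∀ n : Fin 2 →₀ ℕ, n ≠ 0 → IsUnit (wt b n • 1 - (Lt + (b : ℂ) • Ls)) := by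
  set ft := Matrix.toLin' Lt with hft
  set fs := Matrix.toLin' Ls with hfs
  set bad : Set ℝ := ⋃ c ∈ {c | Module.End.HasEigenvalue ft c},
    ⋃ d ∈ {d | Module.End.HasEigenvalue fs d}, ⋃ n : Fin 2 →₀ ℕ,
      {b : ℝ | c - n 0 + b * (d - n 1) = 0 ∧ ¬(c = n 0 ∧ d = n 1)} with hbad
  have hcount : bad.Countable := by
    refine (Module.End.finite_hasEigenvalue ft).countable.biUnion fun c _ => ?_
    refine (Module.End.finite_hasEigenvalue fs).countable.biUnion fun d _ => ?_
    refine Set.countable_iUnion fun n => Set.Subsingleton.countable ?_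
    rintro x ⟨hx, hx'⟩ y ⟨hy, -⟩
    have hd : d - n 1 ≠ 0 := by
      intro h
      rw [h, mul_zero, add_zero, sub_eq_zero] at hx
      exact hx' ⟨hx, sub_eq_zero.1 h⟩
    have : (x : ℂ) = y := mul_right_cancel₀ hd (by linear_combination hx - hy)
    exact_mod_cast this
  -- The complement of a countable set of reals is dense, so it meets the positive half line.
  obtain ⟨b, hb0, hb⟩ := (hcount.dense_compl ℝ).inter_open_nonempty _ isOpen_Ioi
    ⟨1, (Set.mem_Ioi.2 one_pos : (1 : ℝ) ∈ Set.Ioi 0)⟩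
  refine ⟨b, hb0, fun n hn => ?_⟩
  have hbc : (b : ℂ) ≠ 0 := by exact_mod_cast (ne_of_gt hb0)
  set Q : Matrix (Fin 4) (Fin 4) ℂ := wt b n • 1 - (Lt + (b : ℂ) • Ls) with hQ
  rw [← Matrix.mulVec_injective_iff_isUnit]
  by_contra hinj
  set p := LinearMap.ker (Matrix.toLin' Q) with hp
  have hp0 : p ≠ ⊥ := fun h => hinj (by
    have := LinearMap.ker_eq_bot.1 h
    simpa [Function.Injective, Matrix.toLin'_apply] using this)
  have hmem : ∀ w, w ∈ p ↔ Q.mulVec w = 0 := fun w => by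
    rw [hp, LinearMap.mem_ker, Matrix.toLin'_apply]
  have hcomm : Q * Lt = Lt * Q := by
    rw [hQ, sub_mul, mul_sub, add_mul, mul_add, smul_mul_assoc, smul_mul_assoc, mul_smul_comm,
      mul_smul_comm, one_mul, mul_one, hc]
  have hmaps : ∀ w ∈ p, ft w ∈ p := by
    intro w hw
    rw [hmem] at hw ⊢
    rw [hft, Matrix.toLin'_apply, Matrix.mulVec_mulVec, hcomm, ← Matrix.mulVec_mulVec, hw,
      Matrix.mulVec_zero]
  have : Nontrivial p := Submodule.nontrivial_iff_ne_bot.2 hp0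
  obtain ⟨c, hcv⟩ := Module.End.exists_eigenvalue (ft.restrict hmaps)
  obtain ⟨w, hw⟩ := hcv.exists_hasEigenvector
  have hw1 : Lt.mulVec (w : Fin 4 → ℂ) = c • (w : Fin 4 → ℂ) := by
    have := congrArg Subtype.val hw.apply_eq_smul
    simpa [hft, Matrix.toLin'_apply] using this
  have hw0 : (w : Fin 4 → ℂ) ≠ 0 := fun h => hw.2 (Subtype.ext h)
  have hw2 : Ls.mulVec (w : Fin 4 → ℂ) = ((wt b n - c) / b) • (w : Fin 4 → ℂ) := by
    have h1 := (hmem _).1 w.2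
    rw [hQ, Matrix.sub_mulVec, Matrix.add_mulVec, Matrix.smul_mulVec, Matrix.smul_mulVec,
      Matrix.one_mulVec, hw1] at h1
    funext i
    have h2 := congrFun h1 i
    simp only [Pi.sub_apply, Pi.add_apply, Pi.smul_apply, smul_eq_mul, Pi.zero_apply] at h2 ⊢
    field_simp
    linear_combination -h2
  have he1 : Module.End.HasEigenvalue ft c :=
    Module.End.hasEigenvalue_of_hasEigenvector
      ⟨Module.End.mem_eigenspace_iff.2 (by rw [hft, Matrix.toLin'_apply, hw1]), hw0⟩
  have he2 : Module.End.HasEigenvalue fs ((wt b n - c) / b) :=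
    Module.End.hasEigenvalue_of_hasEigenvector
      ⟨Module.End.mem_eigenspace_iff.2 (by rw [hfs, Matrix.toLin'_apply, hw2]), hw0⟩
  have hgood : c = n 0 ∧ (wt b n - c) / b = n 1 := by
    by_contra hne
    refine hb (Set.mem_biUnion he1 (Set.mem_biUnion he2 (Set.mem_iUnion.2 ⟨n, ?_, hne⟩)))
    rw [wt]
    field_simp
    ring
  rw [hgood.1] at hw1
  rw [hgood.2] at hw2
  exact hw0 (hnr n hn _ hw1 hw2)

/-- Since `b > 0`, `‖wt b n‖ ≥ min 1 b * deg n`. Large `n` fall under `norm_entry_mul_le`, and the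
finitely many others are added to the constant. -/
theorem exists_bound {L : Matrix (Fin 4) (Fin 4) ℂ} {b : ℝ} (hb : 0 < b)
    {M : (Fin 2 →₀ ℕ) → Matrix (Fin 4) (Fin 4) ℂ}
    (hM : ∀ n ≠ 0, (wt b n • 1 - L) * M n = 1) :
    ∃ K : ℝ, ∀ n ≠ 0, ∀ i k, ‖M n i k‖ * deg n ≤ K := by
  set l : ℝ := ∑ i, ∑ j, ‖L i j‖ with hl
  set e : ℝ := min 1 b with he
  have he0 : 0 < e := lt_min one_pos hb
  have hwt : ∀ n, e * deg n ≤ ‖wt b n‖ := by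
    intro n
    have h1 : wt b n = ((n 0 + b * n 1 : ℝ) : ℂ) := by simp [wt]
    rw [h1, Complex.norm_real, Real.norm_of_nonneg (by positivity), deg]
    push_cast
    have h2 : e * n 0 ≤ 1 * n 0 := by gcongr; exact min_le_left _ _
    have h3 : e * n 1 ≤ b * n 1 := by gcongr; exact min_le_right _ _
    linarith
  obtain ⟨N, hN⟩ := exists_nat_gt (2 * l / e)
  refine ⟨8 / e + ∑ n ∈ tri N, ∑ i, ∑ k, ‖M n i k‖ * deg n, fun n hn i k => ?_⟩
  have hpos : ∀ n, 0 ≤ ∑ i, ∑ k, ‖M n i k‖ * (deg n : ℝ) := fun n =>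
    Finset.sum_nonneg fun _ _ => Finset.sum_nonneg fun _ _ => by positivity
  by_cases hd : deg n ≤ N
  · have h1 : ‖M n i k‖ * deg n ≤ ∑ n ∈ tri N, ∑ i, ∑ k, ‖M n i k‖ * deg n := by
      refine le_trans ?_ (Finset.single_le_sum
        (f := fun n => ∑ i, ∑ k, ‖M n i k‖ * (deg n : ℝ)) (fun n _ => hpos n) (mem_tri.2 hd))
      refine le_trans ?_ (Finset.single_le_sum
        (f := fun i => ∑ k, ‖M n i k‖ * (deg n : ℝ))
        (fun _ _ => Finset.sum_nonneg fun _ _ => by positivity) (Finset.mem_univ i))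
      exact Finset.single_le_sum (f := fun k => ‖M n i k‖ * (deg n : ℝ))
        (fun _ _ => by positivity) (Finset.mem_univ k)
    have : 0 ≤ 8 / e := by positivity
    linarith
  · have h2 : 2 * l ≤ ‖wt b n‖ := by
      refine le_trans ?_ (hwt n)
      have h3 : (N : ℝ) ≤ deg n := by exact_mod_cast (not_le.1 hd).le
      rw [div_lt_iff₀ he0] at hN
      nlinarith
    have h4 := norm_entry_mul_le (hM n hn) h2 i k
    have h5 : ‖M n i k‖ * deg n ≤ 8 / e := by
      rw [le_div_iff₀ he0]
      have := mul_le_mul_of_nonneg_left (hwt n) (norm_nonneg (M n i k))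
      linarith
    have : 0 ≤ ∑ n ∈ tri N, ∑ i, ∑ k, ‖M n i k‖ * (deg n : ℝ) :=
      Finset.sum_nonneg fun n _ => hpos n
    linarith

/-! ## Compatible pairs of logarithmic systems -/

/-- The power series solutions, with constant term `z0`, of the pair of systems
`t₁ ∂Z/∂t₁ = A(Z, t₁, s₂)`, `s₂ (s₂ - 1) ∂Z/∂s₂ = B(Z, t₁, s₂)`. -/
def PairSol (A B : Fin 4 → Poly) (z0 : Fin 4 → ℂ) (Z : Fin 4 → Pow) : Prop :=
  (∀ i, MvPowerSeries.constantCoeff (Z i) = z0 i) ∧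
  ∀ i, euler 0 (Z i) = ev Z (A i) ∧ (sP - 1) * euler 1 (Z i) = ev Z (B i)

/-- The integrability condition of the pair of systems. -/
def Compat (A B : Fin 4 → Poly) : Prop :=
  ∀ i, X (Sum.inr 0) * pderiv (Sum.inr 0) (B i) + ∑ j, pderiv (Sum.inl j) (B i) * A j
    = X (Sum.inr 1) * (X (Sum.inr 1) - 1) * pderiv (Sum.inr 1) (A i)
      + ∑ j, pderiv (Sum.inl j) (A i) * B j

/-- The Jacobian matrix in the unknowns at `(z0, 0, 0)`. -/
noncomputable def jac (A : Fin 4 → Poly) (z0 : Fin 4 → ℂ) : Matrix (Fin 4) (Fin 4) ℂ :=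
  Matrix.of fun i j => ev0 z0 (pderiv (Sum.inl j) (A i))

/-- Differentiate the integrability condition at the equilibrium: second derivatives are multiplied
by values of `A` or `B`, and the explicit derivatives by `t₁` or `s₂`, all zero there. Only the
products of Jacobians survive. -/
theorem Compat.jac_comm {A B : Fin 4 → Poly} (h : Compat A B) {z0 : Fin 4 → ℂ}
    (hA : ∀ i, ev0 z0 (A i) = 0) (hB : ∀ i, ev0 z0 (B i) = 0) :
    jac B z0 * jac A z0 = jac A z0 * jac B z0 := by
  ext i k
  have h1 := congrArg (fun p => ev0 z0 (pderiv (Sum.inl k) p)) (h i)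
  have ht : ev0 z0 (X (Sum.inr 0)) = 0 := by simp [ev0]
  have hs : ev0 z0 (X (Sum.inr 1)) = 0 := by simp [ev0]
  simp only [map_add, pderiv_mul, map_mul, map_sum, hA, hB, ht, hs, pderiv_X, map_sub] at h1
  simpa [Matrix.mul_apply, jac] using h1

theorem euler_zero_theta (b : ℂ) (F : Pow) : euler 0 (theta b F) = theta b (euler 0 F) := by
  have hc : euler 0 (euler 1 F) = euler 1 (euler 0 F) := by
    ext n
    rw [coeff_euler, coeff_euler, coeff_euler, coeff_euler]; ring
  have hC : euler 0 (MvPowerSeries.C b : Pow) = 0 := (euler 0).map_algebraMap b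
  simp [theta, hc, hC, euler_zero_sP]

/-- `theta b` is the first operator of the pair minus `b` times the second, whence the right hand
side `A - b B`. -/
theorem PairSol.theta_eq {A B : Fin 4 → Poly} {z0 : Fin 4 → ℂ} {Z : Fin 4 → Pow}
    (h : PairSol A B z0 Z) (b : ℂ) (i : Fin 4) :
    theta b (Z i) = ev Z (A i - C b * B i) := by
  have hC : ev Z (C b) = MvPowerSeries.C b := by simp [ev]; rfl
  rw [map_sub, map_mul, hC, ← (h.2 i).1, ← (h.2 i).2]
  simp only [theta, Derivation.add_apply, Derivation.smul_apply, smul_eq_mul]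
  ring

/-- Existence, uniqueness and convergence of the solution of a nonresonant compatible pair. -/
theorem exists_pairSol {A B : Fin 4 → Poly} (h : Compat A B) {z0 : Fin 4 → ℂ}
    (hA : ∀ i, ev0 z0 (A i) = 0) (hB : ∀ i, ev0 z0 (B i) = 0)
    (hnr : ∀ n : Fin 2 →₀ ℕ, n ≠ 0 → ∀ v : Fin 4 → ℂ, (jac A z0).mulVec v = (n 0 : ℂ) • v →
      (jac B z0).mulVec v = -(n 1 : ℂ) • v → v = 0) :
    ∃ Z : Fin 4 → Pow, PairSol A B z0 Z ∧
      (∃ r : ℝ, 0 < r ∧ ∀ i, Summable fun n : Fin 2 →₀ ℕ =>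
        ‖MvPowerSeries.coeff n (Z i)‖ * r ^ (n 0 + n 1)) ∧
      ∀ Z', PairSol A B z0 Z' → Z' = Z := by
  -- The sign of `jac B` is reversed because `s₂ (s₂ - 1) ∂/∂s₂` is `-s₂ ∂/∂s₂` to lowest order.
  obtain ⟨b, hb, hU⟩ := exists_pos_nonresonant (Lt := jac A z0) (Ls := -jac B z0)
    (by rw [mul_neg, neg_mul, h.jac_comm hA hB])
    (fun n hn v h1 h2 => hnr n hn v h1 (by
      rw [Matrix.neg_mulVec] at h2; rw [neg_smul, ← h2, neg_neg]))
  have hbc : (b : ℂ) ≠ 0 := by exact_mod_cast hb.ne'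
  set S : Sys :=
    { F := fun i => A i - C (b : ℂ) * B i
      z0 := z0
      b := b
      -- At `n = 0` this inverse may be the default value zero; that index is treated separately in
      -- `Sys.T`.
      M := fun n => (wt b n • 1 - (jac A z0 + (b : ℂ) • -jac B z0))⁻¹
      equil := fun i => by rw [map_sub, map_mul, hA, hB]; simp } with hS
  have hL : S.L = jac A z0 + (b : ℂ) • -jac B z0 := by
    ext i j
    simp only [Sys.L, hS, jac, Matrix.of_apply, Matrix.add_apply, Matrix.smul_apply,
      Matrix.neg_apply, map_sub, pderiv_C_mul, map_mul, smul_eq_mul]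
    have : ev0 z0 (C (b : ℂ)) = b := by simp [ev0]
    rw [this]; ring
  have hI : S.Inv := by
    intro n hn
    rw [hL]
    exact Matrix.mul_nonsing_inv _ ((Matrix.isUnit_iff_isUnit_det _).1 (hU n hn))
  obtain ⟨K, hK⟩ := exists_bound hb (M := S.M) (L := S.L) hI
  obtain ⟨h0, hsol⟩ := S.sol_spec hI
  have hZ0 : ∀ F : Poly, MvPowerSeries.constantCoeff (ev S.sol F) = ev0 z0 F := by
    intro F
    rw [constantCoeff_ev]
    simp only [h0]
    rfl
  have hCb : ev S.sol (C (b : ℂ)) = MvPowerSeries.C (b : ℂ) := by simp [ev]; rfl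
  -- `W` measures the failure of the `t₁`-equation. Since `theta b` commutes with `t₁ ∂/∂t₁`,
  -- differentiating the `θ`-equation and inserting the integrability condition leaves the
  -- linearised equation for `W`.
  set W : Fin 4 → Pow := fun i => euler 0 (S.sol i) - ev S.sol (A i) with hWdef
  have hW : W = 0 := by
    refine S.linear_unique hI h0 (fun i => ?_) (fun i => ?_)
    · have h1 : MvPowerSeries.constantCoeff (euler 0 (S.sol i)) = 0 := by
        rw [← MvPowerSeries.coeff_zero_eq_constantCoeff_apply, coeff_euler]; simp
      rw [hWdef]
      simp only
      rw [map_sub, h1, hZ0, hA, sub_zero]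
    · have hcompat := congrArg (ev S.sol) (h i)
      have hXt : ev S.sol (X (Sum.inr 0)) = tP := by simp [ev]
      have hXs : ev S.sol (X (Sum.inr 1)) = sP := by simp [ev]
      simp only [map_add, map_mul, map_sum, map_sub, map_one, hXt, hXs] at hcompat
      have hts : theta b tP = tP := by simp [theta, euler_tP_zero, euler_one_tP]
      have hss : theta b sP = MvPowerSeries.C (b : ℂ) * (1 - sP) * sP := by
        simp [theta, euler_zero_sP, euler_one_sP]
      have e1 : theta b (W i) = euler 0 (ev S.sol (S.F i)) - theta b (ev S.sol (A i)) := by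
        rw [hWdef, map_sub, ← euler_zero_theta, hsol]
      have e2 : ∀ j, euler 0 (S.sol j) = W j + ev S.sol (A j) := fun j => by
        rw [hWdef]; ring
      rw [show theta S.b (W i) = theta b (W i) from rfl, e1, derivation_ev, derivation_ev]
      have hF : ∀ j, theta b (S.sol j)
          = ev S.sol (A j) - MvPowerSeries.C (b : ℂ) * ev S.sol (B j) := fun j => by
        rw [← hCb, ← map_mul, ← map_sub]; exact hsol j
      have hFd : ∀ x, ev S.sol (pderiv x (S.F i)) = ev S.sol (pderiv x (A i))
          - MvPowerSeries.C (b : ℂ) * ev S.sol (pderiv x (B i)) := fun x => by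
        rw [← hCb, ← map_mul, ← map_sub, ← pderiv_C_mul, ← map_sub]
      simp only [hF, hts, hss, e2, euler_tP_zero, euler_zero_sP, hFd]
      simp only [Fin.sum_univ_four] at hcompat ⊢
      linear_combination (-MvPowerSeries.C (b : ℂ)) * hcompat
  have hWi : ∀ i, euler 0 (S.sol i) = ev S.sol (A i) := fun i =>
    sub_eq_zero.1 (congrFun hW i)
  refine ⟨S.sol, ⟨h0, fun i => ⟨hWi i, ?_⟩⟩, S.convergent hK, fun Z' hZ' => ?_⟩
  · have h1 := hsol i
    have h2 : theta S.b (S.sol i) = euler 0 (S.sol i)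
        + MvPowerSeries.C (b : ℂ) * (1 - sP) * euler 1 (S.sol i) := rfl
    have h3 : ev S.sol (S.F i) = ev S.sol (A i) - MvPowerSeries.C (b : ℂ) * ev S.sol (B i) := by
      rw [← hCb, ← map_mul, ← map_sub]
    rw [h2, h3, hWi] at h1
    have hb1 : (MvPowerSeries.C (b : ℂ)⁻¹ : Pow) * MvPowerSeries.C (b : ℂ) = 1 := by
      rw [← map_mul, inv_mul_cancel₀ hbc, map_one]
    -- Once the `t₁`-equation holds, subtracting it from the `θ`-equation and dividing by `b` leaves
    -- the `s₂`-equation.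
    linear_combination (-MvPowerSeries.C (b : ℂ)⁻¹) * h1
      + (-(sP - 1) * euler 1 (S.sol i) + ev S.sol (B i)) * hb1
  · exact S.sol_unique hI ⟨hZ'.1, fun i => hZ'.theta_eq b i⟩

/-! ## Hamiltonian pairs -/

theorem pderiv_pderiv_comm {σ : Type*} (i j : σ) (p : MvPolynomial σ ℂ) :
    pderiv i (pderiv j p) = pderiv j (pderiv i p) := by
  classical
  have h : ⁅(pderiv i : Derivation ℂ (MvPolynomial σ ℂ) (MvPolynomial σ ℂ)),
      (pderiv j : Derivation ℂ (MvPolynomial σ ℂ) (MvPolynomial σ ℂ))⁆ = 0 := by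
    refine MvPolynomial.derivation_ext fun k => ?_
    rw [Derivation.commutator_apply, pderiv_X, pderiv_X]
    simp only [Pi.single_apply]
    split_ifs <;> simp
  have := congrArg (fun D => D p) h
  simpa [Derivation.commutator_apply, sub_eq_zero] using this

/-- The right hand side of `t₁ ∂Z/∂t₁ = …` for the Hamiltonian `K`. -/
noncomputable def fieldT (K : Poly) : Fin 4 → Poly :=
  ![-pderiv (Sum.inl 2) K, -pderiv (Sum.inl 3) K, pderiv (Sum.inl 0) K, pderiv (Sum.inl 1) K]

/-- The right hand side of `s₂ (s₂ - 1) ∂Z/∂s₂ = …` for the Hamiltonian `K`. -/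
noncomputable def fieldS (K : Poly) : Fin 4 → Poly :=
  ![pderiv (Sum.inl 2) K, pderiv (Sum.inl 3) K, -pderiv (Sum.inl 0) K, -pderiv (Sum.inl 1) K]

/-- The curvature of a pair of Hamiltonians. -/
noncomputable def curvature (K1 K2 : Poly) : Poly :=
  X (Sum.inr 0) * pderiv (Sum.inr 0) K2
    + X (Sum.inr 1) * (X (Sum.inr 1) - 1) * pderiv (Sum.inr 1) K1
    + (pderiv (Sum.inl 0) K1 * pderiv (Sum.inl 2) K2 - pderiv (Sum.inl 2) K1 * pderiv (Sum.inl 0) K2)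
    + (pderiv (Sum.inl 1) K1 * pderiv (Sum.inl 3) K2 - pderiv (Sum.inl 3) K1 * pderiv (Sum.inl 1) K2)

/-- For Hamiltonian fields, each component of the integrability condition is, up to sign, the
derivative of the curvature in the conjugate unknown. The curvature thus need only be independent of
the unknowns. Its signs reflect that `fieldT K1` is the Hamiltonian field of `-K1`, as `t₁ = 1 /
s₁`. -/
theorem compat_of_curvature {K1 K2 : Poly}
    (h : ∀ j : Fin 4, pderiv (Sum.inl j) (curvature K1 K2) = 0) : Compat (fieldT K1) (fieldS K2) := by
  have hx : ∀ (j : Fin 4) (k : Fin 2), pderiv (Sum.inl j) (X (Sum.inr k) : Poly) = 0 :=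
    fun j k => pderiv_X_of_ne Sum.inr_ne_inl
  have h' := h
  simp only [curvature, map_add, map_sub, pderiv_mul, hx, pderiv_one] at h'
  have c1 := fun j : Fin 4 => pderiv_pderiv_comm (Sum.inl j) (Sum.inr 0) K2
  have c2 := fun j : Fin 4 => pderiv_pderiv_comm (Sum.inl j) (Sum.inr 1) K1
  simp only [c1, c2] at h'
  have d1 : ∀ K : Poly, pderiv (Sum.inl 1) (pderiv (Sum.inl 0) K)
    = pderiv (Sum.inl 0) (pderiv (Sum.inl 1) K) := pderiv_pderiv_comm _ _
  have d2 : ∀ K : Poly, pderiv (Sum.inl 2) (pderiv (Sum.inl 0) K)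
    = pderiv (Sum.inl 0) (pderiv (Sum.inl 2) K) := pderiv_pderiv_comm _ _
  have d3 : ∀ K : Poly, pderiv (Sum.inl 3) (pderiv (Sum.inl 0) K)
    = pderiv (Sum.inl 0) (pderiv (Sum.inl 3) K) := pderiv_pderiv_comm _ _
  have d4 : ∀ K : Poly, pderiv (Sum.inl 2) (pderiv (Sum.inl 1) K)
    = pderiv (Sum.inl 1) (pderiv (Sum.inl 2) K) := pderiv_pderiv_comm _ _
  have d5 : ∀ K : Poly, pderiv (Sum.inl 3) (pderiv (Sum.inl 1) K)
    = pderiv (Sum.inl 1) (pderiv (Sum.inl 3) K) := pderiv_pderiv_comm _ _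
  have d6 : ∀ K : Poly, pderiv (Sum.inl 3) (pderiv (Sum.inl 2) K)
    = pderiv (Sum.inl 2) (pderiv (Sum.inl 3) K) := pderiv_pderiv_comm _ _
  intro i
  fin_cases i <;> simp only [fieldT, fieldS, Fin.sum_univ_four, Fin.zero_eta, Fin.mk_one,
    Fin.reduceFinMk, Matrix.cons_val, map_neg]
  · have := h' 2
    simp only [d2, d4, d6] at this ⊢
    linear_combination this
  · have := h' 3
    simp only [d3, d5, d6] at this ⊢
    linear_combination this
  · have := h' 0
    simp only [d1, d2, d3] at this ⊢
    linear_combination -this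
  · have := h' 1
    simp only [d1, d4, d5] at this ⊢
    linear_combination -this

end Garnier

namespace Garnier

open MvPolynomial

/-! ## The four charts

In the chart `(e, f)` the unknowns are `Q₁, Q₂, P₁, P₂` with
`(q₁, p₁) = (Q₁ / t₁, t₁ P₁)` if `e`, `(q₁, p₁) = (Q₁, P₁)` otherwise, and
`(q₂, p₂) = (s₂ Q₂, P₂ / s₂)` if `f`, `(q₂, p₂) = (Q₂, P₂)` otherwise. -/

/-- `x` if the condition holds, `1` otherwise. -/
def pick {R : Type*} [One R] (e : Bool) (x : R) : R := if e then x else 1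

/-- The Hamiltonian of `t₁ ∂/∂t₁` in the chart `(e, f)`. -/
noncomputable def chartK1 (P : Params) (e f : Bool) : Poly :=
  let q1 : Poly := X (Sum.inl 0)
  let q2 : Poly := X (Sum.inl 1)
  let p1 : Poly := X (Sum.inl 2)
  let p2 : Poly := X (Sum.inl 3)
  let t : Poly := X (Sum.inr 0)
  let s : Poly := X (Sum.inr 1)
  -- The factors come from `t₁ q₁ = T Q₁`, `p₁ = U P₁`, `q₂ = V Q₂` and `s₂ = S V`. All negative
  -- powers cancel, so the Hamiltonian stays polynomial.
  let T : Poly := pick (!e) t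
  let U : Poly := pick e t
  let S : Poly := pick (!f) s
  let V : Poly := pick f s
  T * q1 ^ 3 * p1 ^ 2 - q1 ^ 2 * p1 ^ 2 + 2 * T * q1 ^ 2 * q2 * p1 * p2
    + T * q1 * q2 * (q2 - S) * p2 ^ 2
    - ((C P.a0 + C P.a2 - 1) * T * q1 ^ 2 + C P.a1 * q1 * (T * q1 - 1)
      + C P.eta * (T * q1 - 1) * U + C P.eta * U * V * q2) * p1
    - ((C P.a0 + C P.a1 - 1) * T * q1 * q2 + C P.a2 * T * q1 * (q2 - S)
      - C P.eta * t * (s - 1) * q2) * p2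
    -- The term `-Q₁ P₁` accounts for the dependence of the substitution on `t₁`: it produces the
    -- summand `Q₁` in `t₁ ∂(t₁ q₁)/∂t₁`.
    + C (P.nu * (P.nu + P.a8)) * T * q1 - (if e then q1 * p1 else 0)

/-- The Hamiltonian of `s₂ (s₂ - 1) ∂/∂s₂` in the chart `(e, f)`. -/
noncomputable def chartK2 (P : Params) (e f : Bool) : Poly :=
  let q1 : Poly := X (Sum.inl 0)
  let q2 : Poly := X (Sum.inl 1)
  let p1 : Poly := X (Sum.inl 2)
  let p2 : Poly := X (Sum.inl 3)
  let t : Poly := X (Sum.inr 0)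
  let s : Poly := X (Sum.inr 1)
  let T : Poly := pick (!e) t
  let U : Poly := pick e t
  let S : Poly := pick (!f) s
  let V : Poly := pick f s
  V * q1 ^ 2 * q2 * p1 ^ 2 + 2 * V * q1 * q2 * (q2 - S) * p1 * p2
    + (q2 * (V * q2 - 1) * (q2 - S) + S * (s - 1) * T * q1 * q2) * p2 ^ 2
    - ((C P.a0 + C P.a1 - 1) * V * q1 * q2 + C P.a2 * V * q1 * (q2 - S)
      - C P.eta * (s - 1) * U * V * q2) * p1
    - ((C P.a0 - 1) * q2 * (V * q2 - 1) + C P.a1 * V * q2 * (q2 - S)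
      + C P.a2 * (V * q2 - 1) * (q2 - S) + S * (s - 1) * C P.a2 * T * q1
      + C P.eta * s * (s - 1) * t * q2) * p2
    + C (P.nu * (P.nu + P.a8)) * V * q2 - (if f then (s - 1) * q2 * p2 else 0)

theorem pderiv_two {σ : Type*} (i : σ) : pderiv i (2 : MvPolynomial σ ℂ) = 0 := by
  rw [← map_ofNat C 2, pderiv_C]

-- The two flows commute with exactly zero curvature in every chart; this is a polynomial identity
-- in the unknowns, variables and parameters.
set_option maxHeartbeats 4000000 in
theorem curvature_chart (P : Params) (e f : Bool) :
    curvature (chartK1 P e f) (chartK2 P e f) = 0 := by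
  cases e <;> cases f <;>
  · simp only [curvature, chartK1, chartK2, pick, Bool.not_true, Bool.not_false, if_true, if_false,
      Bool.false_eq_true, map_add, map_sub, pderiv_mul, pderiv_pow, pderiv_C, pderiv_X, pderiv_one, map_zero,
      Pi.single_apply, Sum.inl.injEq, Sum.inr.injEq, reduceCtorEq, Fin.reduceEq, pderiv_two]
    ring

end Garnier

namespace Garnier

open MvPolynomial

/-! ### The chart vector fields in closed form over an arbitrary algebra -/

section Explicit

set_option linter.unusedSimpArgs false

variable {K : Type*} [CommRing K] [Algebra ℂ K]

/-- The right hand side of `t₁ ∂Z/∂t₁ = …` in the chart `(e, f)`. -/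
def chartT (P : Params) (e f : Bool) (t s : K) (Z : Fin 4 → K) : Fin 4 → K :=
  let c := algebraMap ℂ K
  let q1 := Z 0
  let q2 := Z 1
  let p1 := Z 2
  let p2 := Z 3
  let T := pick (!e) t
  let U := pick e t
  let S := pick (!f) s
  let V := pick f s
  ![-(2 * T * q1 ^ 3 * p1 - 2 * q1 ^ 2 * p1 + 2 * T * q1 ^ 2 * q2 * p2
      - ((c P.a0 + c P.a2 - 1) * T * q1 ^ 2 + c P.a1 * q1 * (T * q1 - 1)
        + c P.eta * (T * q1 - 1) * U + c P.eta * U * V * q2) - if e then q1 else 0),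
    -(2 * T * q1 ^ 2 * q2 * p1 + 2 * T * q1 * q2 * (q2 - S) * p2
      - ((c P.a0 + c P.a1 - 1) * T * q1 * q2 + c P.a2 * T * q1 * (q2 - S)
        - c P.eta * t * (s - 1) * q2)),
    3 * T * q1 ^ 2 * p1 ^ 2 - 2 * q1 * p1 ^ 2 + 4 * T * q1 * q2 * p1 * p2
      + T * q2 * (q2 - S) * p2 ^ 2
      - (2 * (c P.a0 + c P.a2 - 1) * T * q1 + c P.a1 * (2 * T * q1 - 1) + c P.eta * T * U) * p1
      - ((c P.a0 + c P.a1 - 1) * T * q2 + c P.a2 * T * (q2 - S)) * p2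
      + c (P.nu * (P.nu + P.a8)) * T - if e then p1 else 0,
    2 * T * q1 ^ 2 * p1 * p2 + T * q1 * (2 * q2 - S) * p2 ^ 2 - c P.eta * U * V * p1
      - ((c P.a0 + c P.a1 - 1) * T * q1 + c P.a2 * T * q1 - c P.eta * t * (s - 1)) * p2]

/-- The right hand side of `s₂ (s₂ - 1) ∂Z/∂s₂ = …` in the chart `(e, f)`. -/
def chartS (P : Params) (e f : Bool) (t s : K) (Z : Fin 4 → K) : Fin 4 → K :=
  let c := algebraMap ℂ K
  let q1 := Z 0
  let q2 := Z 1
  let p1 := Z 2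
  let p2 := Z 3
  let T := pick (!e) t
  let U := pick e t
  let S := pick (!f) s
  let V := pick f s
  ![2 * V * q1 ^ 2 * q2 * p1 + 2 * V * q1 * q2 * (q2 - S) * p2
      - ((c P.a0 + c P.a1 - 1) * V * q1 * q2 + c P.a2 * V * q1 * (q2 - S)
        - c P.eta * (s - 1) * U * V * q2),
    2 * V * q1 * q2 * (q2 - S) * p1
      + 2 * (q2 * (V * q2 - 1) * (q2 - S) + S * (s - 1) * T * q1 * q2) * p2
      - ((c P.a0 - 1) * q2 * (V * q2 - 1) + c P.a1 * V * q2 * (q2 - S)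
        + c P.a2 * (V * q2 - 1) * (q2 - S) + S * (s - 1) * c P.a2 * T * q1
        + c P.eta * s * (s - 1) * t * q2) - if f then (s - 1) * q2 else 0,
    -(2 * V * q1 * q2 * p1 ^ 2 + 2 * V * q2 * (q2 - S) * p1 * p2 + S * (s - 1) * T * q2 * p2 ^ 2
      - ((c P.a0 + c P.a1 - 1) * V * q2 + c P.a2 * V * (q2 - S)) * p1
      - S * (s - 1) * c P.a2 * T * p2),
    -(V * q1 ^ 2 * p1 ^ 2 + 2 * V * q1 * (2 * q2 - S) * p1 * p2
      + ((V * q2 - 1) * (q2 - S) + V * q2 * (q2 - S) + q2 * (V * q2 - 1)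
        + S * (s - 1) * T * q1) * p2 ^ 2
      - ((c P.a0 + c P.a1 - 1) * V * q1 + c P.a2 * V * q1 - c P.eta * (s - 1) * U * V) * p1
      - ((c P.a0 - 1) * (2 * V * q2 - 1) + c P.a1 * V * (2 * q2 - S)
        + c P.a2 * (V * (q2 - S) + (V * q2 - 1)) + c P.eta * s * (s - 1) * t) * p2
      + c (P.nu * (P.nu + P.a8)) * V - if f then (s - 1) * p2 else 0)]

theorem pderiv_pick (i : Fin 4) (k : Fin 2) (e : Bool) :
    pderiv (Sum.inl i) (pick e (X (Sum.inr k)) : Poly) = 0 := by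
  cases e <;> simp [pick]

theorem pderiv_ite (i : Fin 4) (e : Bool) (p : Poly) :
    pderiv (Sum.inl i) (if e then p else 0) = if e then pderiv (Sum.inl i) p else 0 := by
  cases e <;> simp

theorem aeval_pick_t (Z : Fin 4 → K) (t s : K) (e : Bool) :
    aeval (pt Z t s) (pick e (X (Sum.inr 0)) : Poly) = pick e t := by
  cases e <;> simp [pick]

theorem aeval_pick_s (Z : Fin 4 → K) (t s : K) (e : Bool) :
    aeval (pt Z t s) (pick e (X (Sum.inr 1)) : Poly) = pick e s := by
  cases e <;> simp [pick]

theorem aeval_ite (Y : Fin 4 ⊕ Fin 2 → K) (e : Bool) (p : Poly) :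
    aeval Y (if e then p else 0) = if e then aeval Y p else 0 := by
  cases e <;> simp

theorem pderiv_inr (i : Fin 4) (k : Fin 2) : pderiv (Sum.inl i) (X (Sum.inr k) : Poly) = 0 :=
  pderiv_X_of_ne Sum.inr_ne_inl

theorem pderiv_inl (i j : Fin 4) :
    pderiv (Sum.inl i) (X (Sum.inl j) : Poly) = if j = i then 1 else 0 := by
  rw [pderiv_X, Pi.single_apply]
  simp

theorem aeval_chartK1_zero (P : Params) (e f : Bool) (t s : K) (Z : Fin 4 → K) :
    aeval (pt Z t s) (-pderiv (Sum.inl 2) (chartK1 P e f)) = chartT P e f t s Z 0 := by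
  simp only [chartK1, pderiv_pick, pderiv_ite, pderiv_inr, pderiv_inl, pderiv_mul, pderiv_pow, pderiv_C,
    pderiv_one, pderiv_two, map_add, map_sub, Fin.reduceEq, if_true, if_false, mul_zero, zero_mul, mul_one,
    one_mul, add_zero, zero_add, sub_zero,
    ite_self]
  simp only [aeval_pick_t, aeval_pick_s, aeval_ite, map_add, map_sub, map_mul, map_pow, map_neg,
    map_zero, map_one, aeval_X, pt_inl, pt_inr_zero, pt_inr_one, algHom_C, map_ofNat, map_natCast]
  simp only [chartT, Matrix.cons_val]
  push_cast
  ring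

theorem aeval_chartK1_one (P : Params) (e f : Bool) (t s : K) (Z : Fin 4 → K) :
    aeval (pt Z t s) (-pderiv (Sum.inl 3) (chartK1 P e f)) = chartT P e f t s Z 1 := by
  simp only [chartK1, pderiv_pick, pderiv_ite, pderiv_inr, pderiv_inl, pderiv_mul, pderiv_pow, pderiv_C,
    pderiv_one, pderiv_two, map_add, map_sub, Fin.reduceEq, if_true, if_false, mul_zero, zero_mul, mul_one,
    one_mul, add_zero, zero_add, sub_zero,
    ite_self]
  simp only [aeval_pick_t, aeval_pick_s, aeval_ite, map_add, map_sub, map_mul, map_pow, map_neg,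
    map_zero, map_one, aeval_X, pt_inl, pt_inr_zero, pt_inr_one, algHom_C, map_ofNat, map_natCast]
  simp only [chartT, Matrix.cons_val]
  push_cast
  ring

theorem aeval_chartK1_two (P : Params) (e f : Bool) (t s : K) (Z : Fin 4 → K) :
    aeval (pt Z t s) (pderiv (Sum.inl 0) (chartK1 P e f)) = chartT P e f t s Z 2 := by
  simp only [chartK1, pderiv_pick, pderiv_ite, pderiv_inr, pderiv_inl, pderiv_mul, pderiv_pow, pderiv_C,
    pderiv_one, pderiv_two, map_add, map_sub, Fin.reduceEq, if_true, if_false, mul_zero, zero_mul, mul_one,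
    one_mul, add_zero, zero_add, sub_zero,
    ite_self]
  simp only [aeval_pick_t, aeval_pick_s, aeval_ite, map_add, map_sub, map_mul, map_pow, map_neg,
    map_zero, map_one, aeval_X, pt_inl, pt_inr_zero, pt_inr_one, algHom_C, map_ofNat, map_natCast]
  simp only [chartT, Matrix.cons_val]
  push_cast
  ring

theorem aeval_chartK1_three (P : Params) (e f : Bool) (t s : K) (Z : Fin 4 → K) :
    aeval (pt Z t s) (pderiv (Sum.inl 1) (chartK1 P e f)) = chartT P e f t s Z 3 := by
  simp only [chartK1, pderiv_pick, pderiv_ite, pderiv_inr, pderiv_inl, pderiv_mul, pderiv_pow, pderiv_C,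
    pderiv_one, pderiv_two, map_add, map_sub, Fin.reduceEq, if_true, if_false, mul_zero, zero_mul, mul_one,
    one_mul, add_zero, zero_add, sub_zero,
    ite_self]
  simp only [aeval_pick_t, aeval_pick_s, aeval_ite, map_add, map_sub, map_mul, map_pow, map_neg,
    map_zero, map_one, aeval_X, pt_inl, pt_inr_zero, pt_inr_one, algHom_C, map_ofNat, map_natCast]
  simp only [chartT, Matrix.cons_val]
  ring

theorem aeval_chartK2_zero (P : Params) (e f : Bool) (t s : K) (Z : Fin 4 → K) :
    aeval (pt Z t s) (pderiv (Sum.inl 2) (chartK2 P e f)) = chartS P e f t s Z 0 := by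
  simp only [chartK2, pderiv_pick, pderiv_ite, pderiv_inr, pderiv_inl, pderiv_mul, pderiv_pow, pderiv_C,
    pderiv_one, pderiv_two, map_add, map_sub, Fin.reduceEq, if_true, if_false, mul_zero, zero_mul, mul_one,
    one_mul, add_zero, zero_add, sub_zero,
    ite_self]
  simp only [aeval_pick_t, aeval_pick_s, aeval_ite, map_add, map_sub, map_mul, map_pow, map_neg,
    map_zero, map_one, aeval_X, pt_inl, pt_inr_zero, pt_inr_one, algHom_C, map_ofNat, map_natCast]
  simp only [chartS, Matrix.cons_val]
  push_cast
  ring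

theorem aeval_chartK2_one (P : Params) (e f : Bool) (t s : K) (Z : Fin 4 → K) :
    aeval (pt Z t s) (pderiv (Sum.inl 3) (chartK2 P e f)) = chartS P e f t s Z 1 := by
  simp only [chartK2, pderiv_pick, pderiv_ite, pderiv_inr, pderiv_inl, pderiv_mul, pderiv_pow, pderiv_C,
    pderiv_one, pderiv_two, map_add, map_sub, Fin.reduceEq, if_true, if_false, mul_zero, zero_mul, mul_one,
    one_mul, add_zero, zero_add, sub_zero,
    ite_self]
  simp only [aeval_pick_t, aeval_pick_s, aeval_ite, map_add, map_sub, map_mul, map_pow, map_neg,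
    map_zero, map_one, aeval_X, pt_inl, pt_inr_zero, pt_inr_one, algHom_C, map_ofNat, map_natCast]
  simp only [chartS, Matrix.cons_val]
  push_cast
  ring

theorem aeval_chartK2_two (P : Params) (e f : Bool) (t s : K) (Z : Fin 4 → K) :
    aeval (pt Z t s) (-pderiv (Sum.inl 0) (chartK2 P e f)) = chartS P e f t s Z 2 := by
  simp only [chartK2, pderiv_pick, pderiv_ite, pderiv_inr, pderiv_inl, pderiv_mul, pderiv_pow, pderiv_C,
    pderiv_one, pderiv_two, map_add, map_sub, Fin.reduceEq, if_true, if_false, mul_zero, zero_mul, mul_one,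
    one_mul, add_zero, zero_add, sub_zero,
    ite_self]
  simp only [aeval_pick_t, aeval_pick_s, aeval_ite, map_add, map_sub, map_mul, map_pow, map_neg,
    map_zero, map_one, aeval_X, pt_inl, pt_inr_zero, pt_inr_one, algHom_C, map_ofNat, map_natCast]
  simp only [chartS, Matrix.cons_val]
  push_cast
  ring

theorem aeval_chartK2_three (P : Params) (e f : Bool) (t s : K) (Z : Fin 4 → K) :
    aeval (pt Z t s) (-pderiv (Sum.inl 1) (chartK2 P e f)) = chartS P e f t s Z 3 := by
  simp only [chartK2, pderiv_pick, pderiv_ite, pderiv_inr, pderiv_inl, pderiv_mul, pderiv_pow, pderiv_C,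
    pderiv_one, pderiv_two, map_add, map_sub, Fin.reduceEq, if_true, if_false, mul_zero, zero_mul, mul_one,
    one_mul, add_zero, zero_add, sub_zero,
    ite_self]
  simp only [aeval_pick_t, aeval_pick_s, aeval_ite, map_add, map_sub, map_mul, map_pow, map_neg,
    map_zero, map_one, aeval_X, pt_inl, pt_inr_zero, pt_inr_one, algHom_C, map_ofNat, map_natCast]
  simp only [chartS, Matrix.cons_val]
  push_cast
  ring

/-- Integrability is known for the polynomials, while equilibria, eigenvectors and coefficients are
computed with the closed formula; this is the bridge. -/
theorem aeval_fieldT (P : Params) (e f : Bool) (t s : K) (Z : Fin 4 → K) (i : Fin 4) :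
    aeval (pt Z t s) (fieldT (chartK1 P e f) i) = chartT P e f t s Z i := by
  fin_cases i
  exacts [aeval_chartK1_zero P e f t s Z, aeval_chartK1_one P e f t s Z,
    aeval_chartK1_two P e f t s Z, aeval_chartK1_three P e f t s Z]

theorem aeval_fieldS (P : Params) (e f : Bool) (t s : K) (Z : Fin 4 → K) (i : Fin 4) :
    aeval (pt Z t s) (fieldS (chartK2 P e f) i) = chartS P e f t s Z i := by
  fin_cases i
  exacts [aeval_chartK2_zero P e f t s Z, aeval_chartK2_one P e f t s Z,
    aeval_chartK2_two P e f t s Z, aeval_chartK2_three P e f t s Z]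

end Explicit

end Garnier

namespace Garnier

open MvPolynomial

/-! ### Passage between the Hamiltonian system and its charts -/

section Transform

set_option linter.unusedSimpArgs false

theorem pderiv_X_eq_ite {K : Type*} [CommRing K] (i j : Fin 4) :
    pderiv i (X j : MvPolynomial (Fin 4) K) = if j = i then 1 else 0 := by
  rw [pderiv_X, Pi.single_apply]

theorem pderiv_numeral_two {K : Type*} [CommRing K] (i : Fin 4) : pderiv i (2 : MvPolynomial (Fin 4) K) = 0 := by
  rw [← map_ofNat C 2, pderiv_C]

variable {K : Type*} [CommRing K] [Algebra ℂ K]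

/-- Since `s₁ · s₁⁻² = t₁`, the right hand sides `s₁ ∂H₁` equal `t₁ ∂(s₁² H₁)`; the remaining powers
of `s₁` cancel by `h`. -/
theorem mul_eval_scaledH1 (P : Params) {t ti : K} (h : t * ti = 1) (s : K) (z : Fin 4 → K) :
    t * eval z (pderiv 2 (scaledH1 P ti s)) = -chartT P false false t s z 0 ∧
    t * eval z (pderiv 3 (scaledH1 P ti s)) = -chartT P false false t s z 1 ∧
    t * eval z (pderiv 0 (scaledH1 P ti s)) = chartT P false false t s z 2 ∧
    t * eval z (pderiv 1 (scaledH1 P ti s)) = chartT P false false t s z 3 := by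
  refine ⟨?_, ?_, ?_, ?_⟩
  all_goals
    simp only [scaledH1, cst, pderiv_X_eq_ite, pderiv_mul, pderiv_pow, pderiv_C, pderiv_one,
      pderiv_numeral_two, map_add, map_sub, Fin.reduceEq, if_true, if_false, mul_zero, zero_mul,
      mul_one, one_mul, add_zero, zero_add, sub_zero]
    simp only [map_add, map_sub, map_mul, map_pow, map_neg, map_zero, map_one, eval_X, eval_C,
      map_ofNat, map_natCast]
    simp only [chartT, Matrix.cons_val, pick, Bool.not_false, if_true, Bool.false_eq_true, if_false]
    push_cast
  · linear_combination (-2 * z 0 ^ 2 * z 2 + algebraMap ℂ K P.a1 * z 0 + algebraMap ℂ K P.eta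
      - algebraMap ℂ K P.eta * z 1) * h
  · ring
  · linear_combination (-2 * z 0 * z 2 ^ 2 + algebraMap ℂ K P.a1 * z 2) * h
  · linear_combination (-algebraMap ℂ K P.eta * z 2) * h

theorem eval_scaledH2 (P : Params) {t ti : K} (h : Ring.inverse ti = t) (s : K) (z : Fin 4 → K) :
    eval z (pderiv 2 (scaledH2 P ti s)) = chartS P false false t s z 0 ∧
    eval z (pderiv 3 (scaledH2 P ti s)) = chartS P false false t s z 1 ∧
    eval z (pderiv 0 (scaledH2 P ti s)) = -chartS P false false t s z 2 ∧
    eval z (pderiv 1 (scaledH2 P ti s)) = -chartS P false false t s z 3 := by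
  refine ⟨?_, ?_, ?_, ?_⟩
  all_goals
    simp only [scaledH2, cst, pderiv_X_eq_ite, pderiv_mul, pderiv_pow, pderiv_C, pderiv_one,
      pderiv_numeral_two, map_add, map_sub, Fin.reduceEq, if_true, if_false, mul_zero, zero_mul,
      mul_one, one_mul, add_zero, zero_add, sub_zero]
    simp only [map_add, map_sub, map_mul, map_pow, map_neg, map_zero, map_one, eval_X, eval_C,
      map_ofNat, map_natCast, h]
    simp only [chartS, Matrix.cons_val, pick, Bool.not_false, if_true, Bool.false_eq_true, if_false]
    push_cast
    ring

theorem forall_fin_four {p : Fin 4 → Prop} : (∀ i, p i) ↔ p 0 ∧ p 1 ∧ p 2 ∧ p 3 :=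
  ⟨fun h => ⟨h 0, h 1, h 2, h 3⟩, fun ⟨h0, h1, h2, h3⟩ i => by
    fin_cases i
    exacts [h0, h1, h2, h3]⟩

theorem hamiltonEqs_iff (P : Params) {t s : K} (ht : IsUnit t) (hs : IsUnit (s * (s - 1)))
    (z dt ds : Fin 4 → K) :
    HamiltonEqs P t s z dt ds ↔ ∀ i, t * dt i = chartT P false false t s z i ∧
      (s - 1) * (s * ds i) = chartS P false false t s z i := by
  set ti := Ring.inverse t with hti
  have h1 : t * ti = 1 := Ring.mul_inverse_cancel t ht
  have h1' : ti * t = 1 := Ring.inverse_mul_cancel t ht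
  have hinv : ∀ x y : K, x * y = 1 → Ring.inverse x = y := fun x y hxy => by
    have := Ring.inverse_mul_cancel x (IsUnit.of_mul_eq_one y hxy)
    linear_combination (-Ring.inverse x) * hxy + y * this
  have h2 : Ring.inverse ti = t := hinv _ _ h1'
  have h3 : Ring.inverse (ti ^ 2) = t ^ 2 := hinv _ _ (by rw [← mul_pow, h1', one_pow])
  obtain ⟨a1, a2, a3, a4⟩ := mul_eval_scaledH1 P h1 s z
  obtain ⟨b1, b2, b3, b4⟩ := eval_scaledH2 P h2 s z
  have hA : ∀ k, ti * eval z (pderiv k (H1 P ti s)) = t * eval z (pderiv k (scaledH1 P ti s)) := by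
    intro k
    rw [H1, h3, pderiv_C_mul, map_mul, eval_C]
    linear_combination (t * eval z (pderiv k (scaledH1 P ti s))) * h1
  set d := Ring.inverse (s * (s - 1)) with hd
  have hd1 : s * (s - 1) * d = 1 := Ring.mul_inverse_cancel _ hs
  have hB : ∀ k, eval z (pderiv k (H2 P ti s)) = d * eval z (pderiv k (scaledH2 P ti s)) := by
    intro k
    rw [H2, pderiv_C_mul, map_mul, eval_C]
  have key : ∀ x y : K, x = d * y ↔ (s - 1) * (s * x) = y := by
    intro x y
    constructor
    · rintro rfl; linear_combination y * hd1
    · rintro rfl; linear_combination (-x) * hd1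
  constructor
  · rintro ⟨e1, e2, e3, e4, f1, f2, f3, f4⟩
    rw [← hti, hA] at e1 e2 e3 e4
    rw [← hti, hB] at f1 f2 f3 f4
    rw [b1, key] at f1
    rw [b2, key] at f2
    rw [b3, key] at f3
    rw [b4, key] at f4
    rw [forall_fin_four]
    refine ⟨?_, ?_, ?_, ?_⟩
    · exact ⟨by linear_combination -e1 - a1, f1⟩
    · exact ⟨by linear_combination -e2 - a2, f2⟩
    · exact ⟨by linear_combination e3 + a3, by linear_combination -f3⟩
    · exact ⟨by linear_combination e4 + a4, by linear_combination -f4⟩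
  · intro H
    refine ⟨?_, ?_, ?_, ?_, ?_, ?_, ?_, ?_⟩ <;> rw [← hti]
    · rw [hA, a1, ← (H 0).1]; ring
    · rw [hA, a2, ← (H 1).1]; ring
    · rw [hA, a3, ← (H 2).1]
    · rw [hA, a4, ← (H 3).1]
    · rw [hB, b1, key, (H 0).2]
    · rw [hB, b2, key, (H 1).2]
    · rw [hB, b3, key, ← (H 2).2]; ring
    · rw [hB, b4, key, ← (H 3).2]; ring

/-- The relation between the unknowns `z` and the unknowns `Z` in the chart `(e, f)`, together
with their images `td, sd` and `Zt, Zs` under `t₁ ∂/∂t₁` and `s₂ ∂/∂s₂`. -/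
structure ChartRel (e f : Bool) (t s : K) (z td sd Z Zt Zs : Fin 4 → K) : Prop where
  q1 : pick e t * z 0 = Z 0
  q2 : z 1 = pick f s * Z 1
  p1 : z 2 = pick e t * Z 2
  p2 : pick f s * z 3 = Z 3
  q1_t : pick e t * td 0 = Zt 0 - if e then Z 0 else 0
  q2_t : td 1 = pick f s * Zt 1
  p1_t : td 2 = pick e t * (Zt 2 + if e then Z 2 else 0)
  p2_t : pick f s * td 3 = Zt 3
  q1_s : pick e t * sd 0 = Zs 0
  q2_s : sd 1 = pick f s * (Zs 1 + if f then Z 1 else 0)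
  p1_s : sd 2 = pick e t * Zs 2
  p2_s : pick f s * sd 3 = Zs 3 - if f then Z 3 else 0

theorem chartT_change (P : Params) {e f : Bool} {t s : K} {z Z : Fin 4 → K}
    (h0 : pick e t * z 0 = Z 0) (h1 : z 1 = pick f s * Z 1) (h2 : z 2 = pick e t * Z 2)
    (h3 : pick f s * z 3 = Z 3) :
    pick e t * chartT P false false t s z 0 = chartT P e f t s Z 0 - (if e then Z 0 else 0) ∧
    chartT P false false t s z 1 = pick f s * chartT P e f t s Z 1 ∧
    chartT P false false t s z 2 = pick e t * (chartT P e f t s Z 2 + if e then Z 2 else 0) ∧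
    pick f s * chartT P false false t s z 3 = chartT P e f t s Z 3 := by
  simp only [chartT, Matrix.cons_val, ← h0, h1, h2, ← h3]
  cases e <;> cases f <;>
    simp only [pick, Bool.not_false, Bool.not_true, if_true, Bool.false_eq_true, if_false] <;>
    refine ⟨?_, ?_, ?_, ?_⟩ <;> ring

theorem chartS_change (P : Params) {e f : Bool} {t s : K} {z Z : Fin 4 → K}
    (h0 : pick e t * z 0 = Z 0) (h1 : z 1 = pick f s * Z 1) (h2 : z 2 = pick e t * Z 2)
    (h3 : pick f s * z 3 = Z 3) :
    pick e t * chartS P false false t s z 0 = chartS P e f t s Z 0 ∧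
    chartS P false false t s z 1
      = pick f s * (chartS P e f t s Z 1 + (s - 1) * if f then Z 1 else 0) ∧
    chartS P false false t s z 2 = pick e t * chartS P e f t s Z 2 ∧
    pick f s * chartS P false false t s z 3
      = chartS P e f t s Z 3 - (s - 1) * (if f then Z 3 else 0) := by
  simp only [chartS, Matrix.cons_val, ← h0, h1, h2, ← h3]
  cases e <;> cases f <;>
    simp only [pick, Bool.not_false, Bool.not_true, if_true, Bool.false_eq_true, if_false] <;>
    refine ⟨?_, ?_, ?_, ?_⟩ <;> ring

/-- The substitution only multiplies each logarithmic equation by a unit and adds to both sides the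
same term, coming from differentiating the monomial. -/
theorem ChartRel.hamiltonEqs_iff (P : Params) {e f : Bool} {t s : K} (ht : IsUnit t)
    (hs : IsUnit (s * (s - 1))) {z dt ds Z Zt Zs : Fin 4 → K}
    (h : ChartRel e f t s z (fun i => t * dt i) (fun i => s * ds i) Z Zt Zs) :
    HamiltonEqs P t s z dt ds ↔
      ∀ i, Zt i = chartT P e f t s Z i ∧ (s - 1) * Zs i = chartS P e f t s Z i := by
  have hs' : IsUnit s := isUnit_of_mul_isUnit_left hs
  have hU : IsUnit (pick e t) := by cases e <;> simp [pick, ht]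
  have hV : IsUnit (pick f s) := by cases f <;> simp [pick, hs']
  rw [Garnier.hamiltonEqs_iff P ht hs, forall_fin_four, forall_fin_four]
  obtain ⟨a0, a1, a2, a3⟩ := chartT_change P h.q1 h.q2 h.p1 h.p2
  obtain ⟨b0, b1, b2, b3⟩ := chartS_change P h.q1 h.q2 h.p1 h.p2
  have g1 := h.q1_t
  have g2 := h.q2_t
  have g3 := h.p1_t
  have g4 := h.p2_t
  have g5 := h.q1_s
  have g6 := h.q2_s
  have g7 := h.p1_s
  have g8 := h.p2_s
  refine and_congr (and_congr ?_ ?_) (and_congr (and_congr ?_ ?_)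
    (and_congr (and_congr ?_ ?_) (and_congr ?_ ?_)))
  · rw [← hU.mul_right_inj, g1, a0, sub_left_inj]
  · rw [← hU.mul_right_inj, mul_left_comm, g5, b0]
  · rw [g2, a1, hV.mul_right_inj]
  · rw [g6, b1, mul_left_comm, hV.mul_right_inj, mul_add, add_left_inj]
  · rw [g3, a2, hU.mul_right_inj, add_left_inj]
  · rw [g7, b2, mul_left_comm, hU.mul_right_inj]
  · rw [← hV.mul_right_inj, g4, a3]
  · rw [← hV.mul_right_inj, mul_left_comm, g8, b3, mul_sub, sub_left_inj]

end Transform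

end Garnier

namespace Garnier

open MvPolynomial

/-! ## Power series in a chart and Laurent series -/

/-- `1` if the condition holds, `0` otherwise. -/
def bit (e : Bool) : ℤ := if e then 1 else 0

/-- The exponents of the monomials relating the unknowns to those of the chart `(e, f)`. -/
def ex (e f : Bool) : Fin 4 → ℤ × ℤ := ![(-bit e, 0), (0, bit f), (bit e, 0), (0, -bit f)]

/-- The hypotheses on `td`, `sd` are the product rule for a monomial times `Z`. In this form the
statement serves both Laurent series and values of functions at a point. -/
theorem chartRel_of_units {K : Type*} [CommRing K] [Algebra ℂ K] {e f : Bool} {t s : K}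
    {m z td sd Z Zt Zs : Fin 4 → K} (h0 : pick e t * m 0 = 1) (h1 : m 1 = pick f s)
    (h2 : m 2 = pick e t) (h3 : pick f s * m 3 = 1) (hz : ∀ i, z i = m i * Z i)
    (htd : ∀ i, td i = m i * (Zt i + (ex e f i).1 * Z i))
    (hsd : ∀ i, sd i = m i * (Zs i + (ex e f i).2 * Z i)) : ChartRel e f t s z td sd Z Zt Zs where
  q1 := by rw [hz]; linear_combination Z 0 * h0
  q2 := by rw [hz, h1]
  p1 := by rw [hz, h2]
  p2 := by rw [hz]; linear_combination Z 3 * h3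
  q1_t := by
    rw [htd, ← mul_assoc, h0]; cases e <;> simp [ex, bit, sub_eq_add_neg]
  q2_t := by rw [htd, h1]; simp [ex]
  p1_t := by rw [htd, h2]; cases e <;> simp [ex, bit]
  p2_t := by rw [htd, ← mul_assoc, h3]; simp [ex]
  q1_s := by rw [hsd, ← mul_assoc, h0]; simp [ex]
  q2_s := by rw [hsd, h1]; cases f <;> simp [ex, bit]
  p1_s := by rw [hsd, h2]; simp [ex]
  p2_s := by
    rw [hsd, ← mul_assoc, h3]; cases f <;> simp [ex, bit, sub_eq_add_neg]

theorem toL_coeff_expo (F : Pow) (n : Fin 2 →₀ ℕ) :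
    (toL F).coeff (expo n) = MvPowerSeries.coeff n F := toL_coeff F n

theorem toL_coeff_of_notMem (F : Pow) {x : ℤ × ℤ} (h : x ∉ Set.range expo) :
    (toL F).coeff x = 0 :=
  HahnSeries.embDomain_of_notMem_range h

theorem expo_injective : Function.Injective expo := fun m n h =>
  le_antisymm ((expo_le m n).1 h.le) ((expo_le n m).1 h.ge)

theorem toL_injective : Function.Injective toL := fun F G h => by
  ext n
  rw [← toL_coeff_expo, ← toL_coeff_expo, h]

theorem toL_monomial (n : Fin 2 →₀ ℕ) (c : ℂ) :
    toL (MvPowerSeries.monomial n c) = mono (n 0) (n 1) c := by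
  classical
  ext x
  by_cases h : x ∈ Set.range expo
  · obtain ⟨k, rfl⟩ := h
    rw [toL_coeff_expo, MvPowerSeries.coeff_monomial, mono, HahnSeries.coeff_single]
    congr 1
    exact propext (expo_injective.eq_iff (a := k) (b := n)).symm
  · rw [toL_coeff_of_notMem _ h, mono, HahnSeries.coeff_single, if_neg]
    rintro rfl
    exact h ⟨n, rfl⟩

theorem toL_C (c : ℂ) : toL (MvPowerSeries.C c) = algebraMap ℂ Laurent c := by
  have h := toL_monomial 0 c
  rw [MvPowerSeries.monomial_zero_eq_C_apply] at h
  rw [h]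
  rfl

theorem toL_tP : toL tP = mono 1 0 1 := by
  have h := toL_monomial (Finsupp.single 0 1) 1
  simpa [tP, MvPowerSeries.X] using h

/-- The inclusion of power series into Laurent series as a homomorphism of algebras. -/
noncomputable def toLAlg : Pow →ₐ[ℂ] Laurent :=
  { toL with commutes' := fun c => toL_C c }

theorem mono_mul_mono (a b a' b' : ℤ) :
    mono a b 1 * mono a' b' 1 = mono (a + a') (b + b') 1 := by
  simp [mono, HahnSeries.single_mul_single]

theorem mono_zero : mono 0 0 1 = 1 := rfl

theorem coeff_mono_mul (a b : ℤ) (x : Laurent) (n : ℤ × ℤ) :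
    (mono a b 1 * x).coeff (n + (a, b)) = x.coeff n := by
  rw [mono, HahnSeries.coeff_single_mul_add, one_mul]

theorem laurent_ext_shift (a b : ℤ) {x y : Laurent}
    (h : ∀ n, x.coeff (n + (a, b)) = y.coeff (n + (a, b))) : x = y := by
  ext n
  have := h (n - (a, b))
  rwa [sub_add_cancel] at this

theorem eulerT_mono_mul (a b : ℤ) (x : Laurent) :
    eulerT (mono a b 1 * x) = mono a b 1 * (eulerT x + a * x) := by
  refine laurent_ext_shift a b fun n => ?_
  rw [coeff_mono_mul, HahnSeries.coeff_add, eulerT, eulerT]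
  simp only [coeff_mono_mul]
  have : ((a : Laurent) * x).coeff n = a * x.coeff n := by
    rw [← zsmul_eq_mul, HahnSeries.coeff_smul]; simp
  rw [this]
  push_cast [Prod.fst_add]
  ring

theorem eulerS_mono_mul (a b : ℤ) (x : Laurent) :
    eulerS (mono a b 1 * x) = mono a b 1 * (eulerS x + b * x) := by
  refine laurent_ext_shift a b fun n => ?_
  rw [coeff_mono_mul, HahnSeries.coeff_add, eulerS, eulerS]
  simp only [coeff_mono_mul]
  have : ((b : Laurent) * x).coeff n = b * x.coeff n := by
    rw [← zsmul_eq_mul, HahnSeries.coeff_smul]; simp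
  rw [this]
  push_cast [Prod.snd_add]
  ring

theorem eulerT_toL (F : Pow) : eulerT (toL F) = toL (euler 0 F) := by
  ext x
  by_cases h : x ∈ Set.range expo
  · obtain ⟨n, rfl⟩ := h
    rw [toL_coeff_expo, coeff_euler, eulerT]
    simp only [toL_coeff_expo]
    simp [expo]
  · rw [toL_coeff_of_notMem _ h, eulerT]
    simp only [toL_coeff_of_notMem _ h, mul_zero]

theorem eulerS_toL (F : Pow) : eulerS (toL F) = toL (euler 1 F) := by
  ext x
  by_cases h : x ∈ Set.range expo
  · obtain ⟨n, rfl⟩ := h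
    rw [toL_coeff_expo, coeff_euler, eulerS]
    simp only [toL_coeff_expo]
    simp [expo]
  · rw [toL_coeff_of_notMem _ h, eulerS]
    simp only [toL_coeff_of_notMem _ h, mul_zero]

theorem mono_mul_dT (x : Laurent) : mono 1 0 1 * dT x = eulerT x := by
  rw [dT, ← mul_assoc, mono_mul_mono]
  simp [mono_zero]

theorem mono_mul_dS (x : Laurent) : mono 0 1 1 * dS x = eulerS x := by
  rw [dS, ← mul_assoc, mono_mul_mono]
  simp [mono_zero]

/-- The Laurent series with given power series as unknowns in the chart `(e, f)`. -/
noncomputable def lift (e f : Bool) (Z : Fin 4 → Pow) (i : Fin 4) : Laurent :=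
  mono (ex e f i).1 (ex e f i).2 1 * toL (Z i)

/-- The chart field is the evaluation of polynomials over `ℂ`, hence natural in the algebra. -/
theorem chartT_map {K L : Type*} [CommRing K] [Algebra ℂ K] [CommRing L] [Algebra ℂ L]
    (φ : K →ₐ[ℂ] L) (P : Params) (e f : Bool) (t s : K) (Z : Fin 4 → K) (i : Fin 4) :
    chartT P e f (φ t) (φ s) (fun i => φ (Z i)) i = φ (chartT P e f t s Z i) := by
  have h : pt (fun i => φ (Z i)) (φ t) (φ s) = fun j => φ (pt Z t s j) := by
    funext j
    rcases j with j | j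
    · rfl
    · fin_cases j <;> rfl
  rw [← aeval_fieldT, ← aeval_fieldT, h, MvPolynomial.comp_aeval_apply]

theorem chartS_map {K L : Type*} [CommRing K] [Algebra ℂ K] [CommRing L] [Algebra ℂ L]
    (φ : K →ₐ[ℂ] L) (P : Params) (e f : Bool) (t s : K) (Z : Fin 4 → K) (i : Fin 4) :
    chartS P e f (φ t) (φ s) (fun i => φ (Z i)) i = φ (chartS P e f t s Z i) := by
  have h : pt (fun i => φ (Z i)) (φ t) (φ s) = fun j => φ (pt Z t s j) := by
    funext j
    rcases j with j | j
    · rfl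
    · fin_cases j <;> rfl
  rw [← aeval_fieldS, ← aeval_fieldS, h, MvPolynomial.comp_aeval_apply]

/-- The equations in the chart `(e, f)` for power series. -/
def ChartSol (P : Params) (e f : Bool) (Z : Fin 4 → Pow) : Prop :=
  ∀ i, euler 0 (Z i) = chartT P e f tP sP Z i ∧ (sP - 1) * euler 1 (Z i) = chartS P e f tP sP Z i

theorem isFormalSolution_lift_iff (P : Params) (e f : Bool) (Z : Fin 4 → Pow) :
    IsFormalSolution P (lift e f Z) ↔ ChartSol P e f Z := by
  have hrel : ChartRel e f (mono 1 0 1) (mono 0 1 1) (lift e f Z)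
      (fun i => mono 1 0 1 * dT (lift e f Z i)) (fun i => mono 0 1 1 * dS (lift e f Z i))
      (fun i => toL (Z i)) (fun i => toL (euler 0 (Z i))) (fun i => toL (euler 1 (Z i))) := by
    refine chartRel_of_units (m := fun i => mono (ex e f i).1 (ex e f i).2 1) ?_ ?_ ?_ ?_
      (fun i => rfl) (fun i => ?_) (fun i => ?_)
    · cases e <;> simp [ex, bit, pick, mono_mul_mono, mono_zero]
    · cases f <;> simp [ex, bit, pick, mono_zero]
    · cases e <;> simp [ex, bit, pick, mono_zero]
    · cases f <;> simp [ex, bit, pick, mono_mul_mono, mono_zero]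
    · simp only [mono_mul_dT, lift, eulerT_mono_mul, eulerT_toL]
    · simp only [mono_mul_dS, lift, eulerS_mono_mul, eulerS_toL]
  rw [IsFormalSolution, hrel.hamiltonEqs_iff P (isUnit_mono 1 0) isUnit_s_mul, ChartSol]
  refine forall_congr' fun i => ?_
  have h1 := chartT_map toLAlg P e f tP sP Z i
  have h2 := chartS_map toLAlg P e f tP sP Z i
  have ht : toLAlg tP = mono 1 0 1 := toL_tP
  have hs : toLAlg sP = mono 0 1 1 := toL_sP
  rw [ht, hs] at h1 h2
  have h3 : chartT P e f (mono 1 0 1) (mono 0 1 1) (fun i => toL (Z i)) i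
      = toL (chartT P e f tP sP Z i) := h1
  have h4 : chartS P e f (mono 1 0 1) (mono 0 1 1) (fun i => toL (Z i)) i
      = toL (chartS P e f tP sP Z i) := h2
  rw [h3, h4, ← toL_sP, ← map_one toL, ← map_sub, ← map_mul, toL_injective.eq_iff,
    toL_injective.eq_iff]

theorem pairSol_iff (P : Params) (e f : Bool) (z0 : Fin 4 → ℂ) (Z : Fin 4 → Pow) :
    PairSol (fieldT (chartK1 P e f)) (fieldS (chartK2 P e f)) z0 Z ↔
      (∀ i, MvPowerSeries.constantCoeff (Z i) = z0 i) ∧ ChartSol P e f Z := by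
  simp only [PairSol, ChartSol, ev, aeval_fieldT, aeval_fieldS]

end Garnier

namespace Garnier

open MvPolynomial

/-! ## Sums of convergent power series -/

/-- Absolute convergence on the closed polydisc of radius `r`. -/
def SummableAt (r : ℝ) (F : Pow) : Prop :=
  Summable fun n : Fin 2 →₀ ℕ => ‖MvPowerSeries.coeff n F‖ * r ^ (n 0 + n 1)

/-- The terms of a power series at a point. -/
noncomputable def term (F : Pow) (y : ℂ × ℂ) (n : Fin 2 →₀ ℕ) : ℂ :=
  MvPowerSeries.coeff n F * y.1 ^ n 0 * y.2 ^ n 1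

/-- The sum of a power series at a point. -/
noncomputable def val (F : Pow) (y : ℂ × ℂ) : ℂ := ∑' n, term F y n

theorem SummableAt.of_finite {r : ℝ} {F : Pow}
    (h : {n | MvPowerSeries.coeff n F ≠ 0}.Finite) : SummableAt r F := by
  refine summable_of_hasFiniteSupport (h.subset ?_)
  intro n hn h0
  exact hn (by simp [h0])

theorem SummableAt.add {r : ℝ} (hr : 0 ≤ r) {F G : Pow} (hF : SummableAt r F)
    (hG : SummableAt r G) : SummableAt r (F + G) := by
  refine (Summable.add hF hG).of_nonneg_of_le (fun _ => by positivity) (fun n => ?_)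
  rw [map_add, ← add_mul]
  gcongr
  exact norm_add_le _ _

variable {r : ℝ} {y : ℂ × ℂ}

theorem norm_term_le (h1 : ‖y.1‖ ≤ r) (h2 : ‖y.2‖ ≤ r) (F : Pow) (n : Fin 2 →₀ ℕ) :
    ‖term F y n‖ ≤ ‖MvPowerSeries.coeff n F‖ * r ^ (n 0 + n 1) := by
  have hr : 0 ≤ r := (norm_nonneg _).trans h1
  rw [term, norm_mul, norm_mul, norm_pow, norm_pow, pow_add, ← mul_assoc]
  gcongr

theorem SummableAt.summable_norm {F : Pow} (hF : SummableAt r F) (h1 : ‖y.1‖ ≤ r)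
    (h2 : ‖y.2‖ ≤ r) : Summable fun n => ‖term F y n‖ :=
  Summable.of_nonneg_of_le (fun _ => norm_nonneg _) (norm_term_le h1 h2 F) hF

theorem SummableAt.hasSum {F : Pow} (hF : SummableAt r F) (h1 : ‖y.1‖ ≤ r) (h2 : ‖y.2‖ ≤ r) :
    HasSum (term F y) (val F y) :=
  (hF.summable_norm h1 h2).of_norm.hasSum

/-- The power series converges absolutely on the polydisc of radius `r`, with sum `v` at `y`. -/
def SumsTo (r : ℝ) (y : ℂ × ℂ) (F : Pow) (v : ℂ) : Prop := SummableAt r F ∧ val F y = v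

theorem SumsTo.add {F G : Pow} {v w : ℂ} (hF : SumsTo r y F v) (hG : SumsTo r y G w)
    (h1 : ‖y.1‖ ≤ r) (h2 : ‖y.2‖ ≤ r) : SumsTo r y (F + G) (v + w) := by
  refine ⟨hF.1.add ((norm_nonneg _).trans h1) hG.1, ?_⟩
  have h := (hF.1.hasSum h1 h2).add (hG.1.hasSum h1 h2)
  rw [hF.2, hG.2] at h
  refine HasSum.tsum_eq ?_
  convert h using 2 with n
  simp only [term, map_add]
  ring

theorem SumsTo.mul {F G : Pow} {v w : ℂ} (hF : SumsTo r y F v) (hG : SumsTo r y G w)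
    (h1 : ‖y.1‖ ≤ r) (h2 : ‖y.2‖ ≤ r) : SumsTo r y (F * G) (v * w) := by
  refine ⟨IsConvergent.mul_aux ((norm_nonneg _).trans h1) hF.1 hG.1, ?_⟩
  have hF' := hF.1.summable_norm h1 h2
  have hG' := hG.1.summable_norm h1 h2
  have h := hF'.of_norm.tsum_mul_tsum_eq_tsum_sum_antidiagonal hG'.of_norm
    (summable_mul_of_summable_norm hF' hG')
  rw [← hF.2, ← hG.2, val, val, val, h]
  refine tsum_congr fun n => ?_
  rw [term, MvPowerSeries.coeff_mul, Finset.sum_mul, Finset.sum_mul]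
  refine Finset.sum_congr rfl fun p hp => ?_
  rw [Finset.HasAntidiagonal.mem_antidiagonal] at hp
  rw [← hp, term, term, Finsupp.add_apply, Finsupp.add_apply, pow_add, pow_add]
  ring

theorem SumsTo.monomial (m : Fin 2 →₀ ℕ) (c : ℂ) :
    SumsTo r y (MvPowerSeries.monomial m c) (c * y.1 ^ m 0 * y.2 ^ m 1) := by
  classical
  constructor
  · refine SummableAt.of_finite ((Set.finite_singleton m).subset fun n hn => ?_)
    by_contra h
    exact hn (by rw [MvPowerSeries.coeff_monomial, if_neg fun h0 => h (Set.mem_singleton_iff.2 h0)])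
  · rw [val, tsum_eq_single m]
    · rw [term, MvPowerSeries.coeff_monomial_same]
    · intro n hn
      rw [term, MvPowerSeries.coeff_monomial, if_neg hn]
      simp

theorem SumsTo.aeval {σ : Type*} {Y : σ → Pow} {v : σ → ℂ} (hY : ∀ j, SumsTo r y (Y j) (v j))
    (h1 : ‖y.1‖ ≤ r) (h2 : ‖y.2‖ ≤ r) (p : MvPolynomial σ ℂ) :
    SumsTo r y (MvPolynomial.aeval Y p) (MvPolynomial.aeval v p) := by
  induction p using MvPolynomial.induction_on with
  | C c =>
    have h := SumsTo.monomial (r := r) (y := y) 0 c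
    rw [MvPowerSeries.monomial_zero_eq_C_apply] at h
    have e : MvPolynomial.aeval Y (C c) = (MvPowerSeries.C c : Pow) := by
      rw [algHom_C]; rfl
    rw [e]
    simpa using h
  | add p q hp hq => rw [map_add, map_add]; exact hp.add hq h1 h2
  | mul_X p k hp => rw [map_mul, map_mul, aeval_X, aeval_X]; exact hp.mul (hY k) h1 h2

theorem SumsTo.pt {Z : Fin 4 → Pow} {v : Fin 4 → ℂ} (hZ : ∀ i, SumsTo r y (Z i) (v i))
    (j : Fin 4 ⊕ Fin 2) : SumsTo r y (pt Z tP sP j) (pt v y.1 y.2 j) := by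
  have hm : ∀ k, SumsTo r y (MvPowerSeries.X k : Pow) _ := fun k =>
    SumsTo.monomial (Finsupp.single k 1) 1
  rcases j with j | j
  · exact hZ j
  · fin_cases j
    · simpa [tP] using hm 0
    · simpa [sP] using hm 1

/-! ### Differentiation -/

/-- Since `n ≤ 2 ^ n`, halving the radius pays for one differentiation. -/
theorem natCast_mul_half_pow_le (hr : 0 < r) (n : ℕ) : n * (r / 2) ^ n ≤ r ^ n := by
  rw [div_pow, mul_div_assoc', div_le_iff₀ (by positivity), mul_comm]
  gcongr
  exact_mod_cast (Nat.lt_two_pow_self).le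

theorem SummableAt.euler (hr : 0 < r) {F : Pow} (hF : SummableAt r F) (k : Fin 2) :
    SummableAt (r / 2) (euler k F) := by
  refine Summable.of_nonneg_of_le (fun _ => by positivity) (fun n => ?_) hF
  rw [coeff_euler, norm_mul, Complex.norm_natCast, mul_comm (n k : ℝ), mul_assoc]
  gcongr
  refine le_trans ?_ (natCast_mul_half_pow_le hr (n 0 + n 1))
  gcongr
  fin_cases k <;> simp

theorem SummableAt.half (hr : 0 < r) {F : Pow} (hF : SummableAt r F) : SummableAt (r / 2) F :=
  IsConvergent.shrink (by positivity) (by linarith) hF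

theorem isOpen_polydisc (r : ℝ) : IsOpen (polydisc r) := by
  have : polydisc r = Metric.ball 0 r ×ˢ Metric.ball 0 r := by
    ext x; simp [polydisc]
  rw [this]
  exact Metric.isOpen_ball.prod Metric.isOpen_ball

theorem isPreconnected_polydisc (r : ℝ) : IsPreconnected (polydisc r) := by
  have : polydisc r = Metric.ball 0 r ×ˢ Metric.ball 0 r := by
    ext x; simp [polydisc]
  rw [this]
  exact ((convex_ball _ _).prod (convex_ball _ _)).isPreconnected

/-- The derivative of the terms of a power series. -/
noncomputable def dterm (F : Pow) (n : Fin 2 →₀ ℕ) (y : ℂ × ℂ) : ℂ × ℂ →L[ℂ] ℂ :=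
  (MvPowerSeries.coeff n F * (n 0 * y.1 ^ (n 0 - 1)) * y.2 ^ n 1) • ContinuousLinearMap.fst ℂ ℂ ℂ
    + (MvPowerSeries.coeff n F * y.1 ^ n 0 * (n 1 * y.2 ^ (n 1 - 1)))
      • ContinuousLinearMap.snd ℂ ℂ ℂ

theorem hasFDerivAt_term (F : Pow) (n : Fin 2 →₀ ℕ) (y : ℂ × ℂ) :
    HasFDerivAt (fun y => term F y n) (dterm F n y) y := by
  have ha : HasFDerivAt (fun y : ℂ × ℂ => y.1 ^ n 0)
      ((n 0 * y.1 ^ (n 0 - 1)) • ContinuousLinearMap.fst ℂ ℂ ℂ) y :=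
    (hasDerivAt_pow (n 0) y.1).comp_hasFDerivAt y hasFDerivAt_fst
  have hb : HasFDerivAt (fun y : ℂ × ℂ => y.2 ^ n 1)
      ((n 1 * y.2 ^ (n 1 - 1)) • ContinuousLinearMap.snd ℂ ℂ ℂ) y :=
    (hasDerivAt_pow (n 1) y.2).comp_hasFDerivAt y hasFDerivAt_snd
  have h := (ha.mul hb).const_mul (MvPowerSeries.coeff n F)
  have e : (fun y => term F y n)
      = fun y : ℂ × ℂ => MvPowerSeries.coeff n F * (y.1 ^ n 0 * y.2 ^ n 1) := by
    funext y; rw [term, mul_assoc]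
  rw [e]
  refine h.congr_fderiv ?_
  ext <;> simp [dterm] <;> ring

/-- Each of the two partial derivatives contributes `2 / r`, by `k (r/2)^(k-1) (r/2)^l ≤ (2/r)
r^(k+l)`. The bound is uniform in `y`, as termwise differentiation requires. -/
theorem norm_dterm_le (hr : 0 < r) (F : Pow) (n : Fin 2 →₀ ℕ) (hy : y ∈ polydisc (r / 2)) :
    ‖dterm F n y‖ ≤ 4 / r * (‖MvPowerSeries.coeff n F‖ * r ^ (n 0 + n 1)) := by
  have hρ : 0 < r / 2 := by positivity
  have hb : ∀ k l : ℕ, k * (r / 2) ^ (k - 1) * (r / 2) ^ l ≤ 2 / r * r ^ (k + l) := by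
    intro k l
    rcases Nat.eq_zero_or_pos k with rfl | hk
    · simp; positivity
    · obtain ⟨m, rfl⟩ := Nat.exists_eq_add_of_lt hk
      have h := natCast_mul_half_pow_le hr (0 + m + 1 + l)
      have h' : ((0 + m + 1 : ℕ) : ℝ) * (r / 2) ^ (0 + m + 1 + l) ≤ r ^ (0 + m + 1 + l) := by
        refine le_trans (mul_le_mul_of_nonneg_right ?_ (by positivity)) h
        exact_mod_cast (by omega : 0 + m + 1 ≤ 0 + m + 1 + l)
      calc ((0 + m + 1 : ℕ) : ℝ) * (r / 2) ^ (0 + m + 1 - 1) * (r / 2) ^ l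
          = 2 / r * (((0 + m + 1 : ℕ) : ℝ) * (r / 2) ^ (0 + m + 1 + l)) := by
            have : (0 + m + 1 - 1 : ℕ) = m := by omega
            rw [this, zero_add, pow_add, pow_succ]
            field_simp
        _ ≤ _ := by gcongr
  have h1 := hy.1.le
  have h2 := hy.2.le
  have ha : ‖MvPowerSeries.coeff n F * (n 0 * y.1 ^ (n 0 - 1)) * y.2 ^ n 1‖
      ≤ ‖MvPowerSeries.coeff n F‖ * (2 / r * r ^ (n 0 + n 1)) := by
    rw [norm_mul, norm_mul, norm_mul, norm_pow, norm_pow, Complex.norm_natCast, mul_assoc]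
    refine mul_le_mul_of_nonneg_left (le_trans ?_ (hb _ _)) (norm_nonneg _)
    gcongr
  have hc : ‖MvPowerSeries.coeff n F * y.1 ^ n 0 * (n 1 * y.2 ^ (n 1 - 1))‖
      ≤ ‖MvPowerSeries.coeff n F‖ * (2 / r * r ^ (n 0 + n 1)) := by
    rw [norm_mul, norm_mul, norm_mul, norm_pow, norm_pow, Complex.norm_natCast, mul_assoc]
    refine mul_le_mul_of_nonneg_left
      (le_trans ?_ ((hb (n 1) (n 0)).trans (le_of_eq (by rw [add_comm])))) (norm_nonneg _)
    rw [mul_comm]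
    gcongr
  refine (norm_add_le _ _).trans ?_
  rw [norm_smul, norm_smul]
  have e1 : ‖ContinuousLinearMap.fst ℂ ℂ ℂ‖ ≤ 1 := ContinuousLinearMap.norm_fst_le ..
  have e2 : ‖ContinuousLinearMap.snd ℂ ℂ ℂ‖ ≤ 1 := ContinuousLinearMap.norm_snd_le ..
  have g1 := mul_le_mul ha e1 (norm_nonneg _) (by positivity)
  have g2 := mul_le_mul hc e2 (norm_nonneg _) (by positivity)
  refine (add_le_add g1 g2).trans (le_of_eq ?_)
  ring

theorem SummableAt.hasFDerivAt (hr : 0 < r) {F : Pow} (hF : SummableAt r F)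
    (hy : y ∈ polydisc (r / 2)) :
    HasFDerivAt (val F) (∑' n, dterm F n y) y ∧ Summable fun n => dterm F n y := by
  have hu : Summable fun n : Fin 2 →₀ ℕ =>
      4 / r * (‖MvPowerSeries.coeff n F‖ * r ^ (n 0 + n 1)) := Summable.mul_left _ hF
  refine ⟨hasFDerivAt_tsum_of_isPreconnected hu (isOpen_polydisc (r / 2))
    (isPreconnected_polydisc (r / 2)) (fun n x _ => hasFDerivAt_term F n x)
    (fun n x hx => norm_dterm_le hr F n hx) hy ?_ hy, ?_⟩
  · exact ((hF.half hr).summable_norm hy.1.le hy.2.le).of_norm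
  · exact Summable.of_norm_bounded hu fun n => norm_dterm_le hr F n hy

theorem SummableAt.differentiableOn (hr : 0 < r) {F : Pow} (hF : SummableAt r F) :
    DifferentiableOn ℂ (val F) (polydisc (r / 2)) := fun _ hy =>
  (hF.hasFDerivAt hr hy).1.differentiableAt.differentiableWithinAt

theorem SummableAt.hasDerivAt_fst (hr : 0 < r) {F : Pow} (hF : SummableAt r F)
    (hy : y ∈ polydisc (r / 2)) :
    ∃ d, HasDerivAt (fun t => val F (t, y.2)) d y.1 ∧ y.1 * d = val (Garnier.euler 0 F) y := by
  obtain ⟨h, hs⟩ := hF.hasFDerivAt hr hy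
  refine ⟨(∑' n, dterm F n y) (1, 0), ?_, ?_⟩
  · have h1 : HasDerivAt (fun t : ℂ => (t, y.2)) ((1 : ℂ), (0 : ℂ)) y.1 :=
      (hasDerivAt_id y.1).prodMk (hasDerivAt_const y.1 y.2)
    exact HasFDerivAt.comp_hasDerivAt y.1 (f := fun t : ℂ => (t, y.2)) h h1
  · have ht := (ContinuousLinearMap.apply ℂ ℂ ((1, 0) : ℂ × ℂ)).map_tsum hs
    simp only [ContinuousLinearMap.apply_apply] at ht
    rw [ht, ← tsum_mul_left, val]
    refine tsum_congr fun n => ?_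
    rw [term, coeff_euler]
    rcases Nat.eq_zero_or_pos (n 0) with h0 | h0
    · simp [dterm, h0]
    · obtain ⟨m, hm⟩ := Nat.exists_eq_add_of_lt h0
      simp only [zero_add] at hm
      simp [dterm, hm, pow_succ]
      ring

theorem SummableAt.hasDerivAt_snd (hr : 0 < r) {F : Pow} (hF : SummableAt r F)
    (hy : y ∈ polydisc (r / 2)) :
    ∃ d, HasDerivAt (fun s => val F (y.1, s)) d y.2 ∧ y.2 * d = val (Garnier.euler 1 F) y := by
  obtain ⟨h, hs⟩ := hF.hasFDerivAt hr hy
  refine ⟨(∑' n, dterm F n y) (0, 1), ?_, ?_⟩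
  · have h1 : HasDerivAt (fun s : ℂ => (y.1, s)) ((0 : ℂ), (1 : ℂ)) y.2 :=
      (hasDerivAt_const y.2 y.1).prodMk (hasDerivAt_id y.2)
    exact HasFDerivAt.comp_hasDerivAt y.2 (f := fun s : ℂ => (y.1, s)) h h1
  · have ht := (ContinuousLinearMap.apply ℂ ℂ ((0, 1) : ℂ × ℂ)).map_tsum hs
    simp only [ContinuousLinearMap.apply_apply] at ht
    rw [ht, ← tsum_mul_left, val]
    refine tsum_congr fun n => ?_
    rw [term, coeff_euler]
    rcases Nat.eq_zero_or_pos (n 1) with h0 | h0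
    · simp [dterm, h0]
    · obtain ⟨m, hm⟩ := Nat.exists_eq_add_of_lt h0
      simp only [zero_add] at hm
      simp [dterm, hm, pow_succ]
      ring

/-! ### The meromorphic solution -/

/-- The sums of the Laurent series `lift e f Z`. -/
noncomputable def liftVal (e f : Bool) (Z : Fin 4 → Pow) (i : Fin 4) (y : ℂ × ℂ) : ℂ :=
  y.1 ^ (ex e f i).1 * y.2 ^ (ex e f i).2 * val (Z i) y

theorem convergesTo_liftVal (hr : 0 < r) (e f : Bool) {Z : Fin 4 → Pow} (i : Fin 4)
    (hZ : SummableAt r (Z i)) : ConvergesTo (r / 2) (lift e f Z i) (liftVal e f Z i) := by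
  intro y hy
  have h0 := ((hZ.half hr).hasSum hy.1.1.le hy.1.2.le).mul_left
    (y.1 ^ (ex e f i).1 * y.2 ^ (ex e f i).2)
  -- The sum over `ℤ × ℤ` is supported on the shifted image of `ℕ²`, so it can be reindexed there.
  have hinj : Function.Injective fun n : Fin 2 →₀ ℕ =>
      expo n + ((ex e f i).1, (ex e f i).2) := fun m n h =>
    expo_injective (add_right_cancel h)
  refine (hinj.hasSum_iff ?_).1 ?_
  · intro x hx
    have : (lift e f Z i).coeff x = 0 := by
      have h1 := coeff_mono_mul (ex e f i).1 (ex e f i).2 (toL (Z i))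
        (x - ((ex e f i).1, (ex e f i).2))
      rw [sub_add_cancel] at h1
      rw [lift, h1]
      refine toL_coeff_of_notMem _ ?_
      rintro ⟨n, hn⟩
      exact hx ⟨n, by simp only [hn, sub_add_cancel]⟩
    rw [this]; simp
  · have h1 : ∀ n, (lift e f Z i).coeff (expo n + ((ex e f i).1, (ex e f i).2))
        = MvPowerSeries.coeff n (Z i) := fun n => by
      rw [lift, coeff_mono_mul, toL_coeff_expo]
    have h2 : ((fun n : ℤ × ℤ => (lift e f Z i).coeff n * y.1 ^ n.1 * y.2 ^ n.2)
        ∘ fun n : Fin 2 →₀ ℕ => expo n + ((ex e f i).1, (ex e f i).2))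
        = fun n => y.1 ^ (ex e f i).1 * y.2 ^ (ex e f i).2 * term (Z i) y n := by
      funext n
      simp only [Function.comp_apply, h1, Prod.fst_add, Prod.snd_add]
      rw [zpow_add₀ hy.2.1, zpow_add₀ hy.2.2, term]
      simp only [expo, AddMonoidHom.coe_mk, ZeroHom.coe_mk, zpow_natCast]
      ring
    rw [h2]
    exact h0

theorem isMeromorphicSolution_liftVal (P : Params) (hr : 0 < r) (e f : Bool) {Z : Fin 4 → Pow}
    (hZ : ∀ i, SummableAt r (Z i)) (hsol : ChartSol P e f Z) :
    IsMeromorphicSolution P (r / 2) (liftVal e f Z) := by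
  constructor
  · intro i
    refine ⟨(-(ex e f i).1).toNat, (-(ex e f i).2).toNat,
      fun y => y.1 ^ (ex e f i).1.toNat * y.2 ^ (ex e f i).2.toNat * val (Z i) y, ?_, ?_⟩
    · refine DifferentiableOn.mul ?_ ((hZ i).differentiableOn hr)
      fun_prop
    · rintro y ⟨hy, hy1, hy2⟩
      have hz : ∀ (x : ℂ) (a : ℤ), x ≠ 0 → x ^ a = x ^ a.toNat / x ^ (-a).toNat := by
        intro x a hx
        rw [← zpow_natCast, ← zpow_natCast, ← zpow_sub₀ hx]
        congr 1
        omega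
      rw [liftVal, hz _ _ hy1, hz _ _ hy2]
      field_simp
  · rintro y ⟨hy, hy1, hy2⟩ hy3
    choose d hd hd' using fun i => (hZ i).hasDerivAt_fst hr hy
    choose d2 hd2 hd2' using fun i => (hZ i).hasDerivAt_snd hr hy
    have hder1 : ∀ i, y.1 * deriv (fun t => liftVal e f Z i (t, y.2)) y.1
        = y.1 ^ (ex e f i).1 * y.2 ^ (ex e f i).2
          * (val (euler 0 (Z i)) y + (ex e f i).1 * val (Z i) y) := by
      intro i
      have h := (((hasDerivAt_zpow (ex e f i).1 y.1 (Or.inl hy1)).mul_const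
        (y.2 ^ (ex e f i).2)).mul (hd i)).deriv
      have e1 : deriv (fun t => liftVal e f Z i (t, y.2)) y.1 = _ := h
      rw [e1, ← hd' i, zpow_sub_one₀ hy1]
      field_simp
      ring
    have hder2 : ∀ i, y.2 * deriv (fun s => liftVal e f Z i (y.1, s)) y.2
        = y.1 ^ (ex e f i).1 * y.2 ^ (ex e f i).2
          * (val (euler 1 (Z i)) y + (ex e f i).2 * val (Z i) y) := by
      intro i
      have h := (((hasDerivAt_zpow (ex e f i).2 y.2 (Or.inl hy2)).const_mul
        (y.1 ^ (ex e f i).1)).mul (hd2 i)).deriv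
      have e1 : deriv (fun s => liftVal e f Z i (y.1, s)) y.2 = _ := h
      rw [e1, ← hd2' i, zpow_sub_one₀ hy2]
      field_simp
      ring
    have hrel : ChartRel e f y.1 y.2 (fun i => liftVal e f Z i y)
        (fun i => y.1 * deriv (fun t => liftVal e f Z i (t, y.2)) y.1)
        (fun i => y.2 * deriv (fun s => liftVal e f Z i (y.1, s)) y.2)
        (fun i => val (Z i) y) (fun i => val (euler 0 (Z i)) y)
        (fun i => val (euler 1 (Z i)) y) := by
      refine chartRel_of_units (m := fun i => y.1 ^ (ex e f i).1 * y.2 ^ (ex e f i).2)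
        ?_ ?_ ?_ ?_ (fun i => rfl) hder1 hder2
      · cases e <;> simp [ex, bit, pick, hy1]
      · cases f <;> simp [ex, bit, pick]
      · cases e <;> simp [ex, bit, pick]
      · cases f <;> simp [ex, bit, pick, hy2]
    refine (hrel.hamiltonEqs_iff P (isUnit_iff_ne_zero.2 hy1)
      (isUnit_iff_ne_zero.2 (mul_ne_zero hy2 (sub_ne_zero.2 hy3)))).2 fun i => ?_
    have hs : ∀ i, SumsTo (r / 2) y (Z i) (val (Z i) y) := fun i => ⟨(hZ i).half hr, rfl⟩
    -- Summation respects polynomial evaluation, so the formal chart equations become equations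
    -- between the sums at `y`.
    have hA := SumsTo.aeval (SumsTo.pt hs) hy.1.le hy.2.le (fieldT (chartK1 P e f) i)
    have hB := SumsTo.aeval (SumsTo.pt hs) hy.1.le hy.2.le (fieldS (chartK2 P e f) i)
    rw [aeval_fieldT, aeval_fieldT] at hA
    rw [aeval_fieldS, aeval_fieldS] at hB
    rw [← (hsol i).1] at hA
    rw [← (hsol i).2] at hB
    have hX : SumsTo (r / 2) y (sP - 1) (y.2 - 1) := by
      have := SumsTo.aeval (SumsTo.pt hs) hy.1.le hy.2.le (X (Sum.inr 1) - 1)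
      simpa using this
    have hE : SumsTo (r / 2) y (euler 1 (Z i)) (val (euler 1 (Z i)) y) :=
      ⟨(hZ i).euler hr 1, rfl⟩
    exact ⟨hA.2, (hX.mul hE hy.1.le hy.2.le).2.symm.trans hB.2⟩

end Garnier

namespace Garnier

/-! ## Leading terms and ideals of convergent power series -/

/-- The exponent `(i, j)`. -/
noncomputable def ix (i j : ℕ) : Fin 2 →₀ ℕ := Finsupp.single 0 i + Finsupp.single 1 j

@[simp] theorem ix_zero (i j : ℕ) : ix i j 0 = i := by simp [ix]

@[simp] theorem ix_one (i j : ℕ) : ix i j 1 = j := by simp [ix]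

theorem eq_ix_iff {n : Fin 2 →₀ ℕ} {i j : ℕ} : n = ix i j ↔ n 0 = i ∧ n 1 = j := by
  simp [Finsupp.ext_iff, Fin.forall_fin_two]

theorem ix_le_iff {n : Fin 2 →₀ ℕ} {i j : ℕ} : ix i j ≤ n ↔ i ≤ n 0 ∧ j ≤ n 1 := by
  simp [Finsupp.le_def, Fin.forall_fin_two]

theorem monomial_ix (i j : ℕ) : (MvPowerSeries.monomial (ix i j) 1 : Pow) = tP ^ i * sP ^ j := by
  rw [tP, sP, MvPowerSeries.X_pow_eq, MvPowerSeries.X_pow_eq,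
    MvPowerSeries.monomial_mul_monomial, one_mul, ix]

theorem isConvergent_monomial (n : Fin 2 →₀ ℕ) (c : ℂ) :
    IsConvergent (MvPowerSeries.monomial n c) :=
  ⟨1, one_pos, (SumsTo.monomial (r := 1) (y := 0) n c).1⟩

/-- The multiples of one monomial after another are split off. Each cofactor is a shift of
coefficients and converges at the same radius, so it lies in `R` and not merely among formal series.
-/
theorem mem_span_of_coeff {S : Set Pow} {M : Finset (Fin 2 →₀ ℕ)}
    (hM : ∀ k ∈ M, MvPowerSeries.monomial k 1 ∈ S) (f : R)
    (hf : ∀ n, MvPowerSeries.coeff n (f : Pow) ≠ 0 → ∃ k ∈ M, k ≤ n) :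
    f ∈ Ideal.span ((fun a : R => (a : Pow)) ⁻¹' S) := by
  classical
  induction M using Finset.induction_on generalizing f with
  | empty =>
    have : f = 0 := Subtype.ext (by
      ext n
      by_contra h
      obtain ⟨k, hk, -⟩ := hf n h
      simp at hk)
    rw [this]
    exact Ideal.zero_mem _
  | insert k M hk ih =>
    set g : Pow := fun n => MvPowerSeries.coeff (n + k) (f : Pow) with hg
    have hgc : ∀ n, MvPowerSeries.coeff n g = MvPowerSeries.coeff (n + k) (f : Pow) :=
      fun n => rfl
    have hgconv : IsConvergent g := by
      obtain ⟨r, hr, hs⟩ := (f.2 : IsConvergent (f : Pow))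
      refine ⟨r, hr, ?_⟩
      have h1 := (hs.comp_injective (add_left_injective k)).mul_right ((r ^ (k 0 + k 1))⁻¹)
      refine h1.congr fun n => ?_
      rw [hgc, Function.comp_apply, Finsupp.add_apply, Finsupp.add_apply]
      have : r ^ (n 0 + k 0 + (n 1 + k 1)) = r ^ (n 0 + n 1) * r ^ (k 0 + k 1) := by
        rw [← pow_add]; congr 1; ring
      rw [this]
      have : r ^ (k 0 + k 1) ≠ 0 := by positivity
      field_simp
    let G : R := ⟨g, hgconv⟩
    let m : R := ⟨MvPowerSeries.monomial k 1, isConvergent_monomial k 1⟩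
    have h1 : m * G ∈ Ideal.span ((fun a : R => (a : Pow)) ⁻¹' S) :=
      Ideal.mul_mem_right _ _ (Ideal.subset_span (hM k (Finset.mem_insert_self _ _)))
    have h2 : f - m * G ∈ Ideal.span ((fun a : R => (a : Pow)) ⁻¹' S) := by
      refine ih (fun k hk => hM k (Finset.mem_insert_of_mem hk)) _ fun n hn => ?_
      have hc : MvPowerSeries.coeff n ((f - m * G : R) : Pow) = MvPowerSeries.coeff n (f : Pow)
          - if k ≤ n then MvPowerSeries.coeff n (f : Pow) else 0 := by
        have : ((f - m * G : R) : Pow) = (f : Pow) - MvPowerSeries.monomial k 1 * g := rfl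
        rw [this, map_sub, MvPowerSeries.coeff_monomial_mul]
        split_ifs with h
        · rw [hgc, tsub_add_cancel_of_le h, one_mul]
        · rfl
      rw [hc] at hn
      split_ifs at hn with h
      · simp at hn
      · rw [sub_zero] at hn
        obtain ⟨l, hl, hln⟩ := hf n hn
        rcases Finset.mem_insert.1 hl with rfl | hl
        · exact absurd hln h
        · exact ⟨l, hl, hln⟩
    have : f = f - m * G + m * G := by ring
    rw [this]
    exact Ideal.add_mem _ h2 h1

/-- For a monomial ideal only the exponents outside it have to be checked, a finite set in each
application below. -/
theorem hasForm_of_coeff {m : Laurent} {S : Set Pow} {M : Finset (Fin 2 →₀ ℕ)}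
    (hM : ∀ k ∈ M, MvPowerSeries.monomial k 1 ∈ S) {i j : ℕ} {c : ℂ} {F : Pow}
    (hF : IsConvergent F)
    (h : ∀ n, (∀ k ∈ M, ¬ k ≤ n) → MvPowerSeries.coeff n F = if n = ix i j then c else 0) :
    HasForm R m (mono i j c) S (m * toL F) := by
  classical
  have hG : IsConvergent (F - MvPowerSeries.monomial (ix i j) c) :=
    R.sub_mem hF (isConvergent_monomial _ _)
  refine ⟨⟨_, hG⟩, mem_span_of_coeff hM _ fun n hn => ?_, ?_⟩
  · by_contra hk
    push Not at hk
    refine hn ?_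
    rw [map_sub, h n hk, MvPowerSeries.coeff_monomial, sub_self]
  · have : mono i j c = toL (MvPowerSeries.monomial (ix i j) c) := by
      rw [toL_monomial, ix_zero, ix_one]
    rw [this, ← map_add]
    congr 2
    simp

theorem hasForm_one {m : Laurent} {c : ℂ} {F : Pow} (hF : IsConvergent F)
    (h0 : MvPowerSeries.constantCoeff F = c) :
    HasForm R m (mono 0 0 c) {tP, sP} (m * toL F) := by
  classical
  refine hasForm_of_coeff (i := 0) (j := 0) (M := {ix 1 0, ix 0 1}) ?_ hF fun n hn => ?_
  · simp [monomial_ix]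
  · simp only [Finset.mem_insert, Finset.mem_singleton, forall_eq_or_imp, forall_eq,
      ix_le_iff] at hn
    have : n = ix 0 0 := eq_ix_iff.2 ⟨by omega, by omega⟩
    rw [this, if_pos rfl, ← h0]
    simp [ix]

theorem hasForm_t {m : Laurent} {c : ℂ} {F : Pow} (hF : IsConvergent F)
    (h0 : MvPowerSeries.constantCoeff F = 0) (h1 : MvPowerSeries.coeff (ix 1 0) F = c) :
    HasForm R m (mono 1 0 c) {sP, tP ^ 2} (m * toL F) := by
  classical
  refine hasForm_of_coeff (i := 1) (j := 0) (M := {ix 0 1, ix 2 0}) ?_ hF fun n hn => ?_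
  · simp [monomial_ix]
  · simp only [Finset.mem_insert, Finset.mem_singleton, forall_eq_or_imp, forall_eq,
      ix_le_iff] at hn
    split_ifs with h
    · rw [h, h1]
    · rw [eq_ix_iff] at h
      have : n = 0 := by
        rw [show (0 : Fin 2 →₀ ℕ) = ix 0 0 by simp [ix]]
        exact eq_ix_iff.2 ⟨by omega, by omega⟩
      rw [this]; exact h0

theorem hasForm_s {m : Laurent} {c : ℂ} {F : Pow} (hF : IsConvergent F)
    (h0 : MvPowerSeries.constantCoeff F = 0) (h1 : MvPowerSeries.coeff (ix 1 0) F = 0)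
    (h2 : MvPowerSeries.coeff (ix 0 1) F = c) :
    HasForm R m (mono 0 1 c) {tP ^ 2, tP * sP, sP ^ 2} (m * toL F) := by
  classical
  refine hasForm_of_coeff (i := 0) (j := 1) (M := {ix 2 0, ix 1 1, ix 0 2}) ?_ hF fun n hn => ?_
  · simp [monomial_ix]
  · simp only [Finset.mem_insert, Finset.mem_singleton, forall_eq_or_imp, forall_eq,
      ix_le_iff] at hn
    split_ifs with h
    · rw [h, h2]
    · rw [eq_ix_iff] at h
      rcases Nat.eq_zero_or_pos (n 0) with h3 | h3
      · have : n = 0 := by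
          rw [show (0 : Fin 2 →₀ ℕ) = ix 0 0 by simp [ix]]
          exact eq_ix_iff.2 ⟨by omega, by omega⟩
        rw [this]; exact h0
      · have : n = ix 1 0 := eq_ix_iff.2 ⟨by omega, by omega⟩
        rw [this]; exact h1

/-- The monomials outside the ideal are `1`, `t₁`, `s₂`, `t₁²` and `t₁ s₂`, which accounts for the
five hypotheses. -/
theorem hasForm_ts {m : Laurent} {c : ℂ} {F : Pow} (hF : IsConvergent F)
    (h0 : MvPowerSeries.constantCoeff F = 0) (h1 : MvPowerSeries.coeff (ix 1 0) F = 0)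
    (h2 : MvPowerSeries.coeff (ix 0 1) F = 0) (h3 : MvPowerSeries.coeff (ix 2 0) F = 0)
    (h4 : MvPowerSeries.coeff (ix 1 1) F = c) :
    HasForm R m (mono 1 1 c) {tP ^ 3, tP ^ 2 * sP, sP ^ 2} (m * toL F) := by
  classical
  refine hasForm_of_coeff (i := 1) (j := 1) (M := {ix 3 0, ix 2 1, ix 0 2}) ?_ hF fun n hn => ?_
  · simp [monomial_ix]
  · simp only [Finset.mem_insert, Finset.mem_singleton, forall_eq_or_imp, forall_eq,
      ix_le_iff] at hn
    split_ifs with h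
    · rw [h, h4]
    · rw [eq_ix_iff] at h
      have hcases : n = ix 0 0 ∨ n = ix 1 0 ∨ n = ix 0 1 ∨ n = ix 2 0 := by
        simp only [eq_ix_iff]; omega
      rcases hcases with rfl | rfl | rfl | rfl
      · simpa [ix] using h0
      · exact h1
      · exact h2
      · exact h3

/-- Only the constant term is retained, which is all that uniqueness needs. The error has none,
because the ideal lies in the kernel of the constant coefficient, over any ring `A`. -/
theorem HasForm.exists_pow {A : Subring Pow} {m x : Laurent} {S : Set Pow} {i j : ℕ} {c : ℂ}
    (h : HasForm A m (mono i j c) S x) (hS : ∀ u ∈ S, MvPowerSeries.constantCoeff u = 0) :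
    ∃ F : Pow, x = m * toL F ∧ MvPowerSeries.constantCoeff F = if i = 0 ∧ j = 0 then c else 0 := by
  classical
  obtain ⟨f, hf, rfl⟩ := h
  refine ⟨MvPowerSeries.monomial (ix i j) c + f, ?_, ?_⟩
  · rw [map_add, toL_monomial, ix_zero, ix_one]
  · have hle : Ideal.span ((fun a : A => (a : Pow)) ⁻¹' S)
        ≤ RingHom.ker ((MvPowerSeries.constantCoeff (σ := Fin 2) (R := ℂ)).comp A.subtype) :=
      Ideal.span_le.2 fun u hu => hS _ hu
    have h0 : MvPowerSeries.constantCoeff (f : Pow) = 0 := hle hf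
    rw [map_add, h0, add_zero, ← MvPowerSeries.coeff_zero_eq_constantCoeff_apply,
      MvPowerSeries.coeff_monomial]
    congr 1
    rw [eq_ix_iff]
    simp [eq_comm]

theorem HasForm.pow_one {A : Subring Pow} {m x : Laurent} {c : ℂ}
    (h : HasForm A m (mono 0 0 c) {tP, sP} x) :
    ∃ F : Pow, x = m * toL F ∧ MvPowerSeries.constantCoeff F = c :=
  HasForm.exists_pow (i := 0) (j := 0) h (by simp [tP, sP])

theorem HasForm.pow_t {A : Subring Pow} {m x : Laurent} {c : ℂ}
    (h : HasForm A m (mono 1 0 c) {sP, tP ^ 2} x) :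
    ∃ F : Pow, x = m * toL F ∧ MvPowerSeries.constantCoeff F = 0 :=
  HasForm.exists_pow (i := 1) (j := 0) h (by simp [tP, sP])

theorem HasForm.pow_s {A : Subring Pow} {m x : Laurent} {c : ℂ}
    (h : HasForm A m (mono 0 1 c) {tP ^ 2, tP * sP, sP ^ 2} x) :
    ∃ F : Pow, x = m * toL F ∧ MvPowerSeries.constantCoeff F = 0 :=
  HasForm.exists_pow (i := 0) (j := 1) h (by simp [tP, sP])

theorem HasForm.pow_ts {A : Subring Pow} {m x : Laurent} {c : ℂ}
    (h : HasForm A m (mono 1 1 c) {tP ^ 3, tP ^ 2 * sP, sP ^ 2} x) :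
    ∃ F : Pow, x = m * toL F ∧ MvPowerSeries.constantCoeff F = 0 :=
  HasForm.exists_pow (i := 1) (j := 1) h (by simp [tP, sP])

/-! ## Coefficients of degree one -/

/-- The coefficient of the variable with index `k`. -/
noncomputable def lin (k : Fin 2) (F : Pow) : ℂ := MvPowerSeries.coeff (Finsupp.single k 1) F

theorem lin_eq (k : Fin 2) (F : Pow) :
    lin k F = MvPowerSeries.constantCoeff (MvPowerSeries.pderiv ℂ k F) := by
  rw [← MvPowerSeries.coeff_zero_eq_constantCoeff_apply, MvPowerSeries.coeff_pderiv, lin]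
  simp

theorem coeff_ix_one_zero (F : Pow) : MvPowerSeries.coeff (ix 1 0) F = lin 0 F := by simp [ix, lin]

theorem coeff_ix_zero_one (F : Pow) : MvPowerSeries.coeff (ix 0 1) F = lin 1 F := by simp [ix, lin]

theorem lin_add (k : Fin 2) (F G : Pow) : lin k (F + G) = lin k F + lin k G := map_add _ _ _

theorem lin_sub (k : Fin 2) (F G : Pow) : lin k (F - G) = lin k F - lin k G := map_sub _ _ _

theorem lin_neg (k : Fin 2) (F : Pow) : lin k (-F) = -lin k F := map_neg _ _

theorem lin_mul (k : Fin 2) (F G : Pow) : lin k (F * G)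
    = lin k F * MvPowerSeries.constantCoeff G + MvPowerSeries.constantCoeff F * lin k G := by
  simp only [lin_eq, Derivation.leibniz, smul_eq_mul, map_add, map_mul]
  ring

theorem lin_pow (k : Fin 2) (F : Pow) (n : ℕ) : lin k (F ^ n)
    = n * MvPowerSeries.constantCoeff F ^ (n - 1) * lin k F := by
  simp only [lin_eq, Derivation.leibniz_pow, smul_eq_mul, nsmul_eq_mul, map_mul, map_pow,
    map_natCast]
  ring

theorem lin_algebraMap (k : Fin 2) (c : ℂ) : lin k (algebraMap ℂ Pow c) = 0 := by
  rw [lin_eq, Derivation.map_algebraMap, map_zero]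

theorem lin_one (k : Fin 2) : lin k 1 = 0 := by
  rw [lin_eq, Derivation.map_one_eq_zero, map_zero]

theorem lin_ofNat (k : Fin 2) (n : ℕ) [n.AtLeastTwo] : lin k (OfNat.ofNat n : Pow) = 0 := by
  have : (OfNat.ofNat n : Pow) = algebraMap ℂ Pow (OfNat.ofNat n) := (map_ofNat _ n).symm
  rw [this, lin_algebraMap]

theorem lin_zero_tP : lin 0 tP = 1 := by simp [lin_eq, tP]

theorem lin_one_tP : lin 1 tP = 0 := by simp [lin_eq, tP]

theorem lin_zero_sP : lin 0 sP = 0 := by simp [lin_eq, sP]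

theorem lin_one_sP : lin 1 sP = 1 := by simp [lin_eq, sP]

theorem lin_zero_euler_zero (F : Pow) : lin 0 (euler 0 F) = lin 0 F := by
  simp [lin, coeff_euler]

theorem lin_one_euler_one (F : Pow) : lin 1 (euler 1 F) = lin 1 F := by
  simp [lin, coeff_euler]

theorem constantCoeff_euler (k : Fin 2) (F : Pow) :
    MvPowerSeries.constantCoeff (euler k F) = 0 := by
  rw [← MvPowerSeries.coeff_zero_eq_constantCoeff_apply, coeff_euler]; simp

end Garnier

namespace Garnier

/-! ## Solutions in a chart -/

theorem constantCoeff_algebraMap (c : ℂ) :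
    MvPowerSeries.constantCoeff (algebraMap ℂ Pow c) = c := by
  simp [MvPowerSeries.algebraMap_apply]

open MvPolynomial in
-- Chain rule at the origin with the variables set to zero: a Jacobian can be applied to a vector by
-- taking `lin` of the closed chart formulas, without computing its entries.
theorem lin_aeval_pt (k : Fin 2) (V : Fin 4 → Pow) (F : Poly) :
    lin k (aeval (pt V 0 0) F) =
      ∑ j, ev0 (fun i => MvPowerSeries.constantCoeff (V i)) (pderiv (Sum.inl j) F) * lin k (V j) := by
  classical
  have hc : ∀ G : Poly, MvPowerSeries.constantCoeff (aeval (pt V 0 0) G)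
      = ev0 (fun i => MvPowerSeries.constantCoeff (V i)) G := by
    intro G
    have := constantCoeff_aeval (pt V 0 0) G
    rw [this, ev0]
    congr 2
    funext x
    rcases x with i | i
    · rfl
    · fin_cases i <;> simp [pt]
  induction F using MvPolynomial.induction_on with
  | C a => simp [algHom_C, lin_algebraMap]
  | add p q hp hq => simp only [map_add, lin_add, hp, hq, add_mul, Finset.sum_add_distrib]
  | mul_X p i hp =>
    rw [map_mul, lin_mul, hp, hc, hc, aeval_X, Finset.sum_mul]
    simp only [pderiv_mul, map_add, map_mul, add_mul, Finset.sum_add_distrib]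
    congr 1
    · refine Finset.sum_congr rfl fun j _ => ?_
      ring
    · rcases i with i | i
      · rw [Finset.sum_eq_single i]
        · rw [pderiv_inl, if_pos rfl, map_one, mul_one, pt_inl]
        · intro j _ hj
          rw [pderiv_inl, if_neg (Ne.symm hj)]; simp
        · simp
      · fin_cases i <;> simp [lin, pt]

/-- The linear parts of the two systems of a chart at `z0` have no joint eigenvector for the
eigenvalues `(n₀, -n₁)`, unless `n = 0`. A vector `v` is represented by a family of power series
with constant terms `z0` and coefficients `v` at `t₁`. -/
def NonResonant (P : Params) (e f : Bool) (z0 : Fin 4 → ℂ) : Prop :=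
  ∀ n : Fin 2 →₀ ℕ, n ≠ 0 → ∀ V : Fin 4 → Pow, (∀ i, MvPowerSeries.constantCoeff (V i) = z0 i) →
    (∀ i, lin 0 (chartT P e f 0 0 V i) = n 0 * lin 0 (V i)) →
    (∀ i, lin 0 (chartS P e f 0 0 V i) = -n 1 * lin 0 (V i)) → ∀ i, lin 0 (V i) = 0

theorem exists_chartSol {P : Params} {e f : Bool} {z0 : Fin 4 → ℂ}
    (hA : ∀ i, chartT P e f 0 0 z0 i = 0) (hB : ∀ i, chartS P e f 0 0 z0 i = 0)
    (hnr : NonResonant P e f z0) :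
    ∃ Z : Fin 4 → Pow, (∀ i, MvPowerSeries.constantCoeff (Z i) = z0 i) ∧ ChartSol P e f Z ∧
      (∃ r : ℝ, 0 < r ∧ ∀ i, SummableAt r (Z i)) ∧
      ∀ Z' : Fin 4 → Pow, (∀ i, MvPowerSeries.constantCoeff (Z' i) = z0 i) → ChartSol P e f Z' →
        Z' = Z := by
  have hc : Compat (fieldT (chartK1 P e f)) (fieldS (chartK2 P e f)) :=
    compat_of_curvature fun j => by rw [curvature_chart, map_zero]
  obtain ⟨Z, h1, h2, h3⟩ := exists_pairSol (z0 := z0) hc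
    (fun i => by rw [ev0, aeval_fieldT, hA]) (fun i => by rw [ev0, aeval_fieldS, hB])
    (fun n hn v hv1 hv2 => by
      -- A curve through `z0` with velocity `v` represents the tangent vector.
      let V : Fin 4 → Pow := fun i => algebraMap ℂ Pow (z0 i) + algebraMap ℂ Pow (v i) * tP
      have hV0 : ∀ i, MvPowerSeries.constantCoeff (V i) = z0 i := fun i => by
        simp [V, tP, constantCoeff_algebraMap]
      have hV1 : ∀ i, lin 0 (V i) = v i := fun i => by
        rw [lin_add, lin_mul, lin_algebraMap, lin_algebraMap, lin_zero_tP, constantCoeff_algebraMap]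
        ring
      have key : ∀ G : Fin 4 → Poly, ∀ i,
          lin 0 (MvPolynomial.aeval (pt V 0 0) (G i)) = (jac G z0).mulVec v i := fun G i => by
        rw [lin_aeval_pt]
        simp only [hV0, hV1, jac, Matrix.mulVec, dotProduct, Matrix.of_apply]
      funext i
      rw [Pi.zero_apply, ← hV1]
      refine hnr n hn V hV0 (fun i => ?_) (fun i => ?_) i
      · rw [← aeval_fieldT, key, hv1, hV1, Pi.smul_apply, smul_eq_mul]
      · rw [← aeval_fieldS, key, hv2, hV1, Pi.smul_apply, smul_eq_mul])
  rw [pairSol_iff] at h1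
  exact ⟨Z, h1.1, h1.2, h2, fun Z' h4 h5 => h3 Z' ((pairSol_iff _ _ _ _ _).2 ⟨h4, h5⟩)⟩

end Garnier

namespace Garnier

section NonResonance

set_option linter.unusedSimpArgs false

/-! ## Non-resonance at the equilibria -/

theorem sub_natCast_ne_zero {x : ℂ} (h : ∀ n : ℤ, x ≠ n) (n : ℕ) : x - n ≠ 0 :=
  sub_ne_zero.2 (by simpa using h n)

theorem add_natCast_ne_zero {x : ℂ} (h : ∀ n : ℤ, x ≠ n) (n : ℕ) : x + n ≠ 0 := fun h1 =>
  h (-n) (by rw [eq_neg_of_add_eq_zero_left h1]; push_cast; ring)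

theorem sq_sub_natCast_ne_zero {x : ℂ} (h : ∀ n : ℤ, x ≠ n) (n : ℕ) : x ^ 2 - (n : ℂ) ^ 2 ≠ 0 := by
  rw [sq_sub_sq]
  exact mul_ne_zero (add_natCast_ne_zero h n) (sub_natCast_ne_zero h n)

theorem ne_zero_of_ne_int {x : ℂ} (h : ∀ n : ℤ, x ≠ n) : x ≠ 0 := by simpa using h 0

theorem lin_zero (k : Fin 2) : lin k 0 = 0 := map_zero _

theorem lin_two (k : Fin 2) : lin k 2 = 0 := lin_ofNat k 2

theorem lin_three (k : Fin 2) : lin k 3 = 0 := lin_ofNat k 3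

theorem lin_four (k : Fin 2) : lin k 4 = 0 := lin_ofNat k 4

/-- The matrix with rows `(a, b)`, `(c, -a)` squares to `k²`, so an eigenvalue `n` must satisfy `n²
= k²`. -/
theorem eq_zero_of_traceless {a b c k n v w : ℂ} (h : a ^ 2 + b * c = k ^ 2)
    (hk : k ^ 2 - n ^ 2 ≠ 0) (h1 : a * v + b * w = n * v) (h2 : c * v - a * w = n * w) :
    v = 0 ∧ w = 0 := by
  constructor
  · refine (mul_eq_zero.1 (?_ : (k ^ 2 - n ^ 2) * v = 0)).resolve_left hk
    linear_combination -v * h + (a + n) * h1 + b * h2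
  · refine (mul_eq_zero.1 (?_ : (k ^ 2 - n ^ 2) * w = 0)).resolve_left hk
    linear_combination -w * h + c * h1 + (n - a) * h2

/-- The `t₁`-system gives `p₁` the eigenvalue `α₁`, and then `q₁` the eigenvalue `-α₁` once the
others vanish. It kills `q₂`, `p₂` if `n₀ ≠ 0`; for `n₀ = 0` the `s₂`-system acts on them by a block
of square `(α_∞ + α₁)²`. -/
theorem nonResonant_zero {P : Params} (hrel : P.Relation) (h : P.Generic) :
    NonResonant P false false
      ![P.eta / P.a8, (P.a8 + P.a1) / P.a8, 0, -P.nu * P.a8 / (P.a8 + P.a1)] := by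
  intro n hn V h0 h1 h2
  have g8 := ne_zero_of_ne_int h.a8_ne
  have g1 := sub_natCast_ne_zero h.a1_ne (n 0)
  have g1' := add_natCast_ne_zero h.a1_ne (n 0)
  have gk := sub_natCast_ne_zero h.a1_add_a8_ne (n 1)
  have gk0 := ne_zero_of_ne_int h.a1_add_a8_ne
  have gk2 := sq_sub_natCast_ne_zero h.a1_add_a8_ne (n 1)
  rw [add_comm P.a1] at gk gk0 gk2
  simp only [forall_fin_four, Matrix.cons_val] at h0 h1 h2 ⊢
  obtain ⟨c0, c1, c2, c3⟩ := h0
  simp only [chartT, chartS, pick, Matrix.cons_val, Bool.not_false, if_true, if_false,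
    Bool.false_eq_true, lin_add, lin_sub, lin_neg, lin_mul, lin_pow, lin_algebraMap, lin_one,
    lin_zero, lin_two, map_add, map_sub, map_mul, map_pow, map_zero, map_one, map_ofNat, Nat.reduceSub, pow_one, Nat.cast_ofNat,
    constantCoeff_algebraMap, c0, c1, c2, c3, zero_mul, mul_zero, add_zero, sub_zero] at h1 h2
  generalize lin 0 (V 0) = v0, lin 0 (V 1) = v1, lin 0 (V 2) = v2, lin 0 (V 3) = v3 at *
  have ha0 : P.a0 = 1 - 2 * P.nu - P.a1 - P.a2 - P.a8 := by
    have : P.a0 + P.a1 + P.a2 + P.a8 = 1 - 2 * P.nu := hrel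
    linear_combination this
  rw [ha0] at h2
  generalize P.a0 = a0, P.a1 = a1, P.a2 = a2, P.a8 = a8, P.nu = nu, P.eta = eta at *
  obtain ⟨t0, t1, t2, t3⟩ := h1
  obtain ⟨-, s1, -, s3⟩ := h2
  have hv2 : v2 = 0 := (mul_eq_zero.1 (show (a1 - n 0) * v2 = 0 by linear_combination t2)).resolve_left g1
  subst hv2
  have key : v1 = 0 ∧ v3 = 0 := by
    rcases eq_or_ne (n 0 : ℂ) 0 with hn0 | hn0
    · refine eq_zero_of_traceless (a := a8 + a1 - 2 * nu * a1 / a8)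
        (b := 2 * (a8 + a1) ^ 2 * a1 / a8 ^ 3)
        (c := 2 * nu * a8 * ((a8 + a1) * a8 - nu * a1) / (a8 + a1) ^ 2) (k := a8 + a1) (n := -n 1) ?_
        (by rwa [neg_sq]) ?_ ?_
      · field_simp
        ring
      · linear_combination (norm := skip) s1
        field_simp
        ring
      · linear_combination (norm := skip) s3
        field_simp
        ring
    · constructor
      · exact (mul_eq_zero.1 (show (n 0 : ℂ) * v1 = 0 by linear_combination -t1)).resolve_left hn0
      · exact (mul_eq_zero.1 (show (n 0 : ℂ) * v3 = 0 by linear_combination -t3)).resolve_left hn0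
  obtain ⟨rfl, rfl⟩ := key
  refine ⟨(mul_eq_zero.1 (show (a1 + n 0) * v0 = 0 by linear_combination -t0)).resolve_left g1', rfl, rfl, rfl⟩


theorem nonResonant_two {P : Params} (h : P.Generic) :
    NonResonant P false true ![-P.eta / P.a1, P.a2 / (P.a0 + P.a2), 0, 0] := by
  intro n hn V h0 h1 h2
  have g1 := sub_natCast_ne_zero h.a1_ne (n 0)
  have g1' := add_natCast_ne_zero h.a1_ne (n 0)
  have gk0 := ne_zero_of_ne_int h.a0_add_a2_ne
  have gk2 := sq_sub_natCast_ne_zero h.a0_add_a2_ne (n 1)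
  simp only [forall_fin_four, Matrix.cons_val] at h0 h1 h2 ⊢
  obtain ⟨c0, c1, c2, c3⟩ := h0
  simp only [chartT, chartS, pick, Matrix.cons_val, Bool.not_false, Bool.not_true, if_true,
    if_false, Bool.false_eq_true, lin_add, lin_sub, lin_neg, lin_mul, lin_pow, lin_algebraMap,
    lin_one, lin_zero, lin_two, lin_three, lin_four, map_add, map_sub, map_mul, map_pow, map_zero,
    map_one, map_ofNat, map_neg, Nat.reduceSub, pow_one, Nat.cast_ofNat, constantCoeff_algebraMap,
    c0, c1, c2, c3, zero_mul, mul_zero, add_zero, sub_zero] at h1 h2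
  generalize lin 0 (V 0) = v0, lin 0 (V 1) = v1, lin 0 (V 2) = v2, lin 0 (V 3) = v3 at *
  generalize P.a0 = a0, P.a1 = a1, P.a2 = a2, P.a8 = a8, P.nu = nu, P.eta = eta at *
  obtain ⟨t0, t1, t2, t3⟩ := h1
  obtain ⟨-, s1, -, s3⟩ := h2
  have hv2 : v2 = 0 :=
    (mul_eq_zero.1 (show (a1 - n 0) * v2 = 0 by linear_combination t2)).resolve_left g1
  subst hv2
  have hv0 : v0 = 0 :=
    (mul_eq_zero.1 (show (a1 + n 0) * v0 = 0 by linear_combination -t0)).resolve_left g1'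
  subst hv0
  have key : v1 = 0 ∧ v3 = 0 := by
    rcases eq_or_ne (n 0 : ℂ) 0 with hn0 | hn0
    · refine eq_zero_of_traceless (a := a0 + a2) (b := 2 * a0 * a2 / (a0 + a2) ^ 2) (c := 0)
        (k := a0 + a2) (n := -n 1) ?_ (by rwa [neg_sq]) ?_ ?_
      · field_simp
        ring
      · linear_combination (norm := skip) s1
        field_simp
        ring
      · linear_combination (norm := skip) s3
        field_simp
        ring
    · constructor
      · exact (mul_eq_zero.1 (show (n 0 : ℂ) * v1 = 0 by linear_combination -t1)).resolve_left hn0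
      · exact (mul_eq_zero.1 (show (n 0 : ℂ) * v3 = 0 by linear_combination -t3)).resolve_left hn0
  exact ⟨rfl, key.1, rfl, key.2⟩

theorem nonResonant_three {P : Params} (h : P.Generic) :
    NonResonant P false true ![-P.eta / P.a1, P.a2 / (P.a2 - P.a0), 0, P.a2 - P.a0] := by
  intro n hn V h0 h1 h2
  have g1 := sub_natCast_ne_zero h.a1_ne (n 0)
  have g1' := add_natCast_ne_zero h.a1_ne (n 0)
  have gk0 := ne_zero_of_ne_int h.a0_sub_a2_ne
  have gk2 := sq_sub_natCast_ne_zero h.a0_sub_a2_ne (n 1)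
  simp only [forall_fin_four, Matrix.cons_val] at h0 h1 h2 ⊢
  obtain ⟨c0, c1, c2, c3⟩ := h0
  simp only [chartT, chartS, pick, Matrix.cons_val, Bool.not_false, Bool.not_true, if_true,
    if_false, Bool.false_eq_true, lin_add, lin_sub, lin_neg, lin_mul, lin_pow, lin_algebraMap,
    lin_one, lin_zero, lin_two, lin_three, lin_four, map_add, map_sub, map_mul, map_pow, map_zero,
    map_one, map_ofNat, map_neg, Nat.reduceSub, pow_one, Nat.cast_ofNat, constantCoeff_algebraMap,
    c0, c1, c2, c3, zero_mul, mul_zero, add_zero, sub_zero] at h1 h2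
  generalize lin 0 (V 0) = v0, lin 0 (V 1) = v1, lin 0 (V 2) = v2, lin 0 (V 3) = v3 at *
  generalize P.a0 = a0, P.a1 = a1, P.a2 = a2, P.a8 = a8, P.nu = nu, P.eta = eta at *
  have gk : a2 - a0 ≠ 0 := by rwa [← neg_sub, neg_ne_zero]
  rw [sub_sq_comm] at gk2
  obtain ⟨t0, t1, t2, t3⟩ := h1
  obtain ⟨-, s1, -, s3⟩ := h2
  have hv2 : v2 = 0 :=
    (mul_eq_zero.1 (show (a1 - n 0) * v2 = 0 by linear_combination t2)).resolve_left g1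
  subst hv2
  have hv0 : v0 = 0 :=
    (mul_eq_zero.1 (show (a1 + n 0) * v0 = 0 by linear_combination -t0)).resolve_left g1'
  subst hv0
  have key : v1 = 0 ∧ v3 = 0 := by
    rcases eq_or_ne (n 0 : ℂ) 0 with hn0 | hn0
    -- The entries of the `s₂`-Jacobian on the `q₂`, `p₂` directions; this block squares to `(α₂ -
    -- α₀)²`.
    · refine eq_zero_of_traceless (a := -(a0 + a2)) (b := -2 * a0 * a2 / (a2 - a0) ^ 2) (c := 2 * (a2 - a0) ^ 2)
        (k := a2 - a0) (n := -n 1) ?_ (by rwa [neg_sq]) ?_ ?_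
      · field_simp
        ring
      · linear_combination (norm := skip) s1
        field_simp
        ring
      · linear_combination (norm := skip) s3
        field_simp
        ring
    · constructor
      · exact (mul_eq_zero.1 (show (n 0 : ℂ) * v1 = 0 by linear_combination -t1)).resolve_left hn0
      · exact (mul_eq_zero.1 (show (n 0 : ℂ) * v3 = 0 by linear_combination -t3)).resolve_left hn0
  exact ⟨rfl, key.1, rfl, key.2⟩

/-- Here the `t₁`-Jacobian suffices: with `k = α_∞ + α₀ + α₂` it has eigenvalues `∓k` on the `q₂`
and `p₂` directions and squares to `k²` on the remaining block. -/
theorem nonResonant_four {P : Params} (hrel : P.Relation) (h : P.Generic) :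
    NonResonant P true false
      ![(P.a8 + P.a0 + P.a2) / P.a8, 0, -P.nu * P.a8 / (P.a8 + P.a0 + P.a2), 0] := by
  intro n hn V h0 h1 h2
  have g8 := ne_zero_of_ne_int h.a8_ne
  have hk : ∀ m : ℤ, P.a8 + P.a0 + P.a2 ≠ m := fun m hm =>
    h.a0_add_a2_add_a8_ne m (by rw [← hm]; ring)
  have gk := sub_natCast_ne_zero hk (n 0)
  have gk' := add_natCast_ne_zero hk (n 0)
  have gk0 := ne_zero_of_ne_int hk
  have gk2 := sq_sub_natCast_ne_zero hk (n 0)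
  simp only [forall_fin_four, Matrix.cons_val] at h0 h1 h2 ⊢
  obtain ⟨c0, c1, c2, c3⟩ := h0
  simp only [chartT, chartS, pick, Matrix.cons_val, Bool.not_false, Bool.not_true, if_true,
    if_false, Bool.false_eq_true, lin_add, lin_sub, lin_neg, lin_mul, lin_pow, lin_algebraMap,
    lin_one, lin_zero, lin_two, lin_three, lin_four, map_add, map_sub, map_mul, map_pow, map_zero,
    map_one, map_ofNat, map_neg, Nat.reduceSub, pow_one, Nat.cast_ofNat, constantCoeff_algebraMap,
    c0, c1, c2, c3, zero_mul, mul_zero, add_zero, sub_zero] at h1 h2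
  generalize lin 0 (V 0) = v0, lin 0 (V 1) = v1, lin 0 (V 2) = v2, lin 0 (V 3) = v3 at *
  have ha1 : P.a1 = 1 - 2 * P.nu - P.a0 - P.a2 - P.a8 := by
    have : P.a0 + P.a1 + P.a2 + P.a8 = 1 - 2 * P.nu := hrel
    linear_combination this
  rw [ha1] at h1
  generalize P.a0 = a0, P.a1 = a1, P.a2 = a2, P.a8 = a8, P.nu = nu, P.eta = eta at *
  obtain ⟨t0, t1, t2, t3⟩ := h1
  have hv1 : v1 = 0 := by
    refine (mul_eq_zero.1 (show (a8 + a0 + a2 + n 0) * v1 = 0 from ?_)).resolve_left gk'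
    linear_combination (norm := skip) -t1
    field_simp
    ring
  have hv3 : v3 = 0 := by
    refine (mul_eq_zero.1 (show (a8 + a0 + a2 - n 0) * v3 = 0 from ?_)).resolve_left gk
    linear_combination (norm := skip) t3
    field_simp
    ring
  subst hv1 hv3
  have key : v0 = 0 ∧ v2 = 0 := by
    refine eq_zero_of_traceless (a := 2 * nu * (a0 + a2) / a8 - (a8 + a0 + a2))
      (b := -2 * (a8 + a0 + a2) ^ 2 * (a0 + a2) / a8 ^ 3)
      (c := -2 * nu * a8 * ((a8 + a0 + a2) * a8 - nu * (a0 + a2)) / (a8 + a0 + a2) ^ 2)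
      (k := a8 + a0 + a2) ?_ gk2 ?_ ?_
    · field_simp
      ring
    · linear_combination (norm := skip) t0
      field_simp
      ring
    · linear_combination (norm := skip) t2
      field_simp
      ring
  exact ⟨key.1, rfl, key.2, rfl⟩

/-- The full `t₁`-Jacobian `J` satisfies `J² = k²` with `k = α_∞ + α₀ - α₂`, so an eigenvector for
`n₀` would give `k² = n₀²`. -/
theorem nonResonant_six {P : Params} (hrel : P.Relation) (h : P.Generic) :
    NonResonant P true true
      ![(P.a8 + P.a0 - P.a2) / P.a8, P.a2 / P.a8, -(P.nu + P.a2) * P.a8 / (P.a8 + P.a0 - P.a2),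
        P.a8] := by
  intro n hn V h0 h1 h2
  have g8 := ne_zero_of_ne_int h.a8_ne
  have hk : ∀ m : ℤ, P.a8 + P.a0 - P.a2 ≠ m := fun m hm =>
    h.a0_sub_a2_add_a8_ne m (by rw [← hm]; ring)
  have gk0 := ne_zero_of_ne_int hk
  have gk2 := sq_sub_natCast_ne_zero hk (n 0)
  simp only [forall_fin_four, Matrix.cons_val] at h0 h1 h2 ⊢
  obtain ⟨c0, c1, c2, c3⟩ := h0
  simp only [chartT, chartS, pick, Matrix.cons_val, Bool.not_false, Bool.not_true, if_true,
    if_false, Bool.false_eq_true, lin_add, lin_sub, lin_neg, lin_mul, lin_pow, lin_algebraMap,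
    lin_one, lin_zero, lin_two, lin_three, lin_four, map_add, map_sub, map_mul, map_pow, map_zero,
    map_one, map_ofNat, map_neg, Nat.reduceSub, pow_one, Nat.cast_ofNat, constantCoeff_algebraMap,
    c0, c1, c2, c3, zero_mul, mul_zero, add_zero, sub_zero] at h1 h2
  generalize lin 0 (V 0) = v0, lin 0 (V 1) = v1, lin 0 (V 2) = v2, lin 0 (V 3) = v3 at *
  have ha1 : P.a1 = 1 - 2 * P.nu - P.a0 - P.a2 - P.a8 := by
    have : P.a0 + P.a1 + P.a2 + P.a8 = 1 - 2 * P.nu := hrel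
    linear_combination this
  rw [ha1] at h1
  obtain ⟨k, hk⟩ : ∃ k, k = P.a8 + P.a0 - P.a2 := ⟨_, rfl⟩
  rw [← hk] at h1 gk0 gk2
  have ha0 : P.a0 = k - P.a8 + P.a2 := by rw [hk]; ring
  rw [ha0] at h1
  clear ha0 ha1 hk c0 c1 c2 c3 h2 h hrel
  generalize P.a2 = a2, P.a8 = a8, P.nu = nu at *
  obtain ⟨t0, t1, t2, t3⟩ := h1
  -- The four rows of `J v = n₀ v`, with the entries of `J` written in terms of `k`.
  have e0 : (2 * (nu + a2) * (k - a8) / a8 - k) * v0 + (-2 * k ^ 2 / a8) * v1 + (-2 * k ^ 2 * (k - a8) / a8 ^ 3) * v2 + (-2 * k ^ 2 * a2 / a8 ^ 3) * v3 = n 0 * v0 := by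
    linear_combination (norm := skip) t0
    field_simp
    ring
  have e1 : (2 * a2 * (nu + a2) / a8) * v0 + (k * (a8 - 2 * a2) / a8) * v1 + (-2 * k ^ 2 * a2 / a8 ^ 3) * v2 + (-2 * k * a2 * (a2 - a8) / a8 ^ 3) * v3 = n 0 * v1 := by
    linear_combination (norm := skip) t1
    field_simp
    ring
  have e2 : (-2 * (nu + a2) * a8 * (a8 * k - (nu + a2) * (k - a8)) / k ^ 2) * v0 + (-2 * a8 * (nu + a2)) * v1 + (-(2 * (nu + a2) * (k - a8) / a8 - k)) * v2 + (-(2 * a2 * (nu + a2) / a8)) * v3 = n 0 * v2 := by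
    linear_combination (norm := skip) t2
    field_simp
    ring
  have e3 : (-2 * a8 * (nu + a2)) * v0 + (2 * k * a8) * v1 + (-(-2 * k ^ 2 / a8)) * v2 + (-(k * (a8 - 2 * a2) / a8)) * v3 = n 0 * v3 := by
    linear_combination (norm := skip) t3
    field_simp
    ring
  clear t0 t1 t2 t3
  refine ⟨?_, ?_, ?_, ?_⟩
  · refine (mul_eq_zero.1 (show (k ^ 2 - (n 0 : ℂ) ^ 2) * v0 = 0 from ?_)).resolve_left gk2
    -- Applying a row of `J` to the system gives `J² v = n₀ J v`; adding `n₀` times the matching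
    -- equation gives `n₀² v` on the right.
    linear_combination (norm := skip) (2 * (nu + a2) * (k - a8) / a8 - k) * e0 + (-2 * k ^ 2 / a8) * e1 + (-2 * k ^ 2 * (k - a8) / a8 ^ 3) * e2 + (-2 * k ^ 2 * a2 / a8 ^ 3) * e3 + n 0 * e0
    field_simp
    ring
  · refine (mul_eq_zero.1 (show (k ^ 2 - (n 0 : ℂ) ^ 2) * v1 = 0 from ?_)).resolve_left gk2
    linear_combination (norm := skip) (2 * a2 * (nu + a2) / a8) * e0 + (k * (a8 - 2 * a2) / a8) * e1 + (-2 * k ^ 2 * a2 / a8 ^ 3) * e2 + (-2 * k * a2 * (a2 - a8) / a8 ^ 3) * e3 + n 0 * e1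
    field_simp
    ring
  · refine (mul_eq_zero.1 (show (k ^ 2 - (n 0 : ℂ) ^ 2) * v2 = 0 from ?_)).resolve_left gk2
    linear_combination (norm := skip) (-2 * (nu + a2) * a8 * (a8 * k - (nu + a2) * (k - a8)) / k ^ 2) * e0 + (-2 * a8 * (nu + a2)) * e1 + (-(2 * (nu + a2) * (k - a8) / a8 - k)) * e2 + (-(2 * a2 * (nu + a2) / a8)) * e3 + n 0 * e2
    field_simp
    ring
  · refine (mul_eq_zero.1 (show (k ^ 2 - (n 0 : ℂ) ^ 2) * v3 = 0 from ?_)).resolve_left gk2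
    linear_combination (norm := skip) (-2 * a8 * (nu + a2)) * e0 + (2 * k * a8) * e1 + (-(-2 * k ^ 2 / a8)) * e2 + (-(k * (a8 - 2 * a2) / a8)) * e3 + n 0 * e3
    field_simp
    ring

end NonResonance

end Garnier

namespace Garnier

section Initial

set_option linter.unusedSimpArgs false

/-! ## The eight equilibria -/

/-- Whether solution `k` is considered in a chart with a pole of `q₁` along `t₁ = 0`. -/
def poleT : Fin 8 → Bool := ![false, false, false, false, true, true, true, true]

/-- Whether solution `k` is considered in a chart with a pole of `p₂` along `s₂ = 0`. -/
def poleS : Fin 8 → Bool := ![false, false, true, true, false, false, true, true]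

/-- The constant terms of solution `k` in its chart. -/
noncomputable def initial (P : Params) : Fin 8 → Fin 4 → ℂ :=
  ![![P.eta / P.a8, (P.a8 + P.a1) / P.a8, 0, -P.nu * P.a8 / (P.a8 + P.a1)],
    ![-P.eta / P.a8, (P.a8 - P.a1) / P.a8, 0, -(P.a8 + P.nu) / (P.a8 - P.a1) * P.a8],
    ![-P.eta / P.a1, P.a2 / (P.a0 + P.a2), 0, 0],
    ![-P.eta / P.a1, P.a2 / (P.a2 - P.a0), 0, P.a2 - P.a0],
    ![(P.a8 + P.a0 + P.a2) / P.a8, 0, -P.nu * P.a8 / (P.a8 + P.a0 + P.a2), 0],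
    ![(P.a8 - P.a0 - P.a2) / P.a8, 0, -(P.nu + P.a8) * P.a8 / (P.a8 - P.a0 - P.a2), 0],
    ![(P.a8 + P.a0 - P.a2) / P.a8, P.a2 / P.a8, -(P.nu + P.a2) * P.a8 / (P.a8 + P.a0 - P.a2),
      P.a8],
    ![(P.a8 - P.a0 + P.a2) / P.a8, -P.a2 / P.a8,
      -(P.nu + P.a2 + P.a8) * P.a8 / (P.a8 - P.a0 + P.a2), -P.a8]]

/-- The substitution `α_∞ ↦ -α_∞`, `ν ↦ ν + α_∞`, which preserves the system. -/
def Params.swap (P : Params) : Params := { P with a8 := -P.a8, nu := P.nu + P.a8 }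

theorem Params.Relation.swap {P : Params} (h : P.Relation) : P.swap.Relation := by
  have : P.a0 + P.a1 + P.a2 + P.a8 = 1 - 2 * P.nu := h
  change P.a0 + P.a1 + P.a2 + -P.a8 = 1 - 2 * (P.nu + P.a8)
  linear_combination this

theorem Params.Generic.swap {P : Params} (h : P.Generic) : P.swap.Generic where
  eta_ne := h.eta_ne
  a1_ne := h.a1_ne
  a8_ne n hn := h.a8_ne (-n) (by
    have : -P.a8 = n := hn
    push_cast; linear_combination -this)
  a1_add_a8_ne := h.a1_sub_a8_ne
  a1_sub_a8_ne n hn := h.a1_add_a8_ne n (by rw [← hn]; simp [Params.swap])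
  a0_add_a2_ne := h.a0_add_a2_ne
  a0_sub_a2_ne := h.a0_sub_a2_ne
  a0_add_a2_add_a8_ne := h.a0_add_a2_sub_a8_ne
  a0_add_a2_sub_a8_ne n hn := h.a0_add_a2_add_a8_ne n (by rw [← hn]; simp [Params.swap])
  a0_sub_a2_add_a8_ne := h.a0_sub_a2_sub_a8_ne
  a0_sub_a2_sub_a8_ne n hn := h.a0_sub_a2_add_a8_ne n (by rw [← hn]; simp [Params.swap])

section

variable {K : Type*} [CommRing K] [Algebra ℂ K]

/-- `ν` and `α_∞` enter the vector fields only through `ν (ν + α_∞)`, which the substitution fixes.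
Solutions 2, 6, 8 therefore follow from 1, 5, 7. -/
theorem chartT_swap (P : Params) : chartT (K := K) P.swap = chartT P := by
  have : (P.nu + P.a8) * (P.nu + P.a8 + -P.a8) = P.nu * (P.nu + P.a8) := by ring
  funext e f t s Z
  simp only [chartT, Params.swap, this]

theorem chartS_swap (P : Params) : chartS (K := K) P.swap = chartS P := by
  have : (P.nu + P.a8) * (P.nu + P.a8 + -P.a8) = P.nu * (P.nu + P.a8) := by ring
  funext e f t s Z
  simp only [chartS, Params.swap, this]

end

theorem chartSol_swap (P : Params) : ChartSol P.swap = ChartSol P := by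
  funext e f Z
  simp only [ChartSol, chartT_swap, chartS_swap]

theorem nonResonant_swap (P : Params) : NonResonant P.swap = NonResonant P := by
  funext e f z0
  simp only [NonResonant, chartT_swap, chartS_swap]

theorem initial_swap_zero {P : Params} : initial P.swap 0 = initial P 1 := by
  funext i
  have h : -P.a8 + P.a1 = -(P.a8 - P.a1) := by ring
  revert i
  simp only [forall_fin_four, initial, Params.swap, Matrix.cons_val, h]
  generalize P.a8 - P.a1 = x
  refine ⟨?_, ?_, ?_, ?_⟩ <;> first | trivial | ring

theorem initial_swap_four {P : Params} : initial P.swap 4 = initial P 5 := by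
  funext i
  have h : -P.a8 + P.a0 + P.a2 = -(P.a8 - P.a0 - P.a2) := by ring
  revert i
  simp only [forall_fin_four, initial, Params.swap, Matrix.cons_val, h]
  generalize P.a8 - P.a0 - P.a2 = x
  refine ⟨?_, ?_, ?_, ?_⟩ <;> first | trivial | ring

theorem initial_swap_six {P : Params} : initial P.swap 6 = initial P 7 := by
  funext i
  have h : -P.a8 + P.a0 - P.a2 = -(P.a8 - P.a0 + P.a2) := by ring
  revert i
  simp only [forall_fin_four, initial, Params.swap, Matrix.cons_val, h]
  generalize P.a8 - P.a0 + P.a2 = x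
  refine ⟨?_, ?_, ?_, ?_⟩ <;> first | trivial | ring

theorem nonResonant_initial {P : Params} (hrel : P.Relation) (h : P.Generic) (k : Fin 8) :
    NonResonant P (poleT k) (poleS k) (initial P k) := by
  fin_cases k
  · exact nonResonant_zero hrel h
  · have := nonResonant_zero hrel.swap h.swap
    rw [nonResonant_swap] at this
    exact initial_swap_zero (P := P) ▸ this
  · exact nonResonant_two h
  · exact nonResonant_three h
  · exact nonResonant_four hrel h
  · have := nonResonant_four hrel.swap h.swap
    rw [nonResonant_swap] at this
    exact initial_swap_four (P := P) ▸ this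
  · exact nonResonant_six hrel h
  · have := nonResonant_six hrel.swap h.swap
    rw [nonResonant_swap] at this
    exact initial_swap_six (P := P) ▸ this

/-- The systems of the chart `(e, f)` have an equilibrium at `z0`. -/
def Equilibrium (P : Params) (e f : Bool) (z0 : Fin 4 → ℂ) : Prop :=
  (∀ i, chartT P e f 0 0 z0 i = 0) ∧ ∀ i, chartS P e f 0 0 z0 i = 0

theorem equilibrium_swap (P : Params) : Equilibrium P.swap = Equilibrium P := by
  funext e f z0
  simp only [Equilibrium, chartT_swap, chartS_swap]

theorem equilibrium_zero {P : Params} (hrel : P.Relation) (h : P.Generic) :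
    Equilibrium P false false (initial P 0) := by
  have g8 := ne_zero_of_ne_int h.a8_ne
  have gk := ne_zero_of_ne_int h.a1_add_a8_ne
  rw [add_comm P.a1] at gk
  have ha0 : P.a0 = 1 - 2 * P.nu - P.a1 - P.a2 - P.a8 := by
    have : P.a0 + P.a1 + P.a2 + P.a8 = 1 - 2 * P.nu := hrel
    linear_combination this
  constructor
  all_goals
    simp only [forall_fin_four, initial, chartT, chartS, pick, Matrix.cons_val, Bool.not_false,
      if_true, if_false, Bool.false_eq_true, Algebra.algebraMap_self, RingHom.id_apply, ha0]
    generalize P.a0 = a0, P.a1 = a1, P.a2 = a2, P.a8 = a8, P.nu = nu, P.eta = eta at *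
    refine ⟨?_, ?_, ?_, ?_⟩ <;> field_simp <;> ring

theorem equilibrium_two {P : Params} (h : P.Generic) :
    Equilibrium P false true (initial P 2) := by
  have g1 := ne_zero_of_ne_int h.a1_ne
  have gk := ne_zero_of_ne_int h.a0_add_a2_ne
  constructor
  all_goals
    simp only [forall_fin_four, initial, chartT, chartS, pick, Matrix.cons_val, Bool.not_true,
      Bool.not_false, if_true, if_false, Bool.false_eq_true, Algebra.algebraMap_self,
      RingHom.id_apply]
    generalize P.a0 = a0, P.a1 = a1, P.a2 = a2, P.a8 = a8, P.nu = nu, P.eta = eta at *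
    refine ⟨?_, ?_, ?_, ?_⟩ <;> field_simp <;> ring

theorem equilibrium_three {P : Params} (h : P.Generic) :
    Equilibrium P false true (initial P 3) := by
  have g1 := ne_zero_of_ne_int h.a1_ne
  have gk : P.a2 - P.a0 ≠ 0 := by
    rw [← neg_sub, neg_ne_zero]
    exact ne_zero_of_ne_int h.a0_sub_a2_ne
  constructor
  all_goals
    simp only [forall_fin_four, initial, chartT, chartS, pick, Matrix.cons_val, Bool.not_true,
      Bool.not_false, if_true, if_false, Bool.false_eq_true, Algebra.algebraMap_self,
      RingHom.id_apply]
    generalize P.a0 = a0, P.a1 = a1, P.a2 = a2, P.a8 = a8, P.nu = nu, P.eta = eta at *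
    refine ⟨?_, ?_, ?_, ?_⟩ <;> field_simp <;> ring

theorem equilibrium_four {P : Params} (hrel : P.Relation) (h : P.Generic) :
    Equilibrium P true false (initial P 4) := by
  have g8 := ne_zero_of_ne_int h.a8_ne
  have gk : P.a8 + P.a0 + P.a2 ≠ 0 := fun hk =>
    h.a0_add_a2_add_a8_ne 0 (by push_cast; linear_combination hk)
  have ha1 : P.a1 = 1 - 2 * P.nu - P.a0 - P.a2 - P.a8 := by
    have : P.a0 + P.a1 + P.a2 + P.a8 = 1 - 2 * P.nu := hrel
    linear_combination this
  constructor
  all_goals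
    simp only [forall_fin_four, initial, chartT, chartS, pick, Matrix.cons_val, Bool.not_true,
      Bool.not_false, if_true, if_false, Bool.false_eq_true, Algebra.algebraMap_self,
      RingHom.id_apply, ha1]
    generalize P.a0 = a0, P.a1 = a1, P.a2 = a2, P.a8 = a8, P.nu = nu, P.eta = eta at *
    refine ⟨?_, ?_, ?_, ?_⟩ <;> field_simp <;> ring

theorem equilibrium_six {P : Params} (hrel : P.Relation) (h : P.Generic) :
    Equilibrium P true true (initial P 6) := by
  have g8 := ne_zero_of_ne_int h.a8_ne
  have gk : P.a8 + P.a0 - P.a2 ≠ 0 := fun hk =>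
    h.a0_sub_a2_add_a8_ne 0 (by push_cast; linear_combination hk)
  have ha1 : P.a1 = 1 - 2 * P.nu - P.a0 - P.a2 - P.a8 := by
    have : P.a0 + P.a1 + P.a2 + P.a8 = 1 - 2 * P.nu := hrel
    linear_combination this
  constructor
  all_goals
    simp only [forall_fin_four, initial, chartT, chartS, pick, Matrix.cons_val, Bool.not_true,
      Bool.not_false, if_true, if_false, Bool.false_eq_true, Algebra.algebraMap_self,
      RingHom.id_apply, ha1]
    generalize P.a0 = a0, P.a1 = a1, P.a2 = a2, P.a8 = a8, P.nu = nu, P.eta = eta at *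
    refine ⟨?_, ?_, ?_, ?_⟩ <;> field_simp <;> ring

theorem equilibrium_initial {P : Params} (hrel : P.Relation) (h : P.Generic) (k : Fin 8) :
    Equilibrium P (poleT k) (poleS k) (initial P k) := by
  fin_cases k
  · exact equilibrium_zero hrel h
  · have := equilibrium_zero hrel.swap h.swap
    rw [equilibrium_swap] at this
    exact initial_swap_zero (P := P) ▸ this
  · exact equilibrium_two h
  · exact equilibrium_three h
  · exact equilibrium_four hrel h
  · have := equilibrium_four hrel.swap h.swap
    rw [equilibrium_swap] at this
    exact initial_swap_four (P := P) ▸ this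
  · exact equilibrium_six hrel h
  · have := equilibrium_six hrel.swap h.swap
    rw [equilibrium_swap] at this
    exact initial_swap_six (P := P) ▸ this

end Initial

end Garnier

namespace Garnier

section LeadingTerms

set_option linter.unusedSimpArgs false

/-! ## Leading coefficients -/

theorem constantCoeff_tP : MvPowerSeries.constantCoeff tP = 0 := by simp [tP]

theorem constantCoeff_sP : MvPowerSeries.constantCoeff sP = 0 := by simp [sP]

theorem coeff_tP_mul_sP_mul (n : Fin 2 →₀ ℕ) (F : Pow) :
    MvPowerSeries.coeff n (tP * sP * F)
      = if ix 1 1 ≤ n then MvPowerSeries.coeff (n - ix 1 1) F else 0 := by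
  have : tP * sP = MvPowerSeries.monomial (ix 1 1) 1 := by rw [monomial_ix, pow_one, pow_one]
  rw [this, MvPowerSeries.coeff_monomial_mul, one_mul]

theorem coeff_ix_zero_zero (F : Pow) :
    MvPowerSeries.coeff (ix 0 0) F = MvPowerSeries.constantCoeff F := by
  simp [ix]

/-- The coefficients of low order of a solution `F` of
`(s₂ - 1) s₂ ∂F/∂s₂ = F Φ + t₁ s₂ Ψ` without constant term. -/
theorem coeff_of_linear_eq {F Φ Ψ : Pow} {k : ℂ} (h : ∀ n : ℕ, k ≠ n)
    (h0 : MvPowerSeries.constantCoeff F = 0)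
    (hΦ : MvPowerSeries.constantCoeff Φ = -k)
    (hF : (sP - 1) * euler 1 F = F * Φ + tP * sP * Ψ) :
    MvPowerSeries.coeff (ix 1 0) F = 0 ∧ MvPowerSeries.coeff (ix 0 1) F = 0 ∧
      MvPowerSeries.coeff (ix 2 0) F = 0 ∧
      MvPowerSeries.coeff (ix 1 1) F = MvPowerSeries.constantCoeff Ψ / (k - 1) := by
  -- When `F` starts in degree `N`, the left side contributes `-n₁ Fₙ` and `F Φ` contributes `-k
  -- Fₙ`, so `Fₙ` is determined by `Ψ` as long as `k ≠ n₁`.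
  have key : ∀ N n, (∀ m, deg m < N → MvPowerSeries.coeff m F = 0) → deg n ≤ N →
      (k - n 1) * MvPowerSeries.coeff n F
        = if ix 1 1 ≤ n then MvPowerSeries.coeff (n - ix 1 1) Ψ else 0 := by
    intro N n hm hn
    have h1 := congrArg (MvPowerSeries.coeff n) hF
    rw [map_add, coeff_mul_of_vanish hm hn, coeff_tP_mul_sP_mul, mul_comm (sP - 1),
      coeff_mul_of_vanish (N := N) (fun m hm' => by rw [coeff_euler, hm m hm', mul_zero]) hn,
      coeff_euler, hΦ, map_sub, constantCoeff_sP, map_one MvPowerSeries.constantCoeff] at h1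
    linear_combination h1
  have e0 : ∀ m, deg m < 1 → MvPowerSeries.coeff m F = 0 := by
    intro m hm
    have : m = ix 0 0 := eq_ix_iff.2 (by simp only [deg] at hm; omega)
    rw [this, coeff_ix_zero_zero, h0]
  have h10 : MvPowerSeries.coeff (ix 1 0) F = 0 := by
    have := key 1 (ix 1 0) e0 (by simp [deg])
    rw [if_neg (by simp [ix_le_iff]), ix_one] at this
    exact (mul_eq_zero.1 this).resolve_left (sub_ne_zero.2 (h 0))
  have h01 : MvPowerSeries.coeff (ix 0 1) F = 0 := by
    have := key 1 (ix 0 1) e0 (by simp [deg])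
    rw [if_neg (by simp [ix_le_iff]), ix_one] at this
    exact (mul_eq_zero.1 this).resolve_left (sub_ne_zero.2 (h 1))
  have e1 : ∀ m, deg m < 2 → MvPowerSeries.coeff m F = 0 := by
    intro m hm
    have : m = ix 0 0 ∨ m = ix 1 0 ∨ m = ix 0 1 := by
      simp only [eq_ix_iff]; simp only [deg] at hm; omega
    rcases this with rfl | rfl | rfl
    · rw [coeff_ix_zero_zero, h0]
    · exact h10
    · exact h01
  refine ⟨h10, h01, ?_, ?_⟩
  · have := key 2 (ix 2 0) e1 (by simp [deg])
    rw [if_neg (by simp [ix_le_iff]), ix_one] at this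
    exact (mul_eq_zero.1 this).resolve_left (sub_ne_zero.2 (h 0))
  · have := key 2 (ix 1 1) e1 (by simp [deg])
    rw [if_pos le_rfl, ix_one, tsub_self, MvPowerSeries.coeff_zero_eq_constantCoeff_apply,
      Nat.cast_one] at this
    have h1 : k - 1 ≠ 0 := sub_ne_zero.2 (by simpa using h 1)
    rw [eq_div_iff h1]
    linear_combination this

/-- Every term of the `s₂`-equation for `p₁` is divisible by `p₁` or by `t₁ s₂`, so
`coeff_of_linear_eq` applies with `k = α_∞ + α₁`; hence `p₁` has no term before `t₁ s₂`. -/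
theorem leadingCoeff_zero {P : Params} (hrel : P.Relation) (h : P.Generic) {Z : Fin 4 → Pow}
    (hc : ∀ i, MvPowerSeries.constantCoeff (Z i) = initial P 0 i)
    (hZ : ChartSol P false false Z) :
    MvPowerSeries.coeff (ix 1 0) (Z 2) = 0 ∧ MvPowerSeries.coeff (ix 0 1) (Z 2) = 0 ∧
      MvPowerSeries.coeff (ix 2 0) (Z 2) = 0 ∧ MvPowerSeries.coeff (ix 1 1) (Z 2)
        = -P.nu * (P.nu + P.a2) * P.a8 / ((P.a8 + P.a1) * (1 - P.a8 - P.a1)) := by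
  have g8 := ne_zero_of_ne_int h.a8_ne
  have hk : ∀ n : ℕ, P.a8 + P.a1 ≠ n := fun n hn => h.a1_add_a8_ne n (by
    push_cast; rw [← hn]; ring)
  have gk : P.a8 + P.a1 ≠ 0 := by simpa using hk 0
  have gk1 : P.a8 + P.a1 - 1 ≠ 0 := sub_ne_zero.2 (by simpa using hk 1)
  have gk2 : 1 - P.a8 - P.a1 ≠ 0 := fun h0 => gk1 (by linear_combination -h0)
  simp only [forall_fin_four, initial, Matrix.cons_val] at hc
  obtain ⟨c0, c1, c2, c3⟩ := hc
  have h2 := (hZ 2).2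
  obtain ⟨h3, h4, h5, h6⟩ := coeff_of_linear_eq (F := Z 2)
    (Φ := -(2 * Z 0 * Z 1 * Z 2 + 2 * Z 1 * (Z 1 - sP) * Z 3
      - (algebraMap ℂ Pow P.a0 + algebraMap ℂ Pow P.a1 - 1) * Z 1
      - algebraMap ℂ Pow P.a2 * (Z 1 - sP)))
    (Ψ := -((sP - 1) * (Z 1 * Z 3 ^ 2 - algebraMap ℂ Pow P.a2 * Z 3))) hk c2 (by
      simp only [map_neg, map_sub, map_add, map_mul, map_ofNat, map_one, c0, c1, c2, c3,
        constantCoeff_algebraMap, constantCoeff_sP]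
      field_simp
      have : P.a0 + P.a1 + P.a2 + P.a8 = 1 - 2 * P.nu := hrel
      linear_combination P.a8 * (P.a8 + P.a1) * this) (by
      rw [h2]
      simp only [chartS, pick, Matrix.cons_val, Bool.not_false, if_true, if_false,
        Bool.false_eq_true]
      ring)
  refine ⟨h3, h4, h5, ?_⟩
  rw [h6]
  simp only [map_neg, map_sub, map_mul, map_pow, map_one, c1, c3,
    constantCoeff_algebraMap, constantCoeff_sP]
  field_simp
  ring

/-- The coefficients of `t₁` and `s₂` are compared in the `t₁`- and `s₂`-equations; the denominators
are the differences between the weight `1` and the eigenvalues. -/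
theorem leadingCoeff_two {P : Params} (h : P.Generic) {Z : Fin 4 → Pow}
    (hc : ∀ i, MvPowerSeries.constantCoeff (Z i) = initial P 2 i)
    (hZ : ChartSol P false true Z) :
    lin 0 (Z 2) = P.nu * (P.nu + P.a8) / (1 - P.a1) ∧ lin 0 (Z 3) = 0 ∧
      lin 1 (Z 3) = P.nu * (P.nu + P.a8) / (1 - P.a0 - P.a2) := by
  have g1 : 1 - P.a1 ≠ 0 := fun h0 => h.a1_ne 1 (by push_cast; linear_combination -h0)
  have g2 : 1 - P.a0 - P.a2 ≠ 0 := fun h0 => h.a0_add_a2_ne 1 (by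
    push_cast; linear_combination -h0)
  simp only [forall_fin_four, initial, Matrix.cons_val] at hc
  obtain ⟨c0, c1, c2, c3⟩ := hc
  have e1 := congrArg (lin 0) (hZ 2).1
  have e2 := congrArg (lin 0) (hZ 3).1
  have e3 := congrArg (lin 1) (hZ 3).2
  simp only [chartT, chartS, pick, Matrix.cons_val, Bool.not_false, Bool.not_true, if_true,
    if_false, Bool.false_eq_true, lin_add, lin_sub, lin_neg, lin_mul, lin_pow, lin_algebraMap,
    lin_one, lin_zero, lin_two, lin_three, lin_four, lin_zero_tP, lin_one_tP, lin_zero_sP,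
    lin_one_sP, lin_zero_euler_zero, lin_one_euler_one, constantCoeff_euler,
    constantCoeff_tP, constantCoeff_sP, map_add, map_sub, map_mul, map_pow, map_zero,
    map_one, map_ofNat, map_neg, Nat.reduceSub, pow_one, Nat.cast_ofNat, constantCoeff_algebraMap,
    c0, c1, c2, c3, zero_mul, mul_zero, add_zero, sub_zero, zero_add] at e1 e2 e3
  refine ⟨?_, by rw [e2]; ring, ?_⟩
  · rw [eq_div_iff g1]
    linear_combination e1
  · rw [eq_div_iff g2]
    linear_combination -e3

theorem leadingCoeff_three {P : Params} (hrel : P.Relation) (h : P.Generic) {Z : Fin 4 → Pow}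
    (hc : ∀ i, MvPowerSeries.constantCoeff (Z i) = initial P 3 i)
    (hZ : ChartSol P false true Z) :
    lin 0 (Z 2) = (P.nu + P.a2) * (P.nu + P.a2 + P.a8) / (1 - P.a1) := by
  have g1 : 1 - P.a1 ≠ 0 := fun h0 => h.a1_ne 1 (by push_cast; linear_combination -h0)
  have gk : P.a2 - P.a0 ≠ 0 := fun h0 => h.a0_sub_a2_ne 0 (by push_cast; linear_combination -h0)
  simp only [forall_fin_four, initial, Matrix.cons_val] at hc
  obtain ⟨c0, c1, c2, c3⟩ := hc
  have e1 := congrArg (lin 0) (hZ 2).1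
  simp only [chartT, chartS, pick, Matrix.cons_val, Bool.not_false, Bool.not_true, if_true,
    if_false, Bool.false_eq_true, lin_add, lin_sub, lin_neg, lin_mul, lin_pow, lin_algebraMap,
    lin_one, lin_zero, lin_two, lin_three, lin_four, lin_zero_tP, lin_one_tP, lin_zero_sP,
    lin_one_sP, lin_zero_euler_zero, lin_one_euler_one, constantCoeff_euler,
    constantCoeff_tP, constantCoeff_sP, map_add, map_sub, map_mul, map_pow, map_zero,
    map_one, map_ofNat, map_neg, Nat.reduceSub, pow_one, Nat.cast_ofNat, constantCoeff_algebraMap,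
    c0, c1, c2, c3, zero_mul, mul_zero, add_zero, sub_zero, zero_add] at e1
  rw [eq_div_iff g1]
  have : P.a0 + P.a1 + P.a2 + P.a8 = 1 - 2 * P.nu := hrel
  linear_combination (norm := skip) e1 - P.a2 * this
  field_simp
  ring

theorem leadingCoeff_four {P : Params} (hrel : P.Relation) (h : P.Generic) {Z : Fin 4 → Pow}
    (hc : ∀ i, MvPowerSeries.constantCoeff (Z i) = initial P 4 i)
    (hZ : ChartSol P true false Z) :
    lin 0 (Z 1) = 0 ∧ lin 1 (Z 1) = -P.a2 / P.a8 ∧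
      lin 0 (Z 3) = P.eta * P.nu * P.a8 / ((P.a1 + 2 * P.nu) * (P.a8 + P.a0 + P.a2)) := by
  have g8 := ne_zero_of_ne_int h.a8_ne
  have g02 := ne_zero_of_ne_int h.a0_add_a2_ne
  have gk : P.a8 + P.a0 + P.a2 ≠ 0 := fun h0 => h.a0_add_a2_add_a8_ne 0 (by
    push_cast; linear_combination h0)
  have gk' : 1 + (P.a8 + P.a0 + P.a2) ≠ 0 := fun h0 => h.a0_add_a2_add_a8_ne (-1) (by
    push_cast; linear_combination h0)
  have gk1 : 1 - (P.a8 + P.a0 + P.a2) ≠ 0 := fun h0 => h.a0_add_a2_add_a8_ne 1 (by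
    push_cast; linear_combination -h0)
  simp only [forall_fin_four, initial, Matrix.cons_val] at hc
  obtain ⟨c0, c1, c2, c3⟩ := hc
  have e1 := congrArg (lin 0) (hZ 1).1
  have e2 := congrArg (lin 1) (hZ 1).2
  have e3 := congrArg (lin 0) (hZ 3).1
  simp only [chartT, chartS, pick, Matrix.cons_val, Bool.not_false, Bool.not_true, if_true,
    if_false, Bool.false_eq_true, lin_add, lin_sub, lin_neg, lin_mul, lin_pow, lin_algebraMap,
    lin_one, lin_zero, lin_two, lin_three, lin_four, lin_zero_tP, lin_one_tP, lin_zero_sP,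
    lin_one_sP, lin_zero_euler_zero, lin_one_euler_one, constantCoeff_euler,
    constantCoeff_tP, constantCoeff_sP, map_add, map_sub, map_mul, map_pow, map_zero,
    map_one, map_ofNat, map_neg, Nat.reduceSub, pow_one, Nat.cast_ofNat, constantCoeff_algebraMap,
    c0, c1, c2, c3, zero_mul, mul_zero, add_zero, sub_zero, zero_add] at e1 e2 e3
  have ha1 : P.a1 = 1 - 2 * P.nu - P.a0 - P.a2 - P.a8 := by
    have : P.a0 + P.a1 + P.a2 + P.a8 = 1 - 2 * P.nu := hrel
    linear_combination this
  rw [ha1] at e1 e3 ⊢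
  -- By the Fuchs relation `α₁ + 2ν = 1 - (α_∞ + α₀ + α₂)`, which is nonzero by genericity.
  rw [show 1 - 2 * P.nu - P.a0 - P.a2 - P.a8 + 2 * P.nu = 1 - (P.a8 + P.a0 + P.a2) by ring]
  generalize lin 0 (Z 0) = v0, lin 0 (Z 1) = v1, lin 0 (Z 2) = v2, lin 0 (Z 3) = v3,
    lin 1 (Z 1) = w1 at *
  generalize P.a0 = a0, P.a2 = a2, P.a8 = a8, P.nu = nu, P.eta = eta at *
  clear hZ c0 c1 c2 c3 ha1 hrel
  refine ⟨?_, ?_, ?_⟩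
  · refine (mul_eq_zero.1 (show (1 + (a8 + a0 + a2)) * v1 = 0 from ?_)).resolve_left gk'
    linear_combination (norm := skip) e1
    field_simp
    ring
  · rw [eq_div_iff g8]
    -- The `s₂`-equation determines `α₀ + α₂` times this coefficient, whence the cancellation.
    refine mul_left_cancel₀ g02 ?_
    linear_combination (norm := skip) -a8 * e2
    field_simp
    ring
  · rw [eq_div_iff (mul_ne_zero gk1 gk)]
    linear_combination (norm := skip) (a8 + a0 + a2) * e3
    field_simp
    ring

end LeadingTerms

end Garnier

namespace Garnier

/-! ## The eight solutions -/

theorem coeff_lift (e f : Bool) (Z : Fin 4 → Pow) (i : Fin 4) :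
    (lift e f Z i).coeff (ex e f i) = MvPowerSeries.constantCoeff (Z i) := by
  have := coeff_mono_mul (ex e f i).1 (ex e f i).2 (toL (Z i)) 0
  rw [zero_add] at this
  rw [← MvPowerSeries.coeff_zero_eq_constantCoeff_apply, ← toL_coeff, lift]
  exact this

theorem leading_lift {P : Params} (hrel : P.Relation) (h : P.Generic) {k : Fin 8}
    {Z : Fin 4 → Pow} (hc : ∀ i, MvPowerSeries.constantCoeff (Z i) = initial P k i)
    (hZ : ChartSol P (poleT k) (poleS k) Z) (hconv : ∀ i, IsConvergent (Z i)) :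
    Leading R P k (lift (poleT k) (poleS k) Z) := by
  have hc' := forall_fin_four.1 hc
  fin_cases k
  · obtain ⟨h3, h4, h5, h6⟩ := leadingCoeff_zero hrel h hc hZ
    exact ⟨hasForm_one (hconv 0) hc'.1, hasForm_one (hconv 1) hc'.2.1,
      hasForm_ts (hconv 2) hc'.2.2.1 h3 h4 h5 h6, hasForm_one (hconv 3) hc'.2.2.2⟩
  · have hs := leadingCoeff_zero hrel.swap h.swap (Z := Z) (by rw [initial_swap_zero]; exact hc)
      (by rw [chartSol_swap]; exact hZ)
    obtain ⟨h3, h4, h5, h6⟩ := hs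
    refine ⟨hasForm_one (hconv 0) hc'.1, hasForm_one (hconv 1) hc'.2.1,
      hasForm_ts (hconv 2) hc'.2.2.1 h3 h4 h5 (h6.trans ?_), hasForm_one (hconv 3) hc'.2.2.2⟩
    simp only [Params.swap]
    rw [show -P.a8 + P.a1 = -(P.a8 - P.a1) by ring,
      show 1 - -P.a8 - P.a1 = 1 + P.a8 - P.a1 by ring]
    generalize P.a8 - P.a1 = x, 1 + P.a8 - P.a1 = y
    ring
  · obtain ⟨h3, h4, h5⟩ := leadingCoeff_two h hc hZ
    exact ⟨hasForm_one (hconv 0) hc'.1, hasForm_one (hconv 1) hc'.2.1,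
      hasForm_t (hconv 2) hc'.2.2.1 ((coeff_ix_one_zero _).trans h3),
      hasForm_s (hconv 3) hc'.2.2.2 ((coeff_ix_one_zero _).trans h4)
        ((coeff_ix_zero_one _).trans h5)⟩
  · have h3 := leadingCoeff_three hrel h hc hZ
    exact ⟨hasForm_one (hconv 0) hc'.1, hasForm_one (hconv 1) hc'.2.1,
      hasForm_t (hconv 2) hc'.2.2.1 ((coeff_ix_one_zero _).trans h3),
      hasForm_one (hconv 3) hc'.2.2.2⟩
  · obtain ⟨h3, h4, h5⟩ := leadingCoeff_four hrel h hc hZ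
    exact ⟨hasForm_one (hconv 0) hc'.1, hasForm_s (hconv 1) hc'.2.1
        ((coeff_ix_one_zero _).trans h3) ((coeff_ix_zero_one _).trans h4),
      hasForm_one (hconv 2) hc'.2.2.1,
      hasForm_t (hconv 3) hc'.2.2.2 ((coeff_ix_one_zero _).trans h5)⟩
  · have hs := leadingCoeff_four hrel.swap h.swap (Z := Z) (by rw [initial_swap_four]; exact hc)
      (by rw [chartSol_swap]; exact hZ)
    obtain ⟨h3, h4, h5⟩ := hs
    refine ⟨hasForm_one (hconv 0) hc'.1, hasForm_s (hconv 1) hc'.2.1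
        ((coeff_ix_one_zero _).trans h3) ((coeff_ix_zero_one _).trans (h4.trans ?_)),
      hasForm_one (hconv 2) hc'.2.2.1,
      hasForm_t (hconv 3) hc'.2.2.2 ((coeff_ix_one_zero _).trans (h5.trans ?_))⟩
    · simp only [Params.swap]
      rw [neg_div_neg_eq]
    · have hr : P.a0 + P.a1 + P.a2 + P.a8 = 1 - 2 * P.nu := hrel
      simp only [Params.swap]
      rw [show -P.a8 + P.a0 + P.a2 = -(P.a8 - P.a0 - P.a2) by ring,
        show P.a1 + 2 * (P.nu + P.a8) = 1 + P.a8 - P.a0 - P.a2 by linear_combination hr]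
      generalize P.a8 - P.a0 - P.a2 = x, 1 + P.a8 - P.a0 - P.a2 = y
      rw [mul_neg, mul_neg, neg_div_neg_eq]
      ring
  · exact ⟨hasForm_one (hconv 0) hc'.1, hasForm_one (hconv 1) hc'.2.1,
      hasForm_one (hconv 2) hc'.2.2.1, hasForm_one (hconv 3) hc'.2.2.2⟩
  · exact ⟨hasForm_one (hconv 0) hc'.1, hasForm_one (hconv 1) hc'.2.1,
      hasForm_one (hconv 2) hc'.2.2.1, hasForm_one (hconv 3) hc'.2.2.2⟩

theorem eq_lift_of_forall {e f : Bool} {z0 : Fin 4 → ℂ} {w : Fin 4 → Laurent}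
    (hw : ∀ i, ∃ F : Pow, w i = mono (ex e f i).1 (ex e f i).2 1 * toL F ∧
      MvPowerSeries.constantCoeff F = z0 i) :
    ∃ Z, w = lift e f Z ∧ ∀ i, MvPowerSeries.constantCoeff (Z i) = z0 i := by
  choose Z hZ using hw
  exact ⟨Z, funext fun i => (hZ i).1, fun i => (hZ i).2⟩

/-- The leading terms fix the chart and the constant terms there; the higher prescribed coefficients
are then consequences of the system. -/
theorem Leading.eq_lift {A : Subring Pow} {P : Params} {k : Fin 8} {w : Fin 4 → Laurent}
    (h : Leading A P k w) : ∃ Z, w = lift (poleT k) (poleS k) Z ∧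
      ∀ i, MvPowerSeries.constantCoeff (Z i) = initial P k i := by
  refine eq_lift_of_forall (forall_fin_four.2 ?_)
  fin_cases k
  · exact ⟨h.1.pow_one, h.2.1.pow_one, h.2.2.1.pow_ts, h.2.2.2.pow_one⟩
  · exact ⟨h.1.pow_one, h.2.1.pow_one, h.2.2.1.pow_ts, h.2.2.2.pow_one⟩
  · exact ⟨h.1.pow_one, h.2.1.pow_one, h.2.2.1.pow_t, h.2.2.2.pow_s⟩
  · exact ⟨h.1.pow_one, h.2.1.pow_one, h.2.2.1.pow_t, h.2.2.2.pow_one⟩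
  · exact ⟨h.1.pow_one, h.2.1.pow_s, h.2.2.1.pow_one, h.2.2.2.pow_t⟩
  · exact ⟨h.1.pow_one, h.2.1.pow_s, h.2.2.1.pow_one, h.2.2.2.pow_t⟩
  · exact ⟨h.1.pow_one, h.2.1.pow_one, h.2.2.1.pow_one, h.2.2.2.pow_one⟩
  · exact ⟨h.1.pow_one, h.2.1.pow_one, h.2.2.1.pow_one, h.2.2.2.pow_one⟩

theorem exists_solution {P : Params} (hrel : P.Relation) (h : P.Generic) (k : Fin 8) :
    ∃ Z : Fin 4 → Pow, (∀ i, MvPowerSeries.constantCoeff (Z i) = initial P k i) ∧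
      Leading R P k (lift (poleT k) (poleS k) Z) ∧
      IsFormalSolution P (lift (poleT k) (poleS k) Z) ∧
      (∃ r : ℝ, 0 < r ∧ ∃ f : Fin 4 → ℂ × ℂ → ℂ,
        (∀ i, ConvergesTo r (lift (poleT k) (poleS k) Z i) (f i)) ∧
          IsMeromorphicSolution P r f) ∧
      ∀ w : Fin 4 → Laurent, Leading ⊤ P k w → IsFormalSolution P w →
        w = lift (poleT k) (poleS k) Z := by
  obtain ⟨Z, hc, hZ, ⟨r, hr, hs⟩, hu⟩ := exists_chartSol (equilibrium_initial hrel h k).1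
    (equilibrium_initial hrel h k).2 (nonResonant_initial hrel h k)
  refine ⟨Z, hc, leading_lift hrel h hc hZ fun i => ⟨r, hr, hs i⟩,
    (isFormalSolution_lift_iff _ _ _ _).2 hZ, ⟨r / 2, half_pos hr, _,
      fun i => convergesTo_liftVal hr _ _ i (hs i), isMeromorphicSolution_liftVal P hr _ _ hs hZ⟩,
    fun w hw hsol => ?_⟩
  obtain ⟨Z', rfl, hc'⟩ := hw.eq_lift
  rw [hu Z' hc' ((isFormalSolution_lift_iff _ _ _ _).1 hsol)]

/-! ## The solutions are pairwise distinct -/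

theorem coeff_lift_of_notMem (e f : Bool) (Z : Fin 4 → Pow) (i : Fin 4) {n : ℤ × ℤ}
    (hn : ¬ (0 ≤ n.1 - (ex e f i).1 ∧ 0 ≤ n.2 - (ex e f i).2)) : (lift e f Z i).coeff n = 0 := by
  have h1 := coeff_mono_mul (ex e f i).1 (ex e f i).2 (toL (Z i)) (n - ex e f i)
  rw [show ((ex e f i).1, (ex e f i).2) = ex e f i from rfl, sub_add_cancel] at h1
  rw [lift, h1]
  refine toL_coeff_of_notMem _ ?_
  rintro ⟨m, hm⟩
  rw [Prod.ext_iff] at hm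
  simp only [Prod.fst_sub, Prod.snd_sub] at hm
  rw [← hm.1, ← hm.2] at hn
  exact hn ⟨Int.natCast_nonneg _, Int.natCast_nonneg _⟩

/-- The coefficients that distinguish the solutions: those of `q₁` at `t₁⁻¹`, of `p₂` at `s₂⁻¹`,
and the constant term of `q₁`. -/
theorem coeff_lift_initial {P : Params} (k : Fin 8) {Z : Fin 4 → Pow}
    (hc : ∀ i, MvPowerSeries.constantCoeff (Z i) = initial P k i) :
    (lift (poleT k) (poleS k) Z 0).coeff (-1, 0) = (if poleT k then initial P k 0 else 0) ∧
      (lift (poleT k) (poleS k) Z 3).coeff (0, -1) = (if poleS k then initial P k 3 else 0) ∧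
      (poleT k = false → (lift (poleT k) (poleS k) Z 0).coeff (0, 0) = initial P k 0) := by
  have h0 := coeff_lift (poleT k) (poleS k) Z 0
  have h3 := coeff_lift (poleT k) (poleS k) Z 3
  rw [hc] at h0 h3
  refine ⟨?_, ?_, fun h => ?_⟩
  · cases he : poleT k
    · exact coeff_lift_of_notMem _ _ _ _ (by simp [ex, bit])
    · rw [he] at h0
      exact h0
  · cases he : poleS k
    · exact coeff_lift_of_notMem _ _ _ _ (by simp [ex, bit])
    · rw [he] at h3
      exact h3
  · rw [h] at h0 ⊢
    exact h0

/-- The coefficient of `q₁` at `t₁⁻¹` separates 1–4 from 5–8, and 5 from 6. That of `p₂` at `s₂⁻¹`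
isolates 4 among the first four, separates 7 and 8 from 5 and 6, and 7 from 8. Solution 3 has none,
so 1, 2, 3 are told apart by the constant terms `η/α_∞`, `-η/α_∞`, `-η/α₁` of `q₁`. -/
theorem initial_distinct {P : Params} (h : P.Generic) {j k : Fin 8}
    (h1 : (if poleT j then initial P j 0 else 0) = if poleT k then initial P k 0 else 0)
    (h2 : (if poleS j then initial P j 3 else 0) = if poleS k then initial P k 3 else 0)
    (h3 : poleT j = false → poleT k = false → initial P j 0 = initial P k 0) : j = k := by
  have g8 := ne_zero_of_ne_int h.a8_ne
  have g1 := ne_zero_of_ne_int h.a1_ne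
  have f0 : P.eta / P.a8 ≠ -P.eta / P.a8 := fun he => by
    rw [div_left_inj' g8, self_eq_neg] at he
    exact h.eta_ne he
  have f1 : P.eta / P.a8 ≠ -P.eta / P.a1 := fun he => by
    rw [div_eq_div_iff g8 g1] at he
    refine mul_ne_zero h.eta_ne (ne_zero_of_ne_int h.a1_add_a8_ne) ?_
    linear_combination he
  have f2 : -P.eta / P.a8 ≠ -P.eta / P.a1 := fun he => by
    rw [div_eq_div_iff g8 g1] at he
    refine mul_ne_zero h.eta_ne (ne_zero_of_ne_int h.a1_sub_a8_ne) ?_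
    linear_combination -he
  have f3 : P.a2 - P.a0 ≠ 0 := fun he => h.a0_sub_a2_ne 0 (by push_cast; linear_combination -he)
  have f4 : (P.a8 + P.a0 + P.a2) / P.a8 ≠ 0 := div_ne_zero (fun he =>
    h.a0_add_a2_add_a8_ne 0 (by push_cast; linear_combination he)) g8
  have f5 : (P.a8 - P.a0 - P.a2) / P.a8 ≠ 0 := div_ne_zero (fun he =>
    h.a0_add_a2_sub_a8_ne 0 (by push_cast; linear_combination -he)) g8
  have f6 : (P.a8 + P.a0 - P.a2) / P.a8 ≠ 0 := div_ne_zero (fun he =>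
    h.a0_sub_a2_add_a8_ne 0 (by push_cast; linear_combination he)) g8
  have f7 : (P.a8 - P.a0 + P.a2) / P.a8 ≠ 0 := div_ne_zero (fun he =>
    h.a0_sub_a2_sub_a8_ne 0 (by push_cast; linear_combination -he)) g8
  have f8 : (P.a8 + P.a0 + P.a2) / P.a8 ≠ (P.a8 - P.a0 - P.a2) / P.a8 := fun he => by
    rw [div_left_inj' g8] at he
    exact h.a0_add_a2_ne 0 (by push_cast; linear_combination he / 2)
  have f9 : P.a8 ≠ -P.a8 := fun he => g8 (self_eq_neg.1 he)
  have g8' : -P.a8 ≠ 0 := neg_ne_zero.2 g8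
  fin_cases j <;> fin_cases k <;> first
    | rfl
    | exfalso
      first
      | exact f4 h1
      | exact f5 h1
      | exact f6 h1
      | exact f7 h1
      | exact f8 h1
      | exact f4 h1.symm
      | exact f5 h1.symm
      | exact f6 h1.symm
      | exact f7 h1.symm
      | exact f8 h1.symm
      | exact f3 h2
      | exact g8 h2
      | exact g8' h2
      | exact f9 h2
      | exact f3 h2.symm
      | exact g8 h2.symm
      | exact g8' h2.symm
      | exact f9 h2.symm
      | exact f0 (h3 rfl rfl)
      | exact f1 (h3 rfl rfl)
      | exact f2 (h3 rfl rfl)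
      | exact f0 (h3 rfl rfl).symm
      | exact f1 (h3 rfl rfl).symm
      | exact f2 (h3 rfl rfl).symm

end Garnier
theorem mainTheorem1 (P : Garnier.Params) (hrel : P.Relation) (hgen : P.Generic) :
    ∃ z : Fin 8 → Fin 4 → Garnier.Laurent,
      Function.Injective z ∧
      ∀ k : Fin 8,
        -- the prescribed leading terms, with error terms in ideals of convergent power series
        Garnier.Leading Garnier.R P k (z k) ∧
        -- the series solve the system and converge to a meromorphic solution
        Garnier.IsFormalSolution P (z k) ∧
        (∃ r : ℝ, 0 < r ∧ ∃ f : Fin 4 → ℂ × ℂ → ℂ,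
          (∀ i, Garnier.ConvergesTo r (z k i) (f i)) ∧ Garnier.IsMeromorphicSolution P r f) ∧
        -- all other coefficients are determined by the leading terms and the system
        (∀ w : Fin 4 → Garnier.Laurent,
          Garnier.Leading ⊤ P k w → Garnier.IsFormalSolution P w → w = z k) := by
  choose Z hc hlead hsol hmer huniq using Garnier.exists_solution hrel hgen
  refine ⟨fun k => Garnier.lift (Garnier.poleT k) (Garnier.poleS k) (Z k), fun j k hjk => ?_,
    fun k => ⟨hlead k, hsol k, hmer k, huniq k⟩⟩
  obtain ⟨h1, h2, h3⟩ := Garnier.coeff_lift_initial j (hc j)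
  obtain ⟨h1', h2', h3'⟩ := Garnier.coeff_lift_initial k (hc k)
  simp only at hjk
  rw [hjk] at h1 h2 h3
  exact Garnier.initial_distinct hgen (h1.symm.trans h1') (h2.symm.trans h2')
    fun hj hk => (h3 hj).symm.trans (h3' hk)
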